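/- Let $L_3$ be the closure of the $4$-strand braid $(\sigma_1\sigma_2\sigma_3)^4\sigma_1\sigma_2$, where the $\sigma_i$ are the standard generators with positive crossings. It is a link with two components, an unknot (the closure of the fourth strand) and a torus knot $T(3,4)$ (formed by the first three strands). For a positive integer $k$ let $$L_3^k = L_3 \,\#\, \cdots \,\#\, L_3 \,\#\, T(2,3)$$ be the $(k+1)$-component link with $k$ factors $L_3$, where $T(2,3)$ is the trefoil, the closure of $\sigma_1^3$; in each consecutive connected sum $L_3\,\#\,L_3$ the unknot component of the left $L_3$ is connected with the $T(3,4)$-component of the right $L_3$, and the unknot component of the last $L_3$ is connected with $T(2,3)$. Then for every $l\in\{1,\ldots,k\}$ the integral bigraded Khovanov cohomology $H_{\mathrm{Kh}}^{*,*}(L_3^k)$ contains a direct summand isomorphic to $\mathbb{Z}/3^l\mathbb{Z}$, that is, there is a bidegree $(i,j)$ such that $H_{\mathrm{Kh}}^{i,j}(L_3^k)$ has a direct summand isomorphic to $\mathbb{Z}/3^l\mathbb{Z}$. -/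

import Mathlib

noncomputable section

/-- An oriented link diagram, given by its combinatorial (signed Gauss / planar diagram) code.

The crossings are numbered by `Fin n`.  The strand passes over (`true`) and under (`false`) each
crossing once, and it may carry further marked points `Pt`.  These passages cut the link into
oriented edges: `inEdge p` is the edge that ends at the passage `p`, and `outEdge p` is the edge
that starts there.  Every edge ends at exactly one passage and starts at exactly one passage. -/
structure LinkDiagram where
  Edge : Type
  finite_edge : Finite Edge
  n : ℕ
  Pt : Type
  positive : Fin n → Bool
  inEdge : (Fin n × Bool) ⊕ Pt ≃ Edge
  outEdge : (Fin n × Bool) ⊕ Pt ≃ Edge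

namespace LinkDiagram

instance (D : LinkDiagram) : Finite D.Edge := D.finite_edge

section Khovanov

variable (D : LinkDiagram)

def overIn (c : Fin D.n) : D.Edge := D.inEdge (Sum.inl (c, true))

def overOut (c : Fin D.n) : D.Edge := D.outEdge (Sum.inl (c, true))

def underIn (c : Fin D.n) : D.Edge := D.inEdge (Sum.inl (c, false))

def underOut (c : Fin D.n) : D.Edge := D.outEdge (Sum.inl (c, false))

/-- The number of positive crossings. -/
def nPos : ℕ := (Finset.univ.filter fun c => D.positive c = true).card

/-- The number of negative crossings. -/
def nNeg : ℕ := (Finset.univ.filter fun c => D.positive c = false).card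

/-- A vertex of the cube of resolutions: `false` is the `0`-smoothing, `true` the `1`-smoothing. -/
abbrev Vertex : Type := Fin D.n → Bool

/-- `D.Joined v e f`: the edges `e` and `f` are joined directly in the resolution `v`, at a marked
point or by one of the two arcs that replace a crossing.  The `0`-smoothing of a positive crossing
and the `1`-smoothing of a negative crossing are the smoothings compatible with the orientation. -/
inductive Joined (v : D.Vertex) : D.Edge → D.Edge → Prop
  | point (s : D.Pt) : Joined v (D.inEdge (Sum.inr s)) (D.outEdge (Sum.inr s))
  | oriented_left (c : Fin D.n) (h : v c ≠ D.positive c) : Joined v (D.underIn c) (D.overOut c)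
  | oriented_right (c : Fin D.n) (h : v c ≠ D.positive c) : Joined v (D.overIn c) (D.underOut c)
  | unoriented_in (c : Fin D.n) (h : v c = D.positive c) : Joined v (D.underIn c) (D.overIn c)
  | unoriented_out (c : Fin D.n) (h : v c = D.positive c) : Joined v (D.underOut c) (D.overOut c)

/-- The circles of the resolution `v`: classes of edges under the equivalence relation generated
by `Joined`. -/
def Circle (v : D.Vertex) : Type := Quot (D.Joined v)

instance (v : D.Vertex) : Finite (D.Circle v) := inferInstanceAs (Finite (Quot (D.Joined v)))

/-- The circle of the resolution `v` through the edge `e`. -/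
def circle (v : D.Vertex) (e : D.Edge) : D.Circle v := Quot.mk _ e

/-- The standard generators of the Khovanov complex: a vertex `v` of the cube with a basis element
`X ^ a`, `a = 0, 1`, of `ℤ[X]/(X²)` for each circle of the resolution `v` (recorded by `a`). -/
abbrev Generator : Type := Σ v : D.Vertex, D.Circle v → Fin 2

open Classical in
instance (v : D.Vertex) : Fintype (D.Circle v) := Fintype.ofFinite _

open Classical in
instance : Fintype D.Generator := inferInstance

variable {D}

/-- The number of `1`-smoothings. -/
def Generator.weight (x : D.Generator) : ℕ := (Finset.univ.filter fun c => x.1 c = true).card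

/-- The homological degree. -/
def Generator.hdeg (x : D.Generator) : ℤ := x.weight - D.nNeg

/-- The quantum degree; here `1` has degree `1` and `X` has degree `-1`. -/
def Generator.qdeg (x : D.Generator) : ℤ :=
  (∑ γ : D.Circle x.1, (1 - 2 * ((x.2 γ : ℕ) : ℤ))) + x.weight + D.nPos - 2 * D.nNeg

/-- The coefficient of `X ^ c` in the product of `X ^ a` and `X ^ b` in `ℤ[X]/(X²)`. -/
def mulCoeff (a b c : Fin 2) : ℤ := if (a : ℕ) + b = c then 1 else 0

/-- The coefficient of `X ^ b ⊗ X ^ c` in `Δ (X ^ a)`, where `Δ 1 = 1 ⊗ X + X ⊗ 1` and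
`Δ X = X ⊗ X`. -/
def comulCoeff (a b c : Fin 2) : ℤ := if (b : ℕ) + c = a + 1 then 1 else 0

open Classical in
/-- The matrix entry from `x` to `y` of multiplication or comultiplication at the crossing `c`, if
the vertex of `y` is obtained from the vertex of `x` by changing `c` from `0` to `1`.  In both
smoothings of `c`, one of the two arcs contains an end of `underIn c` and the other one an end
of `underOut c`. -/
def edgeCoeff (x y : D.Generator) (c : Fin D.n) : ℤ :=
  if D.circle x.1 (D.underIn c) ≠ D.circle x.1 (D.underOut c) then
    -- two circles merge
    mulCoeff (x.2 (D.circle x.1 (D.underIn c))) (x.2 (D.circle x.1 (D.underOut c)))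
      (y.2 (D.circle y.1 (D.underIn c)))
  else if D.circle y.1 (D.underIn c) ≠ D.circle y.1 (D.underOut c) then
    -- one circle splits
    comulCoeff (x.2 (D.circle x.1 (D.underIn c))) (y.2 (D.circle y.1 (D.underIn c)))
      (y.2 (D.circle y.1 (D.underOut c)))
  else 0 -- does not occur for a planar diagram

/-- There is an edge of the cube of resolutions in the direction `c` from the vertex of `x` to that
of `y`, and `x` and `y` agree on all circles that do not meet the crossing `c`. -/
def Adjacent (x y : D.Generator) (c : Fin D.n) : Prop :=
  x.1 c = false ∧ y.1 = Function.update x.1 c true ∧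
    ∀ e : D.Edge, D.circle x.1 e ≠ D.circle x.1 (D.underIn c) →
      D.circle x.1 e ≠ D.circle x.1 (D.underOut c) →
      x.2 (D.circle x.1 e) = y.2 (D.circle y.1 e)

open Classical in
/-- The matrix entry from `x` to `y` of the Khovanov differential. -/
def incidence (x y : D.Generator) : ℤ :=
  ∑ c : Fin D.n, if Adjacent x y c then
    (-1) ^ (Finset.univ.filter fun b => b < c ∧ x.1 b = true).card * edgeCoeff x y c else 0

variable (D)

/-- The Khovanov cochain group in homological degree `i` and quantum degree `j`. -/
abbrev Cochain (i j : ℤ) : Type := {x : D.Generator // x.hdeg = i ∧ x.qdeg = j} → ℤ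

open Classical in
/-- The Khovanov differential from homological degree `i` to homological degree `i'` in quantum
degree `j`.  It vanishes unless `i' = i + 1`. -/
def differential (i i' j : ℤ) : D.Cochain i j →ₗ[ℤ] D.Cochain i' j :=
  Matrix.mulVecLin (Matrix.of fun y x => incidence x.1 y.1)

/-- The integral Khovanov cohomology of a link diagram in bidegree `(i, j)`. -/
abbrev Kh (i j : ℤ) : Type :=
  LinearMap.ker (D.differential i (i + 1) j) ⧸
    (LinearMap.range (D.differential (i - 1) i j)).submoduleOf
      (LinearMap.ker (D.differential i (i + 1) j))

end Khovanov

/-- The passages of a disjoint union. -/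
def sumPassages (m n : ℕ) (P Q : Type) :
    (Fin (m + n) × Bool) ⊕ (P ⊕ Q) ≃ ((Fin m × Bool) ⊕ P) ⊕ ((Fin n × Bool) ⊕ Q) :=
  (Equiv.sumCongr ((Equiv.prodCongr finSumFinEquiv.symm (Equiv.refl Bool)).trans
    (Equiv.sumProdDistrib _ _ _)) (Equiv.refl _)).trans (Equiv.sumSumSumComm _ _ _ _)

open Classical in
/-- The connected sum of two diagrams along the edges `p` and `q`: both edges are cut, the first
half of `p` is continued by the second half of `q` (the result is called `p` again), and the first
half of `q` by the second half of `p`. -/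
def connectedSum (D₁ D₂ : LinkDiagram) (p : D₁.Edge) (q : D₂.Edge) : LinkDiagram where
  Edge := D₁.Edge ⊕ D₂.Edge
  finite_edge := inferInstance
  n := D₁.n + D₂.n
  Pt := D₁.Pt ⊕ D₂.Pt
  positive := Fin.append D₁.positive D₂.positive
  inEdge := ((sumPassages D₁.n D₂.n D₁.Pt D₂.Pt).trans (Equiv.sumCongr D₁.inEdge D₂.inEdge)).trans
    (Equiv.swap (Sum.inl p) (Sum.inr q))
  outEdge := (sumPassages D₁.n D₂.n D₁.Pt D₂.Pt).trans (Equiv.sumCongr D₁.outEdge D₂.outEdge)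

section Braid

variable {m : ℕ} (w : List (Fin m))

/-- The edge on which the strand enters the crossing number `t` of a braid word, from the left on
the overpass and from the right on the underpass. -/
def braidIn (p : Fin w.length × Bool) : Fin (w.length + 1) × Fin (m + 1) :=
  (p.1.castSucc, if p.2 then (w.get p.1).castSucc else (w.get p.1).succ)

theorem braidIn_injective : Function.Injective (braidIn w) := by
  rintro ⟨t, a⟩ ⟨t', a'⟩ h
  simp only [braidIn, Prod.mk.injEq] at h
  obtain ⟨h1, h2⟩ := h
  have h1' := Fin.castSucc_injective _ h1
  subst h1'
  cases a <;> cases a' <;> simp [Fin.ext_iff] at h2 ⊢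

/-- The passages of the closed braid: the crossings, and one marked point for each strand at each
level at which this strand does not meet a crossing. -/
def braidPassages : (Fin w.length × Bool) ⊕ {e // e ∉ Set.range (braidIn w)} ≃
    Fin (w.length + 1) × Fin (m + 1) :=
  open Classical in
  (Equiv.sumCongr (Equiv.ofInjective _ (braidIn_injective w)) (Equiv.refl _)).trans
    (Equiv.Set.sumCompl (Set.range (braidIn w)))

/-- The permutation of the `m + 1` positions at a level of the braid word; the last level is that
of the closing strands. -/
def levelPerm (t : Fin (w.length + 1)) : Equiv.Perm (Fin (m + 1)) :=
  if h : (t : ℕ) < w.length then Equiv.swap (w.get ⟨t, h⟩).castSucc (w.get ⟨t, h⟩).succ else 1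

/-- The closure of a positive braid word on `m + 1` strands.  The letter `i : Fin m` stands for the
positive generator that crosses the strands in the positions `i` and `i + 1` (counted from `0`).
The edge `(t, j)` is the piece of strand in position `j` before the letter number `t`; the edges
`(w.length, j)` are closed up with the edges `(0, j)`. -/
def braidClosure : LinkDiagram where
  Edge := Fin (w.length + 1) × Fin (m + 1)
  finite_edge := inferInstance
  n := w.length
  Pt := {e // e ∉ Set.range (braidIn w)}
  positive := fun _ => true
  inEdge := braidPassages w
  outEdge := (braidPassages w).trans (Equiv.prodShear (finRotate (w.length + 1)) (levelPerm w))

/-- The edge in position `j` at the beginning of a closed braid. -/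
def braidClosureEdge (j : Fin (m + 1)) : (braidClosure w).Edge :=
  ((0 : Fin (w.length + 1)), j)

end Braid

/-- The braid word `(σ₁σ₂σ₃)⁴σ₁σ₂`. -/
def wordL3 : List (Fin 3) := [0, 1, 2, 0, 1, 2, 0, 1, 2, 0, 1, 2, 0, 1]

/-- The link `L₃`.  The permutation of its braid fixes the last of the four positions and permutes
the first three cyclically: the last strand closes up to the unknot component, the first three
form the component `T(3, 4)`. -/
def L3 : LinkDiagram := braidClosure wordL3

/-- An edge on the unknot component of `L₃`. -/
def L3unknot : L3.Edge := braidClosureEdge wordL3 3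

/-- An edge on the component `T(3, 4)` of `L₃`. -/
def L3torus : L3.Edge := braidClosureEdge wordL3 0

/-- The braid word `σ₁³`. -/
def wordTrefoil : List (Fin 1) := [0, 0, 0]

/-- The trefoil `T(2, 3)`. -/
def trefoil : LinkDiagram := braidClosure wordTrefoil

/-- `L₃ # ⋯ # L₃ # T(2, 3)` with `k` factors `L₃`, with an edge on its first factor.  In each
connected sum, the unknot component of the `L₃` on the left is connected with the component
`T(3, 4)` of the next `L₃`, or with `T(2, 3)` if it is the last one. -/
def L3sumPointed : ℕ → Σ D : LinkDiagram, D.Edge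
  | 0 => ⟨trefoil, braidClosureEdge wordTrefoil 0⟩
  | k + 1 => ⟨connectedSum L3 (L3sumPointed k).1 L3unknot (L3sumPointed k).2, Sum.inl L3torus⟩

/-- The link `L₃ᵏ = L₃ # ⋯ # L₃ # T(2, 3)` with `k` factors `L₃`. -/
def L3sum (k : ℕ) : LinkDiagram := (L3sumPointed k).1

end LinkDiagram

/-- The abelian group `G` has a direct summand isomorphic to `H`. -/
def HasDirectSummand (G H : Type) [AddCommGroup G] [AddCommGroup H] : Prop :=
  ∃ A B : AddSubgroup G, IsCompl A B ∧ Nonempty (A ≃+ H)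

end

/-! An edge of a diagram makes the Khovanov complex a complex of modules over A = ℤ[X]/(X²), where X
multiplies the label of the circle through that edge (`diff_mulX`). The complex of a connected sum
is the tensor product over A of the complexes of the summands, with the usual signs
(`incidence_connectedSum`). On cochains the product is `glueMul`; it satisfies the Leibniz rule
(`diff_glueMul`) and is A-balanced (`mulX_glueMul`).

Torsion grows as follows. In the top degree of the trefoil there is a class y with 2Xy = 0. In
degree 9 of `L3` there is a class ζ on which X at the unknot component acts as 3X at the torus
component. If mXy = 0 at the edge where a new `L3` is attached, then 3m·X(ζy) = m(X_unknot ζ)y =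
ζ(mXy) = 0, with X on the left acting at the torus component: the relation m becomes 3m
(`IsTopRelation.connectedSum`). After l factors the relation is 2·3^l, and twice Xy is a class of
order dividing 3^l.

That the order is not smaller, and that the class splits off, is shown by dual data carried along
with the cocycles: an integral functional α that kills coboundaries and all generators with label X,
with α(y) = 1, and a functional β that kills coboundaries modulo m and satisfies β(Xf) = α(f). Hence
β(Xy) = 1. For ζ both functionals are integral, and β(X_p f) = 3α(f) at the unknot edge p. The
compatibility of the β's with X is what makes products of functionals descend to the tensor product
over A.

If l < k, the remaining factors must preserve the summand instead of enlarging it. For this ζ is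
replaced by a cocycle κ of degree 0 of `L3` whose multiple by X at the unknot is, up to sign, the
single generator with all labels X. Nothing maps to degree 0, so the functional extends at once
(`IsTorsionClass.connectedSum`).

All of this is done for ungraded cochains. Since the differential respects the bigrading and 3^l is
a prime power, some bidegree already carries the summand (`IsTorsionClass.exists_hasDirectSummand`).

Diagrams here need not be planar. The two facts usually read off from a planar picture, that two
circles at a crossing merge when it is resmoothed and that the two edges of a connected sum lie on
one circle, follow from counting ends of edges modulo 2 (`circle_eq_of_circle_ne`,
`circle_left_eq_circle_right`).

The data for the trefoil and `L3` are explicit lists. Resolutions and labellings are coded by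
natural numbers, and the differential and its transpose become list functions that are proved
correct (`diff_cochain`, `codiff_cochain`). The required identities are then finite computations. -/

noncomputable section

namespace LinkDiagram

variable {D : LinkDiagram}

/-! ### Circles and labels -/

theorem mem_iff_of_circle_eq {v : D.Vertex} {e f : D.Edge} (S : Set D.Edge)
    (hS : ∀ a b, D.Joined v a b → (a ∈ S ↔ b ∈ S)) (h : D.circle v e = D.circle v f) :
    e ∈ S ↔ f ∈ S :=
  iff_of_eq (congrArg (Quot.lift (· ∈ S) fun a b hab => propext (hS a b hab)) h)

theorem circle_eq_of_joined {v : D.Vertex} {e f : D.Edge} (h : D.Joined v e f) :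
    D.circle v e = D.circle v f :=
  Quot.sound h

theorem exists_circle {v : D.Vertex} (γ : D.Circle v) : ∃ e, D.circle v e = γ :=
  Quot.exists_rep γ

namespace Generator

/-- The exponent with which a generator labels the circle through an edge. -/
def lab (x : D.Generator) (e : D.Edge) : Fin 2 := x.2 (D.circle x.1 e)

/-- The generator given by a labelling of the edges that is constant on circles. -/
def ofLab (v : D.Vertex) (f : D.Edge → Fin 2) (hf : ∀ a b, D.Joined v a b → f a = f b) :
    D.Generator :=
  ⟨v, Quot.lift f hf⟩

theorem lab_congr (x : D.Generator) {e f : D.Edge} (h : D.circle x.1 e = D.circle x.1 f) :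
    x.lab e = x.lab f :=
  congrArg x.2 h

/-- Labels are compared on edges because the type of circles depends on the resolution, while the
type of edges does not. -/
theorem ext_lab {x y : D.Generator} (h : x.1 = y.1) (h' : ∀ e, x.lab e = y.lab e) : x = y := by
  obtain ⟨v, a⟩ := x
  obtain ⟨w, b⟩ := y
  obtain rfl : v = w := h
  congr 1
  funext γ
  obtain ⟨e, rfl⟩ := exists_circle γ
  exact h' e

open Classical in
/-- Change the label of the circle through `e` to `s`. -/
def relabel (x : D.Generator) (e : D.Edge) (s : Fin 2) : D.Generator :=
  ofLab x.1 (fun f => if D.circle x.1 f = D.circle x.1 e then s else x.lab f) fun a b h => by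
    simp only [circle_eq_of_joined h, x.lab_congr (circle_eq_of_joined h)]

@[simp] theorem relabel_fst (x : D.Generator) (e : D.Edge) (s : Fin 2) :
    (x.relabel e s).1 = x.1 := rfl

open Classical in
theorem lab_relabel (x : D.Generator) (e : D.Edge) (s : Fin 2) (f : D.Edge) :
    (x.relabel e s).lab f = if D.circle x.1 f = D.circle x.1 e then s else x.lab f := rfl

@[simp] theorem lab_relabel_self (x : D.Generator) (e : D.Edge) (s : Fin 2) :
    (x.relabel e s).lab e = s := by
  simp [lab_relabel]

theorem relabel_relabel (x : D.Generator) (e : D.Edge) (s t : Fin 2) :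
    (x.relabel e s).relabel e t = x.relabel e t := by
  refine ext_lab rfl fun f => ?_
  simp only [lab_relabel, relabel_fst]
  split_ifs <;> simp_all

theorem relabel_eq_self (x : D.Generator) {e : D.Edge} {s : Fin 2} (h : x.lab e = s) :
    x.relabel e s = x := by
  refine ext_lab rfl fun f => ?_
  rw [lab_relabel]
  split_ifs with hf
  · rw [← h, x.lab_congr hf]
  · rfl

@[simp] theorem weight_relabel (x : D.Generator) (e : D.Edge) (s : Fin 2) :
    (x.relabel e s).weight = x.weight := rfl

theorem lab_eq_zero_or_one (x : D.Generator) (e : D.Edge) : x.lab e = 0 ∨ x.lab e = 1 := by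
  generalize x.lab e = a
  revert a
  decide

end Generator

/-! ### Changing the smoothing of one crossing -/

/-- The circle of `e` in the resolution `v` meets the crossing `c`. -/
def Touches (v : D.Vertex) (c : Fin D.n) (e : D.Edge) : Prop :=
  D.circle v e = D.circle v (D.underIn c) ∨ D.circle v e = D.circle v (D.underOut c)

/-- The edge `e` has an end at the crossing `c`. -/
def AtCrossing (c : Fin D.n) (e : D.Edge) : Prop :=
  e = D.underIn c ∨ e = D.underOut c ∨ e = D.overIn c ∨ e = D.overOut c

/-- In either smoothing each of the two arcs at `c` has exactly one end on the under strand, so the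
under ends represent all circles that meet `c`. -/
theorem AtCrossing.touches {c : Fin D.n} {e : D.Edge} (h : AtCrossing c e) (v : D.Vertex) :
    Touches v c e := by
  by_cases hv : v c = D.positive c
  · have h1 := circle_eq_of_joined (Joined.unoriented_in c hv)
    have h2 := circle_eq_of_joined (Joined.unoriented_out c hv)
    rcases h with rfl | rfl | rfl | rfl
    · exact .inl rfl
    · exact .inr rfl
    · exact .inl h1.symm
    · exact .inr h2.symm
  · have h1 := circle_eq_of_joined (Joined.oriented_left c hv)
    have h2 := circle_eq_of_joined (Joined.oriented_right c hv)
    rcases h with rfl | rfl | rfl | rfl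
    · exact .inl rfl
    · exact .inr rfl
    · exact .inr h2
    · exact .inl h1.symm

theorem Joined.of_agree {v v' : D.Vertex} {c : Fin D.n} (hv : ∀ b, b ≠ c → v b = v' b)
    {a b : D.Edge} (h : D.Joined v' a b) :
    D.Joined v a b ∨ (AtCrossing c a ∧ AtCrossing c b) := by
  cases h with
  | point s => exact .inl (.point s)
  | oriented_left d h =>
    by_cases hd : d = c
    · subst hd; right; constructor <;> simp [AtCrossing]
    · exact .inl (.oriented_left d (by rwa [hv d hd]))
  | oriented_right d h =>
    by_cases hd : d = c
    · subst hd; right; constructor <;> simp [AtCrossing]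
    · exact .inl (.oriented_right d (by rwa [hv d hd]))
  | unoriented_in d h =>
    by_cases hd : d = c
    · subst hd; right; constructor <;> simp [AtCrossing]
    · exact .inl (.unoriented_in d (by rwa [hv d hd]))
  | unoriented_out d h =>
    by_cases hd : d = c
    · subst hd; right; constructor <;> simp [AtCrossing]
    · exact .inl (.unoriented_out d (by rwa [hv d hd]))

/-- The edges on circles of `v` through `c` form a set closed under the arcs of `v'`: arcs away from
`c` belong to both resolutions, and arcs at `c` have both ends in the set. -/
theorem Touches.of_agree {v v' : D.Vertex} {c : Fin D.n} (hv : ∀ b, b ≠ c → v b = v' b)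
    {e : D.Edge} (h : Touches v' c e) : Touches v c e := by
  have hS : ∀ a b, D.Joined v' a b → (a ∈ {e | Touches v c e} ↔ b ∈ {e | Touches v c e}) := by
    intro a b hab
    rcases hab.of_agree hv with hab | ⟨ha, hb⟩
    · simp only [Set.mem_ofPred_eq, Touches, circle_eq_of_joined hab]
    · exact iff_of_true (ha.touches v) (hb.touches v)
  rcases h with h | h
  · exact (mem_iff_of_circle_eq _ hS h).2 (.inl rfl)
  · exact (mem_iff_of_circle_eq _ hS h).2 (.inr rfl)

theorem touches_iff_of_agree {v v' : D.Vertex} {c : Fin D.n} (hv : ∀ b, b ≠ c → v b = v' b)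
    {e : D.Edge} : Touches v c e ↔ Touches v' c e :=
  ⟨fun h => h.of_agree fun b hb => (hv b hb).symm, fun h => h.of_agree hv⟩

/-- A circle that misses `c` consists of arcs common to both resolutions, so it is a circle of each.
-/
theorem circle_eq_of_agree {v v' : D.Vertex} {c : Fin D.n} (hv : ∀ b, b ≠ c → v b = v' b)
    {e f : D.Edge} (he : ¬ Touches v c e) (h : D.circle v' e = D.circle v' f) :
    D.circle v e = D.circle v f := by
  refine ((mem_iff_of_circle_eq {g | D.circle v g = D.circle v e} ?_ h).1 rfl).symm
  intro a b hab
  rcases hab.of_agree hv with hab | ⟨ha, hb⟩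
  · simp only [Set.mem_ofPred_eq, circle_eq_of_joined hab]
  · have key : ∀ a, AtCrossing c a → ¬ D.circle v a = D.circle v e := by
      intro a ha hae
      apply he
      have := ha.touches v
      rwa [Touches, hae] at this
    exact iff_of_false (key a ha) (key b hb)

theorem circle_eq_iff_of_agree {v v' : D.Vertex} {c : Fin D.n} (hv : ∀ b, b ≠ c → v b = v' b)
    {e f : D.Edge} (he : ¬ Touches v c e) :
    D.circle v e = D.circle v f ↔ D.circle v' e = D.circle v' f :=
  ⟨circle_eq_of_agree (fun b hb => (hv b hb).symm) (by rwa [← touches_iff_of_agree hv]),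
    circle_eq_of_agree hv he⟩

/-! ### Parity -/

-- Every edge ends once and starts once. Separate functions for the two kinds of ends are needed for
-- connected sums, where only the incoming ends are moved.
open Classical in
theorem sum_ends [Fintype D.Edge] [Fintype D.Pt] (f g : D.Edge → ZMod 2) :
    ∑ c, (f (D.underIn c) + f (D.overIn c) + (g (D.underOut c) + g (D.overOut c))) +
      ∑ s, (f (D.inEdge (.inr s)) + g (D.outEdge (.inr s))) = ∑ e, (f e + g e) := by
  rw [Finset.sum_add_distrib (f := f), ← D.inEdge.sum_comp f, ← D.outEdge.sum_comp g,
    Fintype.sum_sum_type, Fintype.sum_sum_type, Fintype.sum_prod_type, Fintype.sum_prod_type]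
  simp only [Finset.sum_add_distrib, Fintype.sum_bool, underIn, overIn, underOut, overOut]
  ring

theorem finite_pt (D : LinkDiagram) : Finite D.Pt :=
  Finite.of_injective (fun s => D.inEdge (.inr s)) fun a b h => by simpa using h

/-- If the two strands at a crossing lie on different circles, then the other smoothing of this
crossing merges these circles. -/
theorem circle_eq_of_circle_ne {v v' : D.Vertex} {c : Fin D.n} (hv : ∀ b, b ≠ c → v b = v' b)
    (hc : v c ≠ v' c) (h : D.circle v (D.underIn c) ≠ D.circle v (D.underOut c)) :
    D.circle v' (D.underIn c) = D.circle v' (D.underOut c) := by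
  classical
  by_contra h'
  have := Fintype.ofFinite D.Edge
  have := D.finite_pt
  have := Fintype.ofFinite D.Pt
  -- The indicator of the intersection of the two circles through `underIn c`, one in each
  -- resolution. Away from `c` its ends cancel in pairs; at `c` exactly one of the four ends would
  -- be counted, which contradicts the even total.
  let f : D.Edge → ZMod 2 := fun e => if D.circle v e = D.circle v (D.underIn c) ∧
    D.circle v' e = D.circle v' (D.underIn c) then 1 else 0
  have hj : ∀ a b, D.Joined v a b → D.Joined v' a b → f a = f b := by
    intro a b h1 h2
    simp only [f, circle_eq_of_joined h1, circle_eq_of_joined h2]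
  have two : ∀ a : ZMod 2, a + a = 0 := by decide
  have hsum := sum_ends f f
  simp only [two, Finset.sum_const_zero] at hsum
  rw [Finset.sum_eq_single c, Finset.sum_eq_zero] at hsum
  · have h0 : f (D.underIn c) = 1 := by simp [f]
    have h1 : f (D.underOut c) = 0 := by simp [f, Ne.symm h]
    by_cases hp : v c = D.positive c
    · have hp' : v' c ≠ D.positive c := fun h => hc (hp.trans h.symm)
      have e1 := circle_eq_of_joined (Joined.unoriented_out c hp)
      have e2 := circle_eq_of_joined (Joined.oriented_right c hp')
      have h2 : f (D.overOut c) = 0 := by simp [f, ← e1, Ne.symm h]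
      have h3 : f (D.overIn c) = 0 := by simp [f, e2, Ne.symm h']
      rw [h0, h1, h2, h3] at hsum
      revert hsum; decide
    · have hp' : v' c = D.positive c := by
        revert hc hp; cases v c <;> cases v' c <;> cases D.positive c <;> simp
      have e1 := circle_eq_of_joined (Joined.oriented_right c hp)
      have e2 := circle_eq_of_joined (Joined.unoriented_out c hp')
      have h2 : f (D.overIn c) = 0 := by simp [f, e1, Ne.symm h]
      have h3 : f (D.overOut c) = 0 := by simp [f, ← e2, Ne.symm h']
      rw [h0, h1, h2, h3] at hsum
      revert hsum; decide
  · intro s _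
    rw [hj _ _ (.point s) (.point s), two]
  · intro b _ hb
    by_cases hp : v b = D.positive b
    · have hp' : v' b = D.positive b := by rw [← hv b hb, hp]
      rw [hj _ _ (.unoriented_in b hp) (.unoriented_in b hp'),
        hj _ _ (.unoriented_out b hp) (.unoriented_out b hp'), two, two, add_zero]
    · have hp' : v' b ≠ D.positive b := by rwa [← hv b hb]
      rw [hj _ _ (.oriented_left b hp) (.oriented_left b hp'),
        hj _ _ (.oriented_right b hp) (.oriented_right b hp'), add_comm (f (D.overOut b)), two]
  · simp

/-! ### The differential -/

theorem fin2_cases (a : Fin 2) : a = 0 ∨ a = 1 := by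
  revert a; decide

theorem Adjacent.agree {x y : D.Generator} {c : Fin D.n} (h : Adjacent x y c) :
    ∀ b, b ≠ c → x.1 b = y.1 b := by
  intro b hb
  rw [h.2.1, Function.update_of_ne hb]

theorem Adjacent.ne {x y : D.Generator} {c : Fin D.n} (h : Adjacent x y c) : x.1 c ≠ y.1 c := by
  rw [h.1, h.2.1, Function.update_self]
  simp

theorem adjacent_iff {x y : D.Generator} {c : Fin D.n} :
    Adjacent x y c ↔ x.1 c = false ∧ y.1 = Function.update x.1 c true ∧
      ∀ e, ¬ Touches x.1 c e → x.lab e = y.lab e := by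
  simp only [Adjacent, Touches, not_or, and_imp, Generator.lab]

theorem edgeCoeff_of_ne {x y : D.Generator} {c : Fin D.n}
    (h : D.circle x.1 (D.underIn c) ≠ D.circle x.1 (D.underOut c)) :
    edgeCoeff x y c =
      mulCoeff (x.lab (D.underIn c)) (x.lab (D.underOut c)) (y.lab (D.underIn c)) :=
  if_pos h

theorem edgeCoeff_of_eq_of_ne {x y : D.Generator} {c : Fin D.n}
    (h : D.circle x.1 (D.underIn c) = D.circle x.1 (D.underOut c))
    (h' : D.circle y.1 (D.underIn c) ≠ D.circle y.1 (D.underOut c)) :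
    edgeCoeff x y c =
      comulCoeff (x.lab (D.underIn c)) (y.lab (D.underIn c)) (y.lab (D.underOut c)) :=
  (if_neg (not_not.2 h)).trans (if_pos h')

theorem edgeCoeff_of_eq_of_eq {x y : D.Generator} {c : Fin D.n}
    (h : D.circle x.1 (D.underIn c) = D.circle x.1 (D.underOut c))
    (h' : D.circle y.1 (D.underIn c) = D.circle y.1 (D.underOut c)) :
    edgeCoeff x y c = 0 :=
  (if_neg (not_not.2 h)).trans (if_neg (not_not.2 h'))

open Classical in
/-- The unsigned contribution of the crossing `c` to the incidence number. -/
def entry (x y : D.Generator) (c : Fin D.n) : ℤ := if Adjacent x y c then edgeCoeff x y c else 0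

/-- The number of crossings before `c` with a `1`-smoothing. -/
def before (v : D.Vertex) (c : Fin D.n) : ℕ :=
  (Finset.univ.filter fun b => b < c ∧ v b = true).card

theorem incidence_eq (x y : D.Generator) :
    incidence x y = ∑ c, (-1) ^ before x.1 c * entry x y c := by
  refine Finset.sum_congr rfl fun c _ => ?_
  simp only [entry, before]
  split_ifs with h
  · congr 2
  · simp

/-- Multiplication and comultiplication are linear over ℤ[X]/(X²), so they send multiples of X to
multiples of X. -/
theorem entry_eq_zero_of_lab {x y : D.Generator} {c : Fin D.n} {p : D.Edge} (hx : x.lab p = 1)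
    (hy : y.lab p = 0) : entry x y c = 0 := by
  rw [entry]
  split_ifs with h
  swap
  · rfl
  have hadj := adjacent_iff.1 h
  by_cases hp : Touches x.1 c p
  swap
  · have := hadj.2.2 p hp
    rw [hx, hy] at this
    exact absurd this (by decide)
  have hp' := (touches_iff_of_agree h.agree).1 hp
  by_cases h1 : D.circle x.1 (D.underIn c) = D.circle x.1 (D.underOut c)
  · by_cases h2 : D.circle y.1 (D.underIn c) = D.circle y.1 (D.underOut c)
    · exact edgeCoeff_of_eq_of_eq h1 h2
    · rw [edgeCoeff_of_eq_of_ne h1 h2]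
      have hx' : x.lab (D.underIn c) = 1 := by
        rcases hp with hp | hp
        · rw [← x.lab_congr hp, hx]
        · rw [x.lab_congr h1, ← x.lab_congr hp, hx]
      rcases hp' with hp' | hp'
      · rw [hx', ← y.lab_congr hp', hy]
        rcases fin2_cases (y.lab (D.underOut c)) with h | h <;> rw [h] <;> rfl
      · rw [hx', ← y.lab_congr hp', hy]
        rcases fin2_cases (y.lab (D.underIn c)) with h | h <;> rw [h] <;> rfl
  · have h2 := circle_eq_of_circle_ne h.agree h.ne h1
    rw [edgeCoeff_of_ne h1]
    have hy' : y.lab (D.underIn c) = 0 := by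
      rcases hp' with hp' | hp'
      · rw [← y.lab_congr hp', hy]
      · rw [y.lab_congr h2, ← y.lab_congr hp', hy]
    rcases hp with hp | hp
    · rw [hy', ← x.lab_congr hp, hx]
      rcases fin2_cases (x.lab (D.underOut c)) with h | h <;> rw [h] <;> rfl
    · rw [hy', ← x.lab_congr hp, hx]
      rcases fin2_cases (x.lab (D.underIn c)) with h | h <;> rw [h] <;> rfl

theorem adjacent_relabel_iff {x y : D.Generator} {c : Fin D.n} {p : D.Edge} (hx : x.lab p = 0)
    (hy : y.lab p = 0) : Adjacent (x.relabel p 1) (y.relabel p 1) c ↔ Adjacent x y c := by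
  rw [adjacent_iff, adjacent_iff]
  simp only [Generator.relabel_fst]
  refine and_congr_right fun h1 => and_congr_right fun h2 => forall₂_congr fun e he => ?_
  have hv : ∀ b, b ≠ c → x.1 b = y.1 b := by
    intro b hb
    rw [h2, Function.update_of_ne hb]
  have hiff := circle_eq_iff_of_agree (f := p) hv he
  rw [Generator.lab_relabel, Generator.lab_relabel]
  by_cases hep : D.circle x.1 e = D.circle x.1 p
  · rw [if_pos hep, if_pos (hiff.1 hep), x.lab_congr hep, y.lab_congr (hiff.1 hep), hx, hy]
    simp
  · rw [if_neg hep, if_neg (mt hiff.2 hep)]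

/-- The other half of linearity over ℤ[X]/(X²): multiplying source and target by X at `p` does not
change the coefficient. If `p` lies on a circle through `c`, this is a property of the two structure
maps; otherwise that circle is a spectator. -/
theorem entry_relabel {x y : D.Generator} {c : Fin D.n} {p : D.Edge} (hx : x.lab p = 0)
    (hy : y.lab p = 0) : entry (x.relabel p 1) (y.relabel p 1) c = entry x y c := by
  classical
  simp only [entry]
  refine if_ctx_congr (adjacent_relabel_iff hx hy) (fun h => ?_) fun _ => rfl
  by_cases hp : Touches x.1 c p
  · have hp' := (touches_iff_of_agree h.agree).1 hp
    by_cases h1 : D.circle x.1 (D.underIn c) = D.circle x.1 (D.underOut c)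
    · by_cases h2 : D.circle y.1 (D.underIn c) = D.circle y.1 (D.underOut c)
      · rw [edgeCoeff_of_eq_of_eq (x := x.relabel p 1) (y := y.relabel p 1) h1 h2,
          edgeCoeff_of_eq_of_eq h1 h2]
      · rw [edgeCoeff_of_eq_of_ne (x := x.relabel p 1) (y := y.relabel p 1) h1 h2,
          edgeCoeff_of_eq_of_ne h1 h2]
        have hxp : D.circle x.1 (D.underIn c) = D.circle x.1 p := by
          rcases hp with hp | hp
          · exact hp.symm
          · rw [h1, hp]
        rw [Generator.lab_relabel, if_pos hxp, x.lab_congr hxp, hx]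
        simp only [Generator.lab_relabel]
        rcases hp' with hp' | hp'
        · have h3 : ¬ D.circle y.1 (D.underOut c) = D.circle y.1 p := by
            rw [hp']; exact Ne.symm h2
          rw [if_pos hp'.symm, if_neg h3, ← y.lab_congr hp', hy]
          rcases fin2_cases (y.lab (D.underOut c)) with h | h <;> rw [h] <;> rfl
        · have h3 : ¬ D.circle y.1 (D.underIn c) = D.circle y.1 p := by
            rw [hp']; exact h2
          rw [if_pos hp'.symm, if_neg h3, ← y.lab_congr hp', hy]
          rcases fin2_cases (y.lab (D.underIn c)) with h | h <;> rw [h] <;> rfl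
    · have h2 := circle_eq_of_circle_ne h.agree h.ne h1
      rw [edgeCoeff_of_ne (x := x.relabel p 1) (y := y.relabel p 1) h1,
          edgeCoeff_of_ne h1]
      have hyp : D.circle y.1 (D.underIn c) = D.circle y.1 p := by
        rcases hp' with hp | hp
        · exact hp.symm
        · rw [h2, hp]
      rw [Generator.lab_relabel y, if_pos hyp, y.lab_congr hyp, hy]
      simp only [Generator.lab_relabel]
      rcases hp with hp | hp
      · have h3 : ¬ D.circle x.1 (D.underOut c) = D.circle x.1 p := by
          rw [hp]; exact Ne.symm h1
        rw [if_pos hp.symm, if_neg h3, ← x.lab_congr hp, hx]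
        rcases fin2_cases (x.lab (D.underOut c)) with h | h <;> rw [h] <;> rfl
      · have h3 : ¬ D.circle x.1 (D.underIn c) = D.circle x.1 p := by
          rw [hp]; exact h1
        rw [if_pos hp.symm, if_neg h3, ← x.lab_congr hp, hx]
        rcases fin2_cases (x.lab (D.underIn c)) with h | h <;> rw [h] <;> rfl
  · have hp' := mt (touches_iff_of_agree h.agree).2 hp
    simp only [Touches, not_or] at hp hp'
    have e1 : (x.relabel p 1).lab (D.underIn c) = x.lab (D.underIn c) := by
      rw [Generator.lab_relabel, if_neg (Ne.symm hp.1)]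
    have e2 : (x.relabel p 1).lab (D.underOut c) = x.lab (D.underOut c) := by
      rw [Generator.lab_relabel, if_neg (Ne.symm hp.2)]
    have e3 : (y.relabel p 1).lab (D.underIn c) = y.lab (D.underIn c) := by
      rw [Generator.lab_relabel, if_neg (Ne.symm hp'.1)]
    have e4 : (y.relabel p 1).lab (D.underOut c) = y.lab (D.underOut c) := by
      rw [Generator.lab_relabel, if_neg (Ne.symm hp'.2)]
    by_cases h1 : D.circle x.1 (D.underIn c) = D.circle x.1 (D.underOut c)
    · by_cases h2 : D.circle y.1 (D.underIn c) = D.circle y.1 (D.underOut c)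
      · rw [edgeCoeff_of_eq_of_eq (x := x.relabel p 1) (y := y.relabel p 1) h1 h2,
          edgeCoeff_of_eq_of_eq h1 h2]
      · rw [edgeCoeff_of_eq_of_ne (x := x.relabel p 1) (y := y.relabel p 1) h1 h2,
          edgeCoeff_of_eq_of_ne h1 h2, e1, e3, e4]
    · rw [edgeCoeff_of_ne (x := x.relabel p 1) (y := y.relabel p 1) h1,
          edgeCoeff_of_ne h1, e1, e2, e3]

theorem incidence_eq_zero_of_lab {x y : D.Generator} {p : D.Edge} (hx : x.lab p = 1)
    (hy : y.lab p = 0) : incidence x y = 0 := by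
  simp [incidence_eq, entry_eq_zero_of_lab hx hy]

theorem incidence_relabel {x y : D.Generator} {p : D.Edge} (hx : x.lab p = 0)
    (hy : y.lab p = 0) : incidence (x.relabel p 1) (y.relabel p 1) = incidence x y := by
  simp only [incidence_eq, entry_relabel hx hy, Generator.relabel_fst]

/-- The Khovanov differential on all cochains at once. -/
def diff (f : D.Generator → ℤ) (y : D.Generator) : ℤ := ∑ x, incidence x y * f x

/-- The transpose of the Khovanov differential. -/
def codiff (φ : D.Generator → ℤ) (x : D.Generator) : ℤ := ∑ y, incidence x y * φ y

/-- Multiplication by `X` at the edge `e`. -/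
def mulX (e : D.Edge) (f : D.Generator → ℤ) (x : D.Generator) : ℤ :=
  if x.lab e = 1 then f (x.relabel e 0) else 0

theorem mulX_of_zero {e : D.Edge} {x : D.Generator} (f : D.Generator → ℤ) (h : x.lab e = 0) :
    mulX e f x = 0 := by
  simp [mulX, h]

theorem mulX_of_one {e : D.Edge} {x : D.Generator} (f : D.Generator → ℤ) (h : x.lab e = 1) :
    mulX e f x = f (x.relabel e 0) := by
  simp [mulX, h]

/-- Reindexing of sums by changing the label of the circle through an edge. -/
theorem sum_lab_one (e : D.Edge) (F : D.Generator → ℤ) :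
    ∑ x : D.Generator, (if x.lab e = 1 then F x else 0) =
      ∑ x : D.Generator, if x.lab e = 0 then F (x.relabel e 1) else 0 := by
  rw [← Finset.sum_filter, ← Finset.sum_filter]
  refine Finset.sum_bij' (fun x _ => x.relabel e 0) (fun x _ => x.relabel e 1) ?_ ?_ ?_ ?_ ?_
  · simp
  · simp
  · intro x hx
    rw [Generator.relabel_relabel, x.relabel_eq_self (Finset.mem_filter.1 hx).2]
  · intro x hx
    rw [Generator.relabel_relabel, x.relabel_eq_self (Finset.mem_filter.1 hx).2]
  · intro x hx
    rw [Generator.relabel_relabel, x.relabel_eq_self (Finset.mem_filter.1 hx).2]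

/-- Split generators by their label at `e`. The block from X to 1 vanishes and the two diagonal
blocks agree, which is exactly commutation with the nilpotent X. -/
theorem diff_mulX (e : D.Edge) (f : D.Generator → ℤ) :
    diff (mulX e f) = mulX e (diff f) := by
  funext z
  have h1 : diff (mulX e f) z =
      ∑ x : D.Generator, if x.lab e = 1 then incidence x z * f (x.relabel e 0) else 0 := by
    refine Finset.sum_congr rfl fun x _ => ?_
    rw [mulX]
    split_ifs <;> simp
  rcases z.lab_eq_zero_or_one e with hz | hz
  · rw [mulX_of_zero _ hz, h1]
    refine Finset.sum_eq_zero fun x _ => ?_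
    split_ifs with hx
    · rw [incidence_eq_zero_of_lab hx hz, zero_mul]
    · rfl
  · rw [mulX_of_one _ hz, h1, sum_lab_one e fun x => incidence x z * f (x.relabel e 0), diff]
    refine Finset.sum_congr rfl fun x _ => ?_
    split_ifs with hx
    · rw [Generator.relabel_relabel, x.relabel_eq_self hx,
        ← incidence_relabel hx (z.lab_relabel_self e 0), Generator.relabel_relabel,
        z.relabel_eq_self hz]
    · rw [incidence_eq_zero_of_lab ((x.lab_eq_zero_or_one e).resolve_left hx)
        (z.lab_relabel_self e 0), zero_mul]

theorem mulX_mulX (e : D.Edge) (f : D.Generator → ℤ) : mulX e (mulX e f) = 0 := by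
  funext x
  simp [mulX]

theorem diff_add (f g : D.Generator → ℤ) : diff (f + g) = diff f + diff g := by
  funext y
  simp [diff, mul_add, Finset.sum_add_distrib]

theorem diff_smul (a : ℤ) (f : D.Generator → ℤ) : diff (a • f) = a • diff f := by
  funext y
  simp only [diff, Pi.smul_apply, smul_eq_mul, Finset.mul_sum]
  exact Finset.sum_congr rfl fun _ _ => by ring

/-! ### The differential respects the bigrading -/

theorem Adjacent.weight {x y : D.Generator} {c : Fin D.n} (h : Adjacent x y c) :
    y.weight = x.weight + 1 := by
  have : (Finset.univ.filter fun b => y.1 b = true) =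
      insert c (Finset.univ.filter fun b => x.1 b = true) := by
    ext b
    by_cases hb : b = c
    · subst hb; simp [h.2.1]
    · simp [h.2.1, hb]
  rw [Generator.weight, this, Finset.card_insert_of_notMem (by simp [h.1])]
  rfl

-- Circles that miss `c` are matched by choosing an edge on each; they are the same circles in both
-- resolutions and keep their labels.
open Classical in
theorem sum_not_touches {x y : D.Generator} {c : Fin D.n} (h : Adjacent x y c) :
    ∑ γ : D.Circle x.1 with γ ≠ D.circle x.1 (D.underIn c) ∧ γ ≠ D.circle x.1 (D.underOut c),
        (1 - 2 * ((x.2 γ : ℕ) : ℤ)) =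
      ∑ γ : D.Circle y.1 with γ ≠ D.circle y.1 (D.underIn c) ∧ γ ≠ D.circle y.1 (D.underOut c),
        (1 - 2 * ((y.2 γ : ℕ) : ℤ)) := by
  have hadj := adjacent_iff.1 h
  have ht : ∀ e, Touches x.1 c e ↔ Touches y.1 c e := fun e => touches_iff_of_agree h.agree
  choose r hr using fun γ : D.Circle x.1 => exists_circle γ
  choose s hs using fun γ : D.Circle y.1 => exists_circle γ
  have hr' : ∀ γ, γ ≠ D.circle x.1 (D.underIn c) ∧ γ ≠ D.circle x.1 (D.underOut c) ↔
      ¬ Touches x.1 c (r γ) := by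
    intro γ
    rw [Touches, hr, not_or]
  have hs' : ∀ γ, γ ≠ D.circle y.1 (D.underIn c) ∧ γ ≠ D.circle y.1 (D.underOut c) ↔
      ¬ Touches y.1 c (s γ) := by
    intro γ
    rw [Touches, hs, not_or]
  refine Finset.sum_bij' (fun γ _ => D.circle y.1 (r γ)) (fun γ _ => D.circle x.1 (s γ))
    ?_ ?_ ?_ ?_ ?_
  · intro γ hγ
    have := mt (ht _).2 ((hr' γ).1 (Finset.mem_filter.1 hγ).2)
    rw [Touches, not_or] at this
    exact Finset.mem_filter.2 ⟨Finset.mem_univ _, this⟩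
  · intro γ hγ
    have := mt (ht _).1 ((hs' γ).1 (Finset.mem_filter.1 hγ).2)
    rw [Touches, not_or] at this
    exact Finset.mem_filter.2 ⟨Finset.mem_univ _, this⟩
  · intro γ hγ
    have hn := (hr' γ).1 (Finset.mem_filter.1 hγ).2
    exact ((hr γ).symm.trans ((circle_eq_iff_of_agree h.agree hn).2 (hs _).symm)).symm
  · intro γ hγ
    have hn := (hs' γ).1 (Finset.mem_filter.1 hγ).2
    exact ((hs γ).symm.trans ((circle_eq_iff_of_agree (fun b hb => (h.agree b hb).symm) hn).2
      (hr _).symm)).symm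
  · intro γ hγ
    have := hadj.2.2 _ ((hr' γ).1 (Finset.mem_filter.1 hγ).2)
    rw [Generator.lab, hr] at this
    rw [this]
    rfl

open Classical in
theorem sum_circles (x : D.Generator) (c : Fin D.n) :
    ∑ γ : D.Circle x.1, (1 - 2 * ((x.2 γ : ℕ) : ℤ)) =
      ∑ γ : D.Circle x.1 with γ ≠ D.circle x.1 (D.underIn c) ∧ γ ≠ D.circle x.1 (D.underOut c),
        (1 - 2 * ((x.2 γ : ℕ) : ℤ)) +
      ((1 - 2 * ((x.lab (D.underIn c) : ℕ) : ℤ)) +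
        if D.circle x.1 (D.underIn c) = D.circle x.1 (D.underOut c) then 0
        else (1 - 2 * ((x.lab (D.underOut c) : ℕ) : ℤ))) := by
  rw [← Finset.sum_filter_add_sum_filter_not Finset.univ fun γ : D.Circle x.1 =>
    γ ≠ D.circle x.1 (D.underIn c) ∧ γ ≠ D.circle x.1 (D.underOut c)]
  congr 1
  have : (Finset.univ.filter fun γ : D.Circle x.1 =>
      ¬ (γ ≠ D.circle x.1 (D.underIn c) ∧ γ ≠ D.circle x.1 (D.underOut c))) =
      {D.circle x.1 (D.underIn c), D.circle x.1 (D.underOut c)} := by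
    ext γ
    simp only [Finset.mem_filter, Finset.mem_univ, true_and, Finset.mem_insert,
      Finset.mem_singleton]
    tauto
  rw [this]
  split_ifs with h
  · rw [← h, Finset.pair_eq_singleton, Finset.sum_singleton, add_zero]
    rfl
  · rw [Finset.sum_pair h]
    rfl

/-- A merge preserves the sum of exponents and loses a circle; a split gains a circle and raises the
sum by one. Both lower the circle part of the degree by 1, which the additional 1-smoothing
restores. -/
theorem qdeg_eq_of_entry_ne_zero {x y : D.Generator} {c : Fin D.n} (h : entry x y c ≠ 0) :
    y.qdeg = x.qdeg := by
  rw [entry] at h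
  split_ifs at h with hadj
  swap
  · exact absurd rfl h
  rw [Generator.qdeg, Generator.qdeg, hadj.weight, sum_circles x c, sum_circles y c,
    sum_not_touches hadj]
  by_cases h1 : D.circle x.1 (D.underIn c) = D.circle x.1 (D.underOut c)
  · by_cases h2 : D.circle y.1 (D.underIn c) = D.circle y.1 (D.underOut c)
    · exact absurd (edgeCoeff_of_eq_of_eq h1 h2) h
    · rw [edgeCoeff_of_eq_of_ne h1 h2, comulCoeff] at h
      rw [if_pos h1, if_neg h2]
      have := (ite_ne_right_iff.1 h).1
      push_cast
      omega
  · have h2 := circle_eq_of_circle_ne hadj.agree hadj.ne h1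
    rw [edgeCoeff_of_ne h1, mulCoeff] at h
    rw [if_neg h1, if_pos h2]
    have := (ite_ne_right_iff.1 h).1
    push_cast
    omega

theorem degrees_of_incidence_ne_zero {x y : D.Generator} (h : incidence x y ≠ 0) :
    y.hdeg = x.hdeg + 1 ∧ y.qdeg = x.qdeg := by
  rw [incidence_eq] at h
  obtain ⟨c, _, hc⟩ := Finset.exists_ne_zero_of_sum_ne_zero h
  have hc := right_ne_zero_of_mul hc
  refine ⟨?_, qdeg_eq_of_entry_ne_zero hc⟩
  rw [entry] at hc
  split_ifs at hc with hadj
  swap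
  · exact absurd rfl hc
  rw [Generator.hdeg, Generator.hdeg, hadj.weight]
  push_cast
  ring

/-! ### Resolutions of connected sums -/

section ConnectedSum

variable {D₁ D₂ : LinkDiagram} {p : D₁.Edge} {q : D₂.Edge}

/-- The crossings of the first summand. -/
def leftCrossing (c : Fin D₁.n) : Fin (connectedSum D₁ D₂ p q).n := Fin.castAdd D₂.n c

/-- The crossings of the second summand. -/
def rightCrossing (c : Fin D₂.n) : Fin (connectedSum D₁ D₂ p q).n := Fin.natAdd D₁.n c

/-- The edges of the first summand. -/
def leftEdge (e : D₁.Edge) : (connectedSum D₁ D₂ p q).Edge := Sum.inl e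

/-- The edges of the second summand. -/
def rightEdge (e : D₂.Edge) : (connectedSum D₁ D₂ p q).Edge := Sum.inr e

/-- A function on the edges of a connected sum. -/
def edgeElim {α : Type*} (f : D₁.Edge → α) (g : D₂.Edge → α) :
    (connectedSum D₁ D₂ p q).Edge → α :=
  Sum.elim f g

theorem crossing_cases (c : Fin (connectedSum D₁ D₂ p q).n) :
    (∃ b, c = leftCrossing b) ∨ ∃ b, c = rightCrossing b :=
  Fin.addCases (motive := fun c : Fin (D₁.n + D₂.n) =>
    (∃ b, c = Fin.castAdd D₂.n b) ∨ ∃ b, c = Fin.natAdd D₁.n b)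
    (fun b => .inl ⟨b, rfl⟩) (fun b => .inr ⟨b, rfl⟩) c

theorem edge_cases (e : (connectedSum D₁ D₂ p q).Edge) :
    (∃ f, e = leftEdge f) ∨ ∃ f, e = rightEdge f := by
  rcases e with f | f
  · exact .inl ⟨f, rfl⟩
  · exact .inr ⟨f, rfl⟩

/-- A resolution of a connected sum restricts to the first summand. -/
def vertexLeft (v : (connectedSum D₁ D₂ p q).Vertex) : D₁.Vertex :=
  fun c => v (leftCrossing c)

/-- A resolution of a connected sum restricts to the second summand. -/
def vertexRight (v : (connectedSum D₁ D₂ p q).Vertex) : D₂.Vertex :=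
  fun c => v (rightCrossing c)

open Classical in
/-- The permutation of the edges that describes how the summands are cut and pasted. -/
def swapEdge : Equiv.Perm (connectedSum D₁ D₂ p q).Edge :=
  (Equiv.swap (Sum.inl p) (Sum.inr q) : Equiv.Perm (D₁.Edge ⊕ D₂.Edge))

theorem swapEdge_left : swapEdge (p := p) (q := q) (leftEdge p) = rightEdge q := by
  classical
  exact Equiv.swap_apply_left (α := D₁.Edge ⊕ D₂.Edge) _ _

theorem swapEdge_right : swapEdge (p := p) (q := q) (rightEdge q) = leftEdge p := by
  classical
  exact Equiv.swap_apply_right (α := D₁.Edge ⊕ D₂.Edge) _ _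

theorem swapEdge_of_ne {a : (connectedSum D₁ D₂ p q).Edge} (h : a ≠ leftEdge p)
    (h' : a ≠ rightEdge q) : swapEdge a = a := by
  classical
  exact Equiv.swap_apply_of_ne_of_ne (α := D₁.Edge ⊕ D₂.Edge) h h'

theorem sumPassages_castAdd {m n : ℕ} {P Q : Type} (c : Fin m) (b : Bool) :
    sumPassages m n P Q (.inl (Fin.castAdd n c, b)) = .inl (.inl (c, b)) := by
  simp [sumPassages]

theorem sumPassages_natAdd {m n : ℕ} {P Q : Type} (c : Fin n) (b : Bool) :
    sumPassages m n P Q (.inl (Fin.natAdd m c, b)) = .inr (.inl (c, b)) := by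
  simp [sumPassages]

/-- The cut exchanges only the ends of `p` and `q`, not their beginnings, so `swapEdge` occurs for
incoming passages and not for outgoing ones. -/
theorem underIn_left (c : Fin D₁.n) :
    (connectedSum D₁ D₂ p q).underIn (leftCrossing c) = swapEdge (leftEdge (D₁.underIn c)) :=
  congrArg (fun a => swapEdge (p := p) (q := q) (Sum.map D₁.inEdge D₂.inEdge a))
    (sumPassages_castAdd c false)

theorem underOut_left (c : Fin D₁.n) :
    (connectedSum D₁ D₂ p q).underOut (leftCrossing c) = leftEdge (D₁.underOut c) :=
  congrArg (Sum.map D₁.outEdge D₂.outEdge) (sumPassages_castAdd c false)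

theorem overIn_left (c : Fin D₁.n) :
    (connectedSum D₁ D₂ p q).overIn (leftCrossing c) = swapEdge (leftEdge (D₁.overIn c)) :=
  congrArg (fun a => swapEdge (p := p) (q := q) (Sum.map D₁.inEdge D₂.inEdge a))
    (sumPassages_castAdd c true)

theorem overOut_left (c : Fin D₁.n) :
    (connectedSum D₁ D₂ p q).overOut (leftCrossing c) = leftEdge (D₁.overOut c) :=
  congrArg (Sum.map D₁.outEdge D₂.outEdge) (sumPassages_castAdd c true)

theorem joined_left_point (v : (connectedSum D₁ D₂ p q).Vertex) (s : D₁.Pt) :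
    (connectedSum D₁ D₂ p q).Joined v (swapEdge (leftEdge (D₁.inEdge (.inr s))))
      (leftEdge (D₁.outEdge (.inr s))) :=
  Joined.point (D := connectedSum D₁ D₂ p q) (Sum.inl s)

theorem positive_left (c : Fin D₁.n) :
    (connectedSum D₁ D₂ p q).positive (leftCrossing c) = D₁.positive c :=
  Fin.append_left _ _ c

theorem underIn_right (c : Fin D₂.n) :
    (connectedSum D₁ D₂ p q).underIn (rightCrossing c) = swapEdge (rightEdge (D₂.underIn c)) :=
  congrArg (fun a => swapEdge (p := p) (q := q) (Sum.map D₁.inEdge D₂.inEdge a))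
    (sumPassages_natAdd c false)

theorem underOut_right (c : Fin D₂.n) :
    (connectedSum D₁ D₂ p q).underOut (rightCrossing c) = rightEdge (D₂.underOut c) :=
  congrArg (Sum.map D₁.outEdge D₂.outEdge) (sumPassages_natAdd c false)

theorem overIn_right (c : Fin D₂.n) :
    (connectedSum D₁ D₂ p q).overIn (rightCrossing c) = swapEdge (rightEdge (D₂.overIn c)) :=
  congrArg (fun a => swapEdge (p := p) (q := q) (Sum.map D₁.inEdge D₂.inEdge a))
    (sumPassages_natAdd c true)

theorem overOut_right (c : Fin D₂.n) :
    (connectedSum D₁ D₂ p q).overOut (rightCrossing c) = rightEdge (D₂.overOut c) :=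
  congrArg (Sum.map D₁.outEdge D₂.outEdge) (sumPassages_natAdd c true)

theorem joined_right_point (v : (connectedSum D₁ D₂ p q).Vertex) (s : D₂.Pt) :
    (connectedSum D₁ D₂ p q).Joined v (swapEdge (rightEdge (D₂.inEdge (.inr s))))
      (rightEdge (D₂.outEdge (.inr s))) :=
  Joined.point (D := connectedSum D₁ D₂ p q) (Sum.inr s)

theorem positive_right (c : Fin D₂.n) :
    (connectedSum D₁ D₂ p q).positive (rightCrossing c) = D₂.positive c :=
  Fin.append_right _ _ c

/-- A function with equal values on the two cut edges does not notice the cut. For such functions,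
invariance along the arcs of the sum is the same as invariance along the arcs of the summands. -/
theorem apply_swapEdge {α : Type*} {F : (connectedSum D₁ D₂ p q).Edge → α}
    (h : F (leftEdge p) = F (rightEdge q)) (a : (connectedSum D₁ D₂ p q).Edge) :
    F (swapEdge a) = F a := by
  by_cases h1 : a = leftEdge p
  · rw [h1, swapEdge_left, h]
  · by_cases h2 : a = rightEdge q
    · rw [h2, swapEdge_right, h]
    · rw [swapEdge_of_ne h1 h2]

theorem Joined.apply_eq_left {α : Type*} {F : (connectedSum D₁ D₂ p q).Edge → α}
    (h : F (leftEdge p) = F (rightEdge q)) {v : (connectedSum D₁ D₂ p q).Vertex}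
    (hF : ∀ a b, (connectedSum D₁ D₂ p q).Joined v a b → F a = F b) {a b : D₁.Edge}
    (hab : D₁.Joined (vertexLeft v) a b) : F (leftEdge a) = F (leftEdge b) := by
  cases hab with
  | point s =>
    have := hF _ _ (joined_left_point v s)
    rwa [apply_swapEdge h] at this
  | oriented_left c hc =>
    have := hF _ _ (.oriented_left (leftCrossing c) (by rwa [positive_left]))
    rwa [underIn_left, overOut_left, apply_swapEdge h] at this
  | oriented_right c hc =>
    have := hF _ _ (.oriented_right (leftCrossing c) (by rwa [positive_left]))
    rwa [overIn_left, underOut_left, apply_swapEdge h] at this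
  | unoriented_in c hc =>
    have := hF _ _ (.unoriented_in (leftCrossing c) (by rwa [positive_left]))
    rwa [overIn_left, underIn_left, apply_swapEdge h, apply_swapEdge h] at this
  | unoriented_out c hc =>
    have := hF _ _ (.unoriented_out (leftCrossing c) (by rwa [positive_left]))
    rwa [overOut_left, underOut_left] at this

theorem Joined.apply_eq_right {α : Type*} {F : (connectedSum D₁ D₂ p q).Edge → α}
    (h : F (leftEdge p) = F (rightEdge q)) {v : (connectedSum D₁ D₂ p q).Vertex}
    (hF : ∀ a b, (connectedSum D₁ D₂ p q).Joined v a b → F a = F b) {a b : D₂.Edge}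
    (hab : D₂.Joined (vertexRight v) a b) : F (rightEdge a) = F (rightEdge b) := by
  cases hab with
  | point s =>
    have := hF _ _ (joined_right_point v s)
    rwa [apply_swapEdge h] at this
  | oriented_left c hc =>
    have := hF _ _ (.oriented_left (rightCrossing c) (by rwa [positive_right]))
    rwa [underIn_right, overOut_right, apply_swapEdge h] at this
  | oriented_right c hc =>
    have := hF _ _ (.oriented_right (rightCrossing c) (by rwa [positive_right]))
    rwa [overIn_right, underOut_right, apply_swapEdge h] at this
  | unoriented_in c hc =>
    have := hF _ _ (.unoriented_in (rightCrossing c) (by rwa [positive_right]))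
    rwa [overIn_right, underIn_right, apply_swapEdge h, apply_swapEdge h] at this
  | unoriented_out c hc =>
    have := hF _ _ (.unoriented_out (rightCrossing c) (by rwa [positive_right]))
    rwa [overOut_right, underOut_right] at this

theorem Joined.apply_eq_of_sum {α : Type*} {F : (connectedSum D₁ D₂ p q).Edge → α}
    (h : F (leftEdge p) = F (rightEdge q)) {v : (connectedSum D₁ D₂ p q).Vertex}
    (h₁ : ∀ a b, D₁.Joined (vertexLeft v) a b → F (leftEdge a) = F (leftEdge b))
    (h₂ : ∀ a b, D₂.Joined (vertexRight v) a b → F (rightEdge a) = F (rightEdge b))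
    {a b : (connectedSum D₁ D₂ p q).Edge} (hab : (connectedSum D₁ D₂ p q).Joined v a b) : F a = F b := by
  cases hab with
  | point s =>
    rcases s with s | s
    · exact (apply_swapEdge h _).trans (h₁ _ _ (.point s))
    · exact (apply_swapEdge h _).trans (h₂ _ _ (.point s))
  | oriented_left c hc =>
    rcases crossing_cases c with ⟨c, rfl⟩ | ⟨c, rfl⟩
    · rw [underIn_left, overOut_left, apply_swapEdge h]
      exact h₁ _ _ (.oriented_left c (by rwa [positive_left] at hc))
    · rw [underIn_right, overOut_right, apply_swapEdge h]
      exact h₂ _ _ (.oriented_left c (by rwa [positive_right] at hc))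
  | oriented_right c hc =>
    rcases crossing_cases c with ⟨c, rfl⟩ | ⟨c, rfl⟩
    · rw [overIn_left, underOut_left, apply_swapEdge h]
      exact h₁ _ _ (.oriented_right c (by rwa [positive_left] at hc))
    · rw [overIn_right, underOut_right, apply_swapEdge h]
      exact h₂ _ _ (.oriented_right c (by rwa [positive_right] at hc))
  | unoriented_in c hc =>
    rcases crossing_cases c with ⟨c, rfl⟩ | ⟨c, rfl⟩
    · rw [overIn_left, underIn_left, apply_swapEdge h, apply_swapEdge h]
      exact h₁ _ _ (.unoriented_in c (by rwa [positive_left] at hc))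
    · rw [overIn_right, underIn_right, apply_swapEdge h, apply_swapEdge h]
      exact h₂ _ _ (.unoriented_in c (by rwa [positive_right] at hc))
  | unoriented_out c hc =>
    rcases crossing_cases c with ⟨c, rfl⟩ | ⟨c, rfl⟩
    · rw [overOut_left, underOut_left]
      exact h₁ _ _ (.unoriented_out c (by rwa [positive_left] at hc))
    · rw [overOut_right, underOut_right]
      exact h₂ _ _ (.unoriented_out c (by rwa [positive_right] at hc))

/-- The two edges along which a connected sum is formed lie on the same circle. -/
theorem apply_left_eq_apply_right {F : (connectedSum D₁ D₂ p q).Edge → ZMod 2}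
    {v : (connectedSum D₁ D₂ p q).Vertex}
    (hF : ∀ a b, (connectedSum D₁ D₂ p q).Joined v a b → F a = F b) :
    F (leftEdge p) = F (rightEdge q) := by
  classical
  have := Fintype.ofFinite D₁.Edge
  have := D₁.finite_pt
  have := Fintype.ofFinite D₁.Pt
  have two : ∀ a : ZMod 2, a + a = 0 := by decide
  -- Count the ends in the first summand, with incoming ends read after the cut. Everything cancels
  -- except at `p`, whose end now carries the value at `q`.
  have hsum := sum_ends (D := D₁) (fun e => F (swapEdge (leftEdge e)))
    (fun e => F (leftEdge e))
  rw [Finset.sum_eq_zero, Finset.sum_eq_zero, Finset.sum_eq_single p] at hsum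
  · rw [swapEdge_left] at hsum
    revert hsum
    generalize F (leftEdge p) = a
    generalize F (rightEdge q) = b
    revert a b
    decide
  · intro e _ he
    rw [swapEdge_of_ne (a := leftEdge e) (fun h => he (Sum.inl_injective h)) Sum.inl_ne_inr, two]
  · simp
  · intro s _
    have := hF _ _ (joined_left_point v s)
    rw [this, two]
  · intro c _
    by_cases hc : vertexLeft v c = D₁.positive c
    · have h1 := hF _ _ (.unoriented_in (leftCrossing c) (by rwa [positive_left]))
      have h2 := hF _ _ (.unoriented_out (leftCrossing c) (by rwa [positive_left]))
      rw [overIn_left, underIn_left] at h1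
      rw [overOut_left, underOut_left] at h2
      rw [h1, h2, two, two, add_zero]
    · have h1 := hF _ _ (.oriented_left (leftCrossing c) (by rwa [positive_left]))
      have h2 := hF _ _ (.oriented_right (leftCrossing c) (by rwa [positive_left]))
      rw [underIn_left, overOut_left] at h1
      rw [overIn_left, underOut_left] at h2
      rw [h1, h2, add_comm (F (leftEdge (D₁.overOut c))), two]

theorem circle_left_eq_circle_right (v : (connectedSum D₁ D₂ p q).Vertex) :
    (connectedSum D₁ D₂ p q).circle v (leftEdge p) = (connectedSum D₁ D₂ p q).circle v (rightEdge q) := by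
  classical
  by_contra h
  have := apply_left_eq_apply_right (v := v) (F := fun e =>
    if (connectedSum D₁ D₂ p q).circle v e = (connectedSum D₁ D₂ p q).circle v (leftEdge p)
    then 1 else 0) fun a b hab => by simp only [circle_eq_of_joined hab]
  rw [if_pos rfl, if_neg (Ne.symm h)] at this
  exact absurd this (by decide)

theorem apply_eq_of_circle_eq {D : LinkDiagram} {α : Type*} {v : D.Vertex} {F : D.Edge → α}
    (hF : ∀ a b, D.Joined v a b → F a = F b) {a b : D.Edge} (h : D.circle v a = D.circle v b) :
    F a = F b :=
  congrArg (Quot.lift F hF) h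

/-- Collapse the second summand onto the circle through `p`. The resulting map is constant on arcs
of the sum, so it retracts the circles of the sum onto those of the first summand. -/
theorem edgeElim_circle_left {v : (connectedSum D₁ D₂ p q).Vertex}
    {a b : (connectedSum D₁ D₂ p q).Edge}
    (h : (connectedSum D₁ D₂ p q).circle v a = (connectedSum D₁ D₂ p q).circle v b) :
    edgeElim (D₁.circle (vertexLeft v)) (fun _ => D₁.circle (vertexLeft v) p) a =
      edgeElim (D₁.circle (vertexLeft v)) (fun _ => D₁.circle (vertexLeft v) p) b :=
  apply_eq_of_circle_eq (fun _ _ hab => Joined.apply_eq_of_sum (v := v)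
    (F := edgeElim (D₁.circle (vertexLeft v)) fun _ => D₁.circle (vertexLeft v) p) rfl
    (fun _ _ hab => circle_eq_of_joined hab) (fun _ _ _ => rfl) hab) h

theorem edgeElim_circle_right {v : (connectedSum D₁ D₂ p q).Vertex}
    {a b : (connectedSum D₁ D₂ p q).Edge}
    (h : (connectedSum D₁ D₂ p q).circle v a = (connectedSum D₁ D₂ p q).circle v b) :
    edgeElim (fun _ => D₂.circle (vertexRight v) q) (D₂.circle (vertexRight v)) a =
      edgeElim (fun _ => D₂.circle (vertexRight v) q) (D₂.circle (vertexRight v)) b :=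
  apply_eq_of_circle_eq (fun _ _ hab => Joined.apply_eq_of_sum (v := v)
    (F := edgeElim (fun _ => D₂.circle (vertexRight v) q) (D₂.circle (vertexRight v))) rfl
    (fun _ _ _ => rfl) (fun _ _ hab => circle_eq_of_joined hab) hab) h

theorem circle_inl_eq_iff {v : (connectedSum D₁ D₂ p q).Vertex} {e f : D₁.Edge} :
    (connectedSum D₁ D₂ p q).circle v (leftEdge e) =
        (connectedSum D₁ D₂ p q).circle v (leftEdge f) ↔
      D₁.circle (vertexLeft v) e = D₁.circle (vertexLeft v) f :=
  ⟨fun h => edgeElim_circle_left h, apply_eq_of_circle_eq fun _ _ hab =>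
    Joined.apply_eq_left (F := (connectedSum D₁ D₂ p q).circle v)
      (circle_left_eq_circle_right v) (fun _ _ hab => circle_eq_of_joined hab) hab⟩

theorem circle_inr_eq_iff {v : (connectedSum D₁ D₂ p q).Vertex} {e f : D₂.Edge} :
    (connectedSum D₁ D₂ p q).circle v (rightEdge e) =
        (connectedSum D₁ D₂ p q).circle v (rightEdge f) ↔
      D₂.circle (vertexRight v) e = D₂.circle (vertexRight v) f :=
  ⟨fun h => edgeElim_circle_right h, apply_eq_of_circle_eq fun _ _ hab =>
    Joined.apply_eq_right (F := (connectedSum D₁ D₂ p q).circle v)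
      (circle_left_eq_circle_right v) (fun _ _ hab => circle_eq_of_joined hab) hab⟩

/-- The circles of a connected sum are those of the two summands with only the circles of `p` and
`q` identified. -/
theorem circle_inl_eq_inr_iff {v : (connectedSum D₁ D₂ p q).Vertex} {e : D₁.Edge} {f : D₂.Edge} :
    (connectedSum D₁ D₂ p q).circle v (leftEdge e) =
        (connectedSum D₁ D₂ p q).circle v (rightEdge f) ↔
      D₁.circle (vertexLeft v) e = D₁.circle (vertexLeft v) p ∧
        D₂.circle (vertexRight v) f = D₂.circle (vertexRight v) q := by
  refine ⟨fun h => ⟨edgeElim_circle_left h, (edgeElim_circle_right h).symm⟩, ?_⟩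
  rintro ⟨h1, h2⟩
  rw [circle_inl_eq_iff.2 h1, circle_inr_eq_iff.2 h2, circle_left_eq_circle_right]

/-! ### Generators of connected sums -/

namespace Generator

theorem lab_left_eq_lab_right (x : (connectedSum D₁ D₂ p q).Generator) :
    x.lab (leftEdge p) = x.lab (rightEdge q) :=
  x.lab_congr (circle_left_eq_circle_right _)

theorem lab_eq_of_joined {D : LinkDiagram} (x : D.Generator) (a b : D.Edge)
    (h : D.Joined x.1 a b) : x.lab a = x.lab b :=
  x.lab_congr (circle_eq_of_joined h)

/-- The first component of a generator of a connected sum. -/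
def left (x : (connectedSum D₁ D₂ p q).Generator) : D₁.Generator :=
  ofLab (vertexLeft x.1) (fun e => x.lab (leftEdge e)) fun _ _ hab =>
    Joined.apply_eq_left (F := x.lab) x.lab_left_eq_lab_right x.lab_eq_of_joined hab

/-- The second component of a generator of a connected sum. -/
def right (x : (connectedSum D₁ D₂ p q).Generator) : D₂.Generator :=
  ofLab (vertexRight x.1) (fun e => x.lab (rightEdge e)) fun _ _ hab =>
    Joined.apply_eq_right (F := x.lab) x.lab_left_eq_lab_right x.lab_eq_of_joined hab

theorem lab_left (x : (connectedSum D₁ D₂ p q).Generator) (e : D₁.Edge) :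
    x.left.lab e = x.lab (leftEdge e) := rfl

theorem lab_right (x : (connectedSum D₁ D₂ p q).Generator) (e : D₂.Edge) :
    x.right.lab e = x.lab (rightEdge e) := rfl

theorem left_lab_eq_right_lab (x : (connectedSum D₁ D₂ p q).Generator) :
    x.left.lab p = x.right.lab q :=
  x.lab_left_eq_lab_right

theorem vertexLeft_append (v₁ : D₁.Vertex) (v₂ : D₂.Vertex) :
    vertexLeft (p := p) (q := q) (Fin.append v₁ v₂) = v₁ :=
  funext fun c => Fin.append_left v₁ v₂ c

theorem vertexRight_append (v₁ : D₁.Vertex) (v₂ : D₂.Vertex) :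
    vertexRight (p := p) (q := q) (Fin.append v₁ v₂) = v₂ :=
  funext fun c => Fin.append_right v₁ v₂ c

/-- The generator of a connected sum with given components. -/
def pair (x₁ : D₁.Generator) (x₂ : D₂.Generator) (h : x₁.lab p = x₂.lab q) :
    (connectedSum D₁ D₂ p q).Generator :=
  ofLab (Fin.append x₁.1 x₂.1) (edgeElim x₁.lab x₂.lab) fun _ _ hab =>
    Joined.apply_eq_of_sum (p := p) (q := q) (F := edgeElim x₁.lab x₂.lab) h
      (fun a b hab => x₁.lab_eq_of_joined a b (by rwa [vertexLeft_append] at hab))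
      (fun a b hab => x₂.lab_eq_of_joined a b (by rwa [vertexRight_append] at hab)) hab

@[simp] theorem left_pair (x₁ : D₁.Generator) (x₂ : D₂.Generator) (h : x₁.lab p = x₂.lab q) :
    (pair x₁ x₂ h).left = x₁ :=
  ext_lab (vertexLeft_append (p := p) (q := q) _ _) fun _ => rfl

@[simp] theorem right_pair (x₁ : D₁.Generator) (x₂ : D₂.Generator) (h : x₁.lab p = x₂.lab q) :
    (pair x₁ x₂ h).right = x₂ :=
  ext_lab (vertexRight_append (p := p) (q := q) _ _) fun _ => rfl

theorem vertex_ext {v w : (connectedSum D₁ D₂ p q).Vertex} (h₁ : vertexLeft v = vertexLeft w)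
    (h₂ : vertexRight v = vertexRight w) : v = w := by
  funext c
  induction c using Fin.addCases with
  | left c => exact congrFun h₁ c
  | right c => exact congrFun h₂ c

theorem ext_left_right {x y : (connectedSum D₁ D₂ p q).Generator} (h₁ : x.left = y.left)
    (h₂ : x.right = y.right) : x = y := by
  refine ext_lab (vertex_ext (congrArg Sigma.fst h₁) (congrArg Sigma.fst h₂)) fun e => ?_
  rcases e with e | e
  · exact congrArg (fun z => lab z e) h₁
  · exact congrArg (fun z => lab z e) h₂

/-- Two generators agree away from the circle through `e`. -/
def SameOff {D : LinkDiagram} (e : D.Edge) (x y : D.Generator) : Prop :=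
  x.relabel e 0 = y.relabel e 0

theorem SameOff.relabel_eq {D : LinkDiagram} {e : D.Edge} {x y : D.Generator}
    (h : SameOff e x y) (s : Fin 2) : x.relabel e s = y.relabel e s := by
  rw [← x.relabel_relabel e 0 s, h, y.relabel_relabel]

theorem sameOff_iff {D : LinkDiagram} {e : D.Edge} {x y : D.Generator} :
    SameOff e x y ↔ x.1 = y.1 ∧ ∀ f, D.circle x.1 f ≠ D.circle x.1 e → x.lab f = y.lab f := by
  constructor
  · intro h
    have h1 : (x.relabel e 0).1 = (y.relabel e 0).1 := congrArg Sigma.fst h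
    refine ⟨h1, fun f hf => ?_⟩
    have h2 := congrArg (fun z => lab z f) h
    simp only [lab_relabel] at h2
    rw [relabel_fst, relabel_fst] at h1
    rwa [if_neg hf, if_neg (by rwa [← h1])] at h2
  · rintro ⟨h1, h2⟩
    refine ext_lab h1 fun f => ?_
    rw [lab_relabel, lab_relabel, ← h1]
    split_ifs with hf
    · rfl
    · exact h2 f hf

/-- The generator of a connected sum with first component `x₁` whose second component agrees with
`x₂` away from the circle through `q`. -/
def glueLeft (x₁ : D₁.Generator) (x₂ : D₂.Generator) : (connectedSum D₁ D₂ p q).Generator :=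
  pair x₁ (x₂.relabel q (x₁.lab p)) (by simp)

/-- The generator of a connected sum with second component `x₂` whose first component agrees with
`x₁` away from the circle through `p`. -/
def glueRight (x₁ : D₁.Generator) (x₂ : D₂.Generator) : (connectedSum D₁ D₂ p q).Generator :=
  pair (x₁.relabel p (x₂.lab q)) x₂ (by simp)

end Generator

open Generator

-- The label of the joined circle is already recorded by the left component, so the generators in
-- question are parametrized freely by the generators of the first summand.
open Classical in
theorem sum_sameOff_right (r : D₂.Generator) (H : (connectedSum D₁ D₂ p q).Generator → ℤ) :
    ∑ x, (if SameOff q x.right r then H x else 0) = ∑ x₁ : D₁.Generator, H (glueLeft x₁ r) := by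
  rw [← Finset.sum_filter]
  have key : ∀ x : (connectedSum D₁ D₂ p q).Generator, SameOff q x.right r →
      glueLeft x.left r = x := by
    intro x hx
    refine ext_left_right (by simp [glueLeft]) ?_
    rw [glueLeft, right_pair, ← hx.relabel_eq, relabel_eq_self _ x.left_lab_eq_right_lab.symm]
  refine Finset.sum_bij' (fun x _ => x.left) (fun x₁ _ => glueLeft x₁ r) ?_ ?_ ?_ ?_ ?_
  · simp
  · intro x₁ _
    refine Finset.mem_filter.2 ⟨Finset.mem_univ _, ?_⟩
    rw [glueLeft, right_pair, SameOff, relabel_relabel]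
  · intro x hx
    exact key x (Finset.mem_filter.1 hx).2
  · simp [glueLeft]
  · intro x hx
    rw [key x (Finset.mem_filter.1 hx).2]

open Classical in
theorem sum_sameOff_left (l : D₁.Generator) (H : (connectedSum D₁ D₂ p q).Generator → ℤ) :
    ∑ x, (if SameOff p x.left l then H x else 0) = ∑ x₂ : D₂.Generator, H (glueRight l x₂) := by
  rw [← Finset.sum_filter]
  have key : ∀ x : (connectedSum D₁ D₂ p q).Generator, SameOff p x.left l →
      glueRight l x.right = x := by
    intro x hx
    refine ext_left_right ?_ (by simp [glueRight])
    rw [glueRight, left_pair, ← hx.relabel_eq, relabel_eq_self _ x.left_lab_eq_right_lab]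
  refine Finset.sum_bij' (fun x _ => x.right) (fun x₂ _ => glueRight l x₂) ?_ ?_ ?_ ?_ ?_
  · simp
  · intro x₂ _
    refine Finset.mem_filter.2 ⟨Finset.mem_univ _, ?_⟩
    rw [glueRight, left_pair, SameOff, relabel_relabel]
  · intro x hx
    exact key x (Finset.mem_filter.1 hx).2
  · simp [glueRight]
  · intro x hx
    rw [key x (Finset.mem_filter.1 hx).2]

theorem sum_left_right (H : D₁.Generator → D₂.Generator → ℤ) :
    ∑ x : (connectedSum D₁ D₂ p q).Generator, H x.left x.right =
      ∑ x₁ : D₁.Generator, ∑ x₂ : D₂.Generator, if x₁.lab p = x₂.lab q then H x₁ x₂ else 0 := by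
  classical
  rw [← Fintype.sum_prod_type', ← Finset.sum_filter]
  refine Finset.sum_bij' (fun x _ => (x.left, x.right))
    (fun y hy => pair y.1 y.2 (Finset.mem_filter.1 hy).2) ?_ ?_ ?_ ?_ ?_
  · intro x _
    simp [x.left_lab_eq_right_lab]
  · simp
  · intro x _
    exact ext_left_right (by simp) (by simp)
  · intro x _
    simp
  · simp

end ConnectedSum

/-! ### The differential of a connected sum -/

section ConnectedSum

variable {D₁ D₂ : LinkDiagram} {p : D₁.Edge} {q : D₂.Edge}

open Generator

theorem circle_swap (v : (connectedSum D₁ D₂ p q).Vertex) (a : (connectedSum D₁ D₂ p q).Edge) :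
    (connectedSum D₁ D₂ p q).circle v (swapEdge a) = (connectedSum D₁ D₂ p q).circle v a :=
  apply_swapEdge (circle_left_eq_circle_right v) a

theorem leftCrossing_inj {a b : Fin D₁.n} :
    leftCrossing (p := p) (q := q) a = leftCrossing b ↔ a = b :=
  Fin.castAdd_inj

theorem rightCrossing_inj {a b : Fin D₂.n} :
    rightCrossing (p := p) (q := q) a = rightCrossing b ↔ a = b :=
  Fin.natAdd_inj _

theorem leftCrossing_lt_rightCrossing (a : Fin D₁.n) (b : Fin D₂.n) :
    leftCrossing (p := p) (q := q) a < rightCrossing b := by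
  rw [Fin.lt_def]
  change (a : ℕ) < D₁.n + b
  omega

theorem vertex_left_iff {v w : (connectedSum D₁ D₂ p q).Vertex} {c : Fin D₁.n} :
    w = Function.update v (leftCrossing c) true ↔
      vertexLeft w = Function.update (vertexLeft v) c true ∧ vertexRight w = vertexRight v := by
  constructor
  · rintro rfl
    constructor
    · funext b
      simp only [vertexLeft, Function.update_apply, leftCrossing_inj]
    · funext b
      exact Function.update_of_ne (leftCrossing_lt_rightCrossing c b).ne' _ _
  · rintro ⟨h1, h2⟩
    funext b
    rcases crossing_cases b with ⟨b, rfl⟩ | ⟨b, rfl⟩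
    · have := congrFun h1 b
      simp only [vertexLeft, Function.update_apply] at this
      simp only [Function.update_apply, leftCrossing_inj, this]
    · rw [Function.update_of_ne (leftCrossing_lt_rightCrossing c b).ne']
      exact congrFun h2 b

theorem vertex_right_iff {v w : (connectedSum D₁ D₂ p q).Vertex} {c : Fin D₂.n} :
    w = Function.update v (rightCrossing c) true ↔
      vertexLeft w = vertexLeft v ∧ vertexRight w = Function.update (vertexRight v) c true := by
  constructor
  · rintro rfl
    constructor
    · funext b
      exact Function.update_of_ne (leftCrossing_lt_rightCrossing b c).ne _ _
    · funext b
      simp only [vertexRight, Function.update_apply, rightCrossing_inj]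
  · rintro ⟨h1, h2⟩
    funext b
    rcases crossing_cases b with ⟨b, rfl⟩ | ⟨b, rfl⟩
    · rw [Function.update_of_ne (leftCrossing_lt_rightCrossing b c).ne]
      exact congrFun h1 b
    · have := congrFun h2 b
      simp only [vertexRight, Function.update_apply] at this
      simp only [Function.update_apply, rightCrossing_inj, this]

theorem sum_crossings {M : Type*} [AddCommMonoid M] (F : Fin (connectedSum D₁ D₂ p q).n → M) :
    ∑ c, F c = ∑ c, F (leftCrossing c) + ∑ c, F (rightCrossing c) :=
  Fin.sum_univ_add F

theorem touches_left_left {v : (connectedSum D₁ D₂ p q).Vertex} {c : Fin D₁.n} {e : D₁.Edge} :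
    Touches v (leftCrossing c) (leftEdge e) ↔ Touches (vertexLeft v) c e := by
  rw [Touches, Touches, underIn_left, underOut_left, circle_swap, circle_inl_eq_iff,
    circle_inl_eq_iff]

theorem touches_left_right {v : (connectedSum D₁ D₂ p q).Vertex} {c : Fin D₁.n} {e : D₂.Edge} :
    Touches v (leftCrossing c) (rightEdge e) ↔
      D₂.circle (vertexRight v) e = D₂.circle (vertexRight v) q ∧
        Touches (vertexLeft v) c p := by
  rw [Touches, Touches, underIn_left, underOut_left, circle_swap, eq_comm,
    circle_inl_eq_inr_iff, eq_comm (b := circle _ _ (leftEdge (D₁.underOut c))),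
    circle_inl_eq_inr_iff, eq_comm (a := circle _ _ p), eq_comm (a := circle _ _ p)]
  tauto

theorem touches_right_right {v : (connectedSum D₁ D₂ p q).Vertex} {c : Fin D₂.n} {e : D₂.Edge} :
    Touches v (rightCrossing c) (rightEdge e) ↔ Touches (vertexRight v) c e := by
  rw [Touches, Touches, underIn_right, underOut_right, circle_swap, circle_inr_eq_iff,
    circle_inr_eq_iff]

theorem touches_right_left {v : (connectedSum D₁ D₂ p q).Vertex} {c : Fin D₂.n} {e : D₁.Edge} :
    Touches v (rightCrossing c) (leftEdge e) ↔
      D₁.circle (vertexLeft v) e = D₁.circle (vertexLeft v) p ∧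
        Touches (vertexRight v) c q := by
  rw [Touches, Touches, underIn_right, underOut_right, circle_swap,
    circle_inl_eq_inr_iff, circle_inl_eq_inr_iff, eq_comm (b := circle _ _ q),
    eq_comm (b := circle _ _ q)]
  tauto

theorem adjacent_left {x y : (connectedSum D₁ D₂ p q).Generator} {c : Fin D₁.n} :
    Adjacent x y (leftCrossing c) ↔
      SameOff q x.right y.right ∧ Adjacent x.left y.left c := by
  rw [adjacent_iff, adjacent_iff, sameOff_iff, vertex_left_iff]
  constructor
  · rintro ⟨h1, ⟨h2, h3⟩, h4⟩
    refine ⟨⟨h3.symm, fun f hf => h4 (rightEdge f) ?_⟩, h1, h2, fun e he => h4 (leftEdge e) ?_⟩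
    · rw [touches_left_right]
      exact fun h => hf h.1
    · rwa [touches_left_left]
  · rintro ⟨⟨h3, h4⟩, h1, h2, h5⟩
    refine ⟨h1, ⟨h2, h3.symm⟩, fun e he => ?_⟩
    rcases edge_cases e with ⟨e, rfl⟩ | ⟨e, rfl⟩
    · exact h5 e (by rwa [touches_left_left] at he)
    -- On the joined circle the label at `e` is the label at `p`, so the condition on the first
    -- summand decides.
    · by_cases h : D₂.circle x.right.1 e = D₂.circle x.right.1 q
      · have h' : D₂.circle y.right.1 e = D₂.circle y.right.1 q := by rwa [← h3]
        have e1 := x.right.lab_congr h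
        have e2 := y.right.lab_congr h'
        rw [← left_lab_eq_right_lab] at e1 e2
        rw [← lab_right, ← lab_right, e1, e2]
        exact h5 p fun ht => he (touches_left_right.2 ⟨h, ht⟩)
      · exact h4 e h

theorem adjacent_right {x y : (connectedSum D₁ D₂ p q).Generator} {c : Fin D₂.n} :
    Adjacent x y (rightCrossing c) ↔
      SameOff p x.left y.left ∧ Adjacent x.right y.right c := by
  rw [adjacent_iff, adjacent_iff, sameOff_iff, vertex_right_iff]
  constructor
  · rintro ⟨h1, ⟨h3, h2⟩, h4⟩
    refine ⟨⟨h3.symm, fun f hf => h4 (leftEdge f) ?_⟩, h1, h2, fun e he => h4 (rightEdge e) ?_⟩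
    · rw [touches_right_left]
      exact fun h => hf h.1
    · rwa [touches_right_right]
  · rintro ⟨⟨h3, h4⟩, h1, h2, h5⟩
    refine ⟨h1, ⟨h3.symm, h2⟩, fun e he => ?_⟩
    rcases edge_cases e with ⟨e, rfl⟩ | ⟨e, rfl⟩
    · by_cases h : D₁.circle x.left.1 e = D₁.circle x.left.1 p
      · have h' : D₁.circle y.left.1 e = D₁.circle y.left.1 p := by rwa [← h3]
        have e1 := x.left.lab_congr h
        have e2 := y.left.lab_congr h'
        rw [left_lab_eq_right_lab] at e1 e2
        rw [← lab_left, ← lab_left, e1, e2]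
        exact h5 q fun ht => he (touches_right_left.2 ⟨h, ht⟩)
      · exact h4 e h
    · exact h5 e (by rwa [touches_right_right] at he)

theorem edgeCoeff_left (x y : (connectedSum D₁ D₂ p q).Generator) (c : Fin D₁.n) :
    edgeCoeff x y (leftCrossing c) = edgeCoeff x.left y.left c := by
  have h : ∀ z : (connectedSum D₁ D₂ p q).Generator,
      (connectedSum D₁ D₂ p q).circle z.1 ((connectedSum D₁ D₂ p q).underIn (leftCrossing c)) =
        (connectedSum D₁ D₂ p q).circle z.1 ((connectedSum D₁ D₂ p q).underOut (leftCrossing c)) ↔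
      D₁.circle z.left.1 (D₁.underIn c) = D₁.circle z.left.1 (D₁.underOut c) := fun z => by
    rw [underIn_left, underOut_left, circle_swap, circle_inl_eq_iff]
    rfl
  classical
  rw [edgeCoeff, edgeCoeff]
  refine if_congr (not_congr (h x)) ?_ (if_congr (not_congr (h y)) ?_ rfl) <;>
    rw [underIn_left, underOut_left, circle_swap, circle_swap] <;> rfl

theorem edgeCoeff_right (x y : (connectedSum D₁ D₂ p q).Generator) (c : Fin D₂.n) :
    edgeCoeff x y (rightCrossing c) = edgeCoeff x.right y.right c := by
  have h : ∀ z : (connectedSum D₁ D₂ p q).Generator,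
      (connectedSum D₁ D₂ p q).circle z.1 ((connectedSum D₁ D₂ p q).underIn (rightCrossing c)) =
        (connectedSum D₁ D₂ p q).circle z.1 ((connectedSum D₁ D₂ p q).underOut (rightCrossing c)) ↔
      D₂.circle z.right.1 (D₂.underIn c) = D₂.circle z.right.1 (D₂.underOut c) := fun z => by
    rw [underIn_right, underOut_right, circle_swap, circle_inr_eq_iff]
    rfl
  classical
  rw [edgeCoeff, edgeCoeff]
  refine if_congr (not_congr (h x)) ?_ (if_congr (not_congr (h y)) ?_ rfl) <;>
    rw [underIn_right, underOut_right, circle_swap, circle_swap] <;> rfl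

open Classical in
theorem entry_left (x y : (connectedSum D₁ D₂ p q).Generator) (c : Fin D₁.n) :
    entry x y (leftCrossing c) =
      if SameOff q x.right y.right then entry x.left y.left c else 0 := by
  simp only [entry, adjacent_left, edgeCoeff_left, ite_and]

open Classical in
theorem entry_right (x y : (connectedSum D₁ D₂ p q).Generator) (c : Fin D₂.n) :
    entry x y (rightCrossing c) =
      if SameOff p x.left y.left then entry x.right y.right c else 0 := by
  simp only [entry, adjacent_right, edgeCoeff_right, ite_and]

theorem before_left (v : (connectedSum D₁ D₂ p q).Vertex) (c : Fin D₁.n) :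
    before v (leftCrossing c) = before (vertexLeft v) c := by
  rw [before, before, Finset.card_filter, Finset.card_filter, sum_crossings,
    Finset.sum_eq_zero (s := (Finset.univ : Finset (Fin D₂.n))), add_zero]
  · rfl
  · exact fun b _ => if_neg fun h => (leftCrossing_lt_rightCrossing c b).asymm h.1

/-- All crossings of the first summand come first; this is the source of the Koszul sign. -/
theorem before_right (x : (connectedSum D₁ D₂ p q).Generator) (c : Fin D₂.n) :
    before x.1 (rightCrossing c) = x.left.weight + before x.right.1 c := by
  rw [before, before, Generator.weight, Finset.card_filter, Finset.card_filter,
    Finset.card_filter, sum_crossings]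
  congr 1
  · exact Finset.sum_congr rfl fun b _ =>
      if_congr ⟨fun h => h.2, fun h => ⟨leftCrossing_lt_rightCrossing b c, h⟩⟩ rfl rfl
  · refine Finset.sum_congr rfl fun b _ => if_congr (and_congr_left fun _ => ?_) rfl rfl
    exact Fin.natAdd_lt_natAdd_iff _

-- The tensor product differential d ⊗ 1 ± 1 ⊗ d over ℤ[X]/(X²). Agreement of the inactive component
-- is required only off the joined circle, because the label of that circle is carried by the active
-- component.
open Classical in
theorem incidence_connectedSum (x y : (connectedSum D₁ D₂ p q).Generator) :
    incidence x y =
      (if SameOff q x.right y.right then incidence x.left y.left else 0) +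
        if SameOff p x.left y.left then (-1) ^ x.left.weight * incidence x.right y.right
        else 0 := by
  simp only [incidence_eq]
  rw [sum_crossings]
  simp only [before_left, before_right, entry_left, entry_right]
  congr 1
  · split_ifs
    · rfl
    · simp
  · split_ifs
    · simp only [pow_add, mul_assoc, Finset.mul_sum]
    · simp

/-- The product of cochains of the summands as a cochain of the connected sum: the labels of the
two circles that are joined are multiplied. -/
def glueMul (f : D₁.Generator → ℤ) (g : D₂.Generator → ℤ)
    (z : (connectedSum D₁ D₂ p q).Generator) : ℤ :=
  f z.left * g (z.right.relabel q 0) + mulX p f z.left * g (z.right.relabel q 1)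

theorem glueMul_eq (f : D₁.Generator → ℤ) (g : D₂.Generator → ℤ)
    (z : (connectedSum D₁ D₂ p q).Generator) :
    glueMul f g z =
      f (z.left.relabel p 0) * g z.right + f (z.left.relabel p 1) * mulX q g z.right := by
  have h := z.left_lab_eq_right_lab
  rcases z.left.lab_eq_zero_or_one p with h0 | h1
  · have h0' := h.symm.trans h0
    rw [glueMul, mulX_of_zero _ h0, mulX_of_zero _ h0', relabel_eq_self _ h0,
      relabel_eq_self _ h0']
    ring
  · have h1' := h.symm.trans h1
    rw [glueMul, mulX_of_one _ h1, mulX_of_one _ h1', relabel_eq_self _ h1, relabel_eq_self _ h1']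
    ring

/-- The Leibniz rule. -/
theorem diff_glueMul (f : D₁.Generator → ℤ) (g : D₂.Generator → ℤ) :
    diff (glueMul (p := p) (q := q) f g) =
      glueMul (diff f) g + glueMul (fun x => (-1) ^ x.weight * f x) (diff g) := by
  classical
  funext z
  rw [diff, Pi.add_apply]
  simp only [incidence_connectedSum, add_mul, ite_mul, zero_mul, Finset.sum_add_distrib]
  congr 1
  · rw [sum_sameOff_right z.right fun x => incidence x.left z.left * glueMul f g x, glueMul,
      ← diff_mulX, diff, diff, Finset.sum_mul, Finset.sum_mul, ← Finset.sum_add_distrib]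
    refine Finset.sum_congr rfl fun x₁ _ => ?_
    rw [glueMul, glueLeft, left_pair, right_pair, relabel_relabel, relabel_relabel]
    ring
  · rw [sum_sameOff_left z.left fun x => (-1) ^ x.left.weight * incidence x.right z.right *
      glueMul f g x, glueMul_eq, ← diff_mulX, diff, diff, Finset.mul_sum, Finset.mul_sum,
      ← Finset.sum_add_distrib]
    refine Finset.sum_congr rfl fun x₂ _ => ?_
    rw [glueMul_eq, glueRight, left_pair, right_pair, relabel_relabel, relabel_relabel]
    simp only [weight_relabel]
    ring

theorem codiff_connectedSum (φ : (connectedSum D₁ D₂ p q).Generator → ℤ)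
    (x : (connectedSum D₁ D₂ p q).Generator) :
    codiff φ x = ∑ z₁, incidence x.left z₁ * φ (glueLeft z₁ x.right) +
      (-1) ^ x.left.weight * ∑ z₂, incidence x.right z₂ * φ (glueRight x.left z₂) := by
  classical
  have comm : ∀ {D : LinkDiagram} {e : D.Edge} {a b : D.Generator},
      SameOff e a b ↔ SameOff e b a := ⟨Eq.symm, Eq.symm⟩
  rw [codiff]
  simp only [incidence_connectedSum, add_mul, ite_mul, zero_mul, Finset.sum_add_distrib]
  congr 1
  · simp only [comm (a := x.right)]
    rw [sum_sameOff_right x.right fun z => incidence x.left z.left * φ z]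
    simp only [glueLeft, left_pair]
  · simp only [comm (a := x.left)]
    rw [sum_sameOff_left x.left fun z => (-1) ^ x.left.weight * incidence x.right z.right * φ z]
    simp only [glueRight, right_pair, Finset.mul_sum, mul_assoc]

/-- The product is balanced: X may be moved across the joined circle. -/
theorem mulX_glueMul (f : D₁.Generator → ℤ) (g : D₂.Generator → ℤ) :
    glueMul (p := p) (q := q) (mulX p f) g = glueMul f (mulX q g) := by
  funext z
  rw [glueMul, glueMul, mulX_mulX]
  simp [mulX, relabel_relabel]

open Classical in
theorem left_relabel_inl (z : (connectedSum D₁ D₂ p q).Generator) (e : D₁.Edge) (s : Fin 2) :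
    (z.relabel (leftEdge e) s).left = z.left.relabel e s := by
  refine ext_lab rfl fun f => ?_
  rw [lab_left, lab_relabel, lab_relabel, lab_left]
  exact if_congr circle_inl_eq_iff rfl rfl

/-- A circle through an edge of the first summand meets the second summand only if it is the joined
circle. -/
theorem right_relabel_inl (z : (connectedSum D₁ D₂ p q).Generator) (e : D₁.Edge) (s : Fin 2) :
    SameOff q (z.relabel (leftEdge e) s).right z.right := by
  rw [sameOff_iff]
  refine ⟨rfl, fun f hf => ?_⟩
  rw [lab_right, lab_right, lab_relabel, if_neg]
  rw [eq_comm, circle_inl_eq_inr_iff]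
  exact fun h => hf h.2

end ConnectedSum

end LinkDiagram

/-- Up to a unit, φ retracts the group onto the cyclic subgroup of `z`; its kernel is the
complement. -/
theorem hasDirectSummand_of_isUnit {G : Type} [AddCommGroup G] {n : ℕ} (z : G) (hz : n • z = 0)
    (φ : G →+ ZMod n) (h : IsUnit (φ z)) : HasDirectSummand G (ZMod n) := by
  obtain ⟨u, hu⟩ := h
  have hmul : ∀ k : ℤ, φ (k • z) = (k : ZMod n) * u := by
    intro k
    rw [map_zsmul, zsmul_eq_mul, hu]
  have hker : ∀ k : ℤ, φ (k • z) = 0 → k • z = 0 := by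
    intro k hk
    rw [hmul] at hk
    have hk' : (k : ZMod n) = 0 := by
      have := congrArg (· * (↑u⁻¹ : ZMod n)) hk
      simpa [mul_assoc] using this
    obtain ⟨m, rfl⟩ := (ZMod.intCast_zmod_eq_zero_iff_dvd k n).1 hk'
    rw [mul_comm, mul_smul, natCast_zsmul, hz, smul_zero]
  have hex : ∀ a : ZMod n, ∃ k : ℤ, φ (k • z) = a := by
    intro a
    obtain ⟨k, hk⟩ := ZMod.intCast_surjective (a * (↑u⁻¹ : ZMod n))
    exact ⟨k, by rw [hmul, hk, mul_assoc, Units.inv_mul, mul_one]⟩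
  refine ⟨AddSubgroup.zmultiples z, φ.ker, ⟨?_, ?_⟩, ⟨AddEquiv.ofBijective
    (φ.comp (AddSubgroup.zmultiples z).subtype) ⟨?_, ?_⟩⟩⟩
  · rw [AddSubgroup.disjoint_def]
    rintro x ⟨k, rfl⟩ hx
    exact hker k hx
  · rw [codisjoint_iff, eq_top_iff]
    intro g _
    obtain ⟨k, hk⟩ := hex (φ g)
    rw [AddSubgroup.mem_sup]
    exact ⟨k • z, ⟨k, rfl⟩, g - k • z, by rw [AddMonoidHom.mem_ker, map_sub, hk, sub_self],
      by abel⟩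
  · rw [injective_iff_map_eq_zero]
    rintro ⟨x, k, rfl⟩ hx
    exact Subtype.ext (hker k hx)
  · intro a
    obtain ⟨k, hk⟩ := hex a
    exact ⟨⟨k • z, k, rfl⟩, hk⟩

namespace LinkDiagram

open Generator

/-! ### Torsion classes -/

/-- A cochain `z` whose class has order dividing `n`, with a functional modulo `n` that shows that
this class generates a direct summand.  The cochain is a multiple of `X` at the edge `e`. -/
structure IsTorsionClass (D : LinkDiagram) (e : D.Edge) (n : ℕ) (z w φ : D.Generator → ℤ) :
    Prop where
  eq_zero_of_lab : ∀ x, x.lab e = 0 → z x = 0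
  diff_eq_zero : diff z = 0
  diff_eq_smul : diff w = (n : ℤ) • z
  dvd_codiff : ∀ x, (n : ℤ) ∣ codiff φ x
  isCoprime : IsCoprime (∑ x, φ x * z x) (n : ℤ)

/-! ### From ungraded cochains to a summand in one bidegree -/

section Extraction

variable {D : LinkDiagram}

theorem sum_bidegree {i j : ℤ} [Fintype {x : D.Generator // x.hdeg = i ∧ x.qdeg = j}]
    (F : D.Generator → ℤ) (h : ∀ x, F x ≠ 0 → x.hdeg = i ∧ x.qdeg = j) :
    ∑ x : {x : D.Generator // x.hdeg = i ∧ x.qdeg = j}, F x.1 = ∑ x, F x := by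
  classical
  rw [← Finset.sum_filter_of_ne (p := fun x : D.Generator => x.hdeg = i ∧ x.qdeg = j)
    fun x _ hx => h x hx]
  exact (Finset.sum_subtype _ (fun x => by simp) F).symm

theorem differential_restrict (f : D.Generator → ℤ) {i i' j : ℤ} (hi : i' = i + 1)
    (y : {x : D.Generator // x.hdeg = i' ∧ x.qdeg = j}) :
    D.differential i i' j (fun x => f x.1) y = diff f y.1 := by
  classical
  refine sum_bidegree (fun x => incidence x y.1 * f x) fun x hx => ?_
  obtain ⟨h1, h2⟩ := degrees_of_incidence_ne_zero (left_ne_zero_of_mul hx)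
  have := y.2
  constructor
  · rw [this.1] at h1
    linarith
  · rw [← h2, this.2]

/-- Evaluation of a functional on cochains, modulo `n`. -/
def evalMod (φ : D.Generator → ℤ) (n : ℕ) (i j : ℤ) : D.Cochain i j →ₗ[ℤ] ZMod n :=
  (Int.castAddHom (ZMod n)).toIntLinearMap ∘ₗ ∑ y, φ y.1 • LinearMap.proj y

theorem evalMod_apply (φ : D.Generator → ℤ) (n : ℕ) (i j : ℤ) (f : D.Cochain i j) :
    evalMod φ n i j f = ((∑ y, φ y.1 * f y : ℤ) : ZMod n) := by
  simp [evalMod]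

/-- Pairing with φ after the differential is pairing with the transposed differential of φ, which
vanishes modulo `n`. The functional therefore descends to cohomology. -/
theorem evalMod_differential {φ : D.Generator → ℤ} {n : ℕ} (h : ∀ x, (n : ℤ) ∣ codiff φ x)
    {i i' j : ℤ} (hi : i' = i + 1) (f : D.Cochain i j) :
    evalMod φ n i' j (D.differential i i' j f) = 0 := by
  classical
  rw [evalMod_apply, ZMod.intCast_zmod_eq_zero_iff_dvd]
  have : ∑ y : {x : D.Generator // x.hdeg = i' ∧ x.qdeg = j},
      φ y.1 * D.differential i i' j f y = ∑ x, codiff φ x.1 * f x := by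
    have h1 : ∀ y, D.differential i i' j f y = ∑ x, incidence x.1 y.1 * f x := fun y => rfl
    simp only [h1, Finset.mul_sum]
    rw [Finset.sum_comm]
    refine Finset.sum_congr rfl fun x _ => ?_
    have h2 : codiff φ x.1 = ∑ y : {x : D.Generator // x.hdeg = i' ∧ x.qdeg = j},
        incidence x.1 y.1 * φ y.1 := by
      refine (sum_bidegree (fun y => incidence x.1 y * φ y) fun y hy => ?_).symm
      obtain ⟨h3, h4⟩ := degrees_of_incidence_ne_zero (left_ne_zero_of_mul hy)
      exact ⟨by rw [h3, x.2.1, hi], by rw [h4, x.2.2]⟩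
    rw [h2, Finset.sum_mul]
    exact Finset.sum_congr rfl fun y _ => by ring
  rw [this]
  exact Finset.dvd_sum fun x _ => (h x.1).mul_right _

/-- The pairing of φ with `z` is a sum over bidegrees. As it is prime to `p`, some bidegree
contributes a number prime to `p`, that is, a unit modulo p^l. This is where a prime power is
needed. -/
theorem IsTorsionClass.exists_hasDirectSummand {e : D.Edge} {p l : ℕ} (hp : p.Prime) (hl : 1 ≤ l)
    {z w φ : D.Generator → ℤ} (h : IsTorsionClass D e (p ^ l) z w φ) :
    ∃ i j : ℤ, HasDirectSummand (D.Kh i j) (ZMod (p ^ l)) := by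
  classical
  have hpl : ((p ^ l : ℕ) : ℤ) = (p : ℤ) ^ l := by push_cast; rfl
  have hex : ∃ i j : ℤ, ¬ (p : ℤ) ∣
      ∑ x : {x : D.Generator // x.hdeg = i ∧ x.qdeg = j}, φ x.1 * z x.1 := by
    by_contra! hall
    have hd : (p : ℤ) ∣ ∑ x, φ x * z x := by
      rw [← Finset.sum_fiberwise_of_maps_to (t := Finset.univ.image fun x : D.Generator =>
        (x.hdeg, x.qdeg)) (g := fun x => (x.hdeg, x.qdeg))
        fun x _ => Finset.mem_image_of_mem _ (Finset.mem_univ x)]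
      refine Finset.dvd_sum fun ij _ => ?_
      rw [Finset.sum_subtype (p := fun x : D.Generator => x.hdeg = ij.1 ∧ x.qdeg = ij.2) _
        (fun x => by simp [Prod.ext_iff]) fun x => φ x * z x]
      exact hall ij.1 ij.2
    have hcop := h.isCoprime
    rw [hpl, IsCoprime.pow_right_iff hl] at hcop
    exact (Nat.prime_iff_prime_int.1 hp).not_isUnit (hcop.isUnit_of_dvd' hd dvd_rfl)
  obtain ⟨i, j, hij⟩ := hex
  refine ⟨i, j, ?_⟩
  let z' : D.Cochain i j := fun x => z x.1
  have hz' : z' ∈ LinearMap.ker (D.differential i (i + 1) j) := by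
    rw [LinearMap.mem_ker]
    funext y
    rw [differential_restrict z rfl, h.diff_eq_zero]
    rfl
  have hw' : D.differential (i - 1) i j (fun x => w x.1) = (p ^ l : ℕ) • z' := by
    funext y
    rw [differential_restrict w (by ring), h.diff_eq_smul]
    simp [z']
  let Φ : D.Kh i j →ₗ[ℤ] ZMod (p ^ l) := Submodule.liftQ _
    ((evalMod φ (p ^ l) i j).comp (Submodule.subtype _)) (by
      rintro ⟨x, hx⟩ ⟨f, hf⟩
      rw [LinearMap.mem_ker, LinearMap.comp_apply]
      change evalMod φ (p ^ l) i j x = 0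
      change D.differential (i - 1) i j f = x at hf
      rw [← hf, evalMod_differential h.dvd_codiff (by ring)])
  refine hasDirectSummand_of_isUnit (Submodule.Quotient.mk ⟨z', hz'⟩) ?_ Φ.toAddMonoidHom ?_
  · rw [← Submodule.Quotient.mk_smul, Submodule.Quotient.mk_eq_zero]
    exact ⟨_, hw'⟩
  · change IsUnit (evalMod φ (p ^ l) i j z')
    rw [evalMod_apply, ZMod.coe_int_isUnit_iff_isCoprime, hpl]
    exact (((Nat.prime_iff_prime_int.1 hp).coprime_iff_not_dvd).2 hij).pow_left

end Extraction

/-! ### Propagation of torsion along connected sums -/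

section Linearity

variable {D : LinkDiagram}

/-- If both edges lie on one circle, both composites vanish because X² = 0; otherwise the two
relabellings are independent. -/
theorem mulX_comm (a e : D.Edge) (f : D.Generator → ℤ) :
    mulX a (mulX e f) = mulX e (mulX a f) := by
  funext x
  simp only [mulX]
  by_cases h : D.circle x.1 a = D.circle x.1 e
  · rw [lab_relabel, if_pos h.symm, lab_relabel, if_pos h]
    simp
  · have hc : (x.relabel a 0).relabel e 0 = (x.relabel e 0).relabel a 0 := by
      refine ext_lab rfl fun f => ?_
      rw [lab_relabel, lab_relabel, lab_relabel, lab_relabel]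
      by_cases h1 : D.circle x.1 f = D.circle x.1 e
      · refine (if_pos h1).trans ?_
        by_cases h2 : D.circle x.1 f = D.circle x.1 a
        · exact (if_pos h2).symm
        · exact ((if_neg h2).trans (if_pos h1)).symm
      · refine (if_neg h1).trans ?_
        by_cases h2 : D.circle x.1 f = D.circle x.1 a
        · exact (if_pos h2).trans (if_pos h2).symm
        · exact (if_neg h2).trans ((if_neg h2).trans (if_neg h1)).symm
    rw [lab_relabel, if_neg (Ne.symm h), lab_relabel, if_neg h, hc]
    split_ifs <;> rfl

end Linearity

section Sum

variable {D₁ D₂ : LinkDiagram} {p : D₁.Edge} {q : D₂.Edge}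

theorem glueMul_add_left (f f' : D₁.Generator → ℤ) (g : D₂.Generator → ℤ) :
    glueMul (p := p) (q := q) (f + f') g = glueMul f g + glueMul f' g := by
  funext z
  simp only [glueMul_eq, Pi.add_apply]
  ring

theorem glueMul_smul_left (c : ℤ) (f : D₁.Generator → ℤ) (g : D₂.Generator → ℤ) :
    glueMul (p := p) (q := q) (c • f) g = c • glueMul f g := by
  funext z
  simp only [glueMul_eq, Pi.smul_apply, smul_eq_mul]
  ring

theorem glueMul_smul_right (c : ℤ) (f : D₁.Generator → ℤ) (g : D₂.Generator → ℤ) :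
    glueMul (p := p) (q := q) f (c • g) = c • glueMul f g := by
  funext z
  simp only [glueMul, Pi.smul_apply, smul_eq_mul]
  ring

theorem glueMul_zero_left (g : D₂.Generator → ℤ) :
    glueMul (p := p) (q := q) 0 g = 0 := by
  funext z
  simp [glueMul_eq]

theorem glueMul_zero_right (f : D₁.Generator → ℤ) :
    glueMul (p := p) (q := q) f 0 = 0 := by
  funext z
  simp [glueMul]

theorem mulX_leftEdge_glueMul (a : D₁.Edge) (f : D₁.Generator → ℤ) (g : D₂.Generator → ℤ) :
    mulX (leftEdge a) (glueMul (p := p) (q := q) f g) = glueMul (mulX a f) g := by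
  funext z
  rw [glueMul, mulX_comm]
  rcases z.left.lab_eq_zero_or_one a with h | h
  · have h' : z.lab (leftEdge a) = 0 := h
    rw [mulX_of_zero _ h', mulX_of_zero _ h, mulX_of_zero _ h]
    simp
  · have h' : z.lab (leftEdge a) = 1 := h
    rw [mulX_of_one _ h', mulX_of_one _ h, mulX_of_one _ h, glueMul, left_relabel_inl,
      (right_relabel_inl z a 0).relabel_eq, (right_relabel_inl z a 0).relabel_eq]

/-- A relation `m X = 0` in the top cohomology, at the edge `e`, with a functional that shows that
this is the only relation. -/
structure IsTopRelation (D : LinkDiagram) (e : D.Edge) (m : ℤ) (y w α β : D.Generator → ℤ) :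
    Prop where
  diff_eq_zero : diff y = 0
  diff_eq_smul : diff w = m • mulX e y
  codiff_eq_zero : codiff α = 0
  dvd_codiff : ∀ x, m ∣ codiff β x
  eq_zero_of_lab : ∀ x, x.lab e = 1 → α x = 0
  eq_of_lab : ∀ x, x.lab e = 1 → β x = α (x.relabel e 0)
  sum_eq_one : ∑ x, α x * y x = 1

/-- A class in cohomology on which `X` at the edge `p` acts as `t X` at the edge `a`, with a
functional that shows that it generates a free module over `ℤ[X]/(X²)`. -/
structure IsScalingClass (D : LinkDiagram) (a p : D.Edge) (t : ℤ) (ζ η α β : D.Generator → ℤ) :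
    Prop where
  diff_eq_zero : diff ζ = 0
  diff_eq : diff η = t • mulX a ζ + (-1 : ℤ) • mulX p ζ
  odd : ∀ x, (-1) ^ x.weight * ζ x = -ζ x
  codiff_eq_zero : codiff α = 0
  codiff_eq_zero' : codiff β = 0
  eq_zero_of_lab : ∀ x, x.lab a = 1 → α x = 0
  eq_of_lab : ∀ x, x.lab a = 1 → β x = α (x.relabel a 0)
  eq_zero_of_lab' : ∀ x, x.lab p = 1 → α x = 0
  eq_of_lab' : ∀ x, x.lab p = 1 → β x = t * α (x.relabel p 0)
  sum_eq_one : ∑ x, α x * ζ x = 1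

/-- The bounding cochain is mη·y − ζ·w. Its boundary is tm·X_a ζ·y − m·X_p ζ·y + m·ζ·Xy, where the
odd degree of ζ gives the last sign, and the last two terms cancel by balancing. The new functionals
are α₁α₂ and β₁α₂ + tα₁β₂. -/
theorem IsTopRelation.connectedSum {a : D₁.Edge} {t m : ℤ} {ζ η α₁ β₁ : D₁.Generator → ℤ}
    {y w α₂ β₂ : D₂.Generator → ℤ} (h₂ : IsTopRelation D₂ q m y w α₂ β₂)
    (h₁ : IsScalingClass D₁ a p t ζ η α₁ β₁) :
    IsTopRelation (connectedSum D₁ D₂ p q) (leftEdge a) (t * m) (glueMul ζ y)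
      (m • glueMul η y + (-1 : ℤ) • glueMul ζ w)
      (fun z => α₁ z.left * α₂ (z.right.relabel q 0))
      (fun z => β₁ z.left * α₂ (z.right.relabel q 0) +
        t * (α₁ z.left * β₂ (z.right.relabel q 0))) := by
  have hodd : (fun x : D₁.Generator => (-1) ^ x.weight * ζ x) = (-1 : ℤ) • ζ := by
    funext x
    simp [h₁.odd x]
  have hα₁ : ∀ x, codiff α₁ x = 0 := congrFun h₁.codiff_eq_zero
  have hβ₁ : ∀ x, codiff β₁ x = 0 := congrFun h₁.codiff_eq_zero'
  have hα₂ : ∀ x, codiff α₂ x = 0 := congrFun h₂.codiff_eq_zero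
  simp only [codiff] at hα₁ hβ₁ hα₂
  constructor
  · rw [diff_glueMul, h₁.diff_eq_zero, h₂.diff_eq_zero, glueMul_zero_left, glueMul_zero_right,
      add_zero]
  · rw [diff_add, diff_smul, diff_smul, diff_glueMul, diff_glueMul, hodd, h₁.diff_eq_zero,
      h₂.diff_eq_zero, h₁.diff_eq, h₂.diff_eq_smul, glueMul_zero_left, glueMul_zero_right,
      glueMul_smul_left, glueMul_smul_right, glueMul_add_left, glueMul_smul_left,
      glueMul_smul_left, mulX_glueMul, mulX_leftEdge_glueMul]
    module
  · funext x
    rw [codiff_connectedSum]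
    -- If the joined circle has label X, then α₁ and α₂ both vanish; so the sum over the second
    -- summand factors through `codiff α₂`.
    have e1 : ∀ z₂ : D₂.Generator, incidence x.right z₂ *
        (α₁ (x.left.relabel p (z₂.lab q)) * α₂ (z₂.relabel q 0)) =
        α₁ (x.left.relabel p 0) * (incidence x.right z₂ * α₂ z₂) := by
      intro z₂
      rcases z₂.lab_eq_zero_or_one q with h | h
      · rw [h, z₂.relabel_eq_self h]
        ring
      · rw [h₁.eq_zero_of_lab' _ ((x.left.lab_relabel_self p _).trans h), h₂.eq_zero_of_lab _ h]
        ring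
    simp only [glueLeft, glueRight, left_pair, right_pair, relabel_relabel, e1, ← mul_assoc]
    rw [← Finset.sum_mul, hα₁]
    simp only [mul_assoc]
    rw [← Finset.mul_sum, hα₂]
    simp
  · intro x
    rw [codiff_connectedSum]
    -- On label X the first term is β₁α₂ = tα₁·α₂ = tα₁·β₂ with the X moved across, so the
    -- functional can also be written with the label carried by the second factor. Then `codiff α₂`
    -- contributes 0 and `codiff β₂` a multiple of m, which t turns into a multiple of tm.
    have e1 : ∀ z₂ : D₂.Generator, incidence x.right z₂ *
        (β₁ (x.left.relabel p (z₂.lab q)) * α₂ (z₂.relabel q 0) +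
          t * (α₁ (x.left.relabel p (z₂.lab q)) * β₂ (z₂.relabel q 0))) =
        β₁ (x.left.relabel p 0) * (incidence x.right z₂ * α₂ z₂) +
          t * α₁ (x.left.relabel p 0) * (incidence x.right z₂ * β₂ z₂) := by
      intro z₂
      rcases z₂.lab_eq_zero_or_one q with h | h
      · rw [h, z₂.relabel_eq_self h]
        ring
      · rw [h, h₁.eq_zero_of_lab' _ (x.left.lab_relabel_self p _), h₂.eq_zero_of_lab _ h,
          h₁.eq_of_lab' _ (x.left.lab_relabel_self p _), h₂.eq_of_lab _ h, relabel_relabel]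
        ring
    have e2 : ∀ z₁ : D₁.Generator, incidence x.left z₁ *
        (β₁ z₁ * α₂ (x.right.relabel q 0) + t * (α₁ z₁ * β₂ (x.right.relabel q 0))) =
        incidence x.left z₁ * β₁ z₁ * α₂ (x.right.relabel q 0) +
          incidence x.left z₁ * α₁ z₁ * (t * β₂ (x.right.relabel q 0)) := by
      intro z₁
      ring
    simp only [glueLeft, glueRight, left_pair, right_pair, relabel_relabel, e1, e2,
      Finset.sum_add_distrib]
    rw [← Finset.sum_mul, ← Finset.sum_mul, ← Finset.mul_sum, ← Finset.mul_sum, hα₁, hβ₁, hα₂]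
    obtain ⟨k, hk⟩ := h₂.dvd_codiff x.right
    rw [codiff] at hk
    rw [hk]
    exact ⟨(-1) ^ x.left.weight * α₁ (x.left.relabel p 0) * k, by ring⟩
  · intro x hx
    rw [h₁.eq_zero_of_lab _ hx, zero_mul]
  · intro x hx
    rw [left_relabel_inl, (right_relabel_inl x a 0).relabel_eq, h₁.eq_zero_of_lab _ hx,
      h₁.eq_of_lab _ hx]
    ring
  · simp only [glueMul]
    rw [sum_left_right fun x₁ x₂ => α₁ x₁ * α₂ (x₂.relabel q 0) *
      (ζ x₁ * y (x₂.relabel q 0) + mulX p ζ x₁ * y (x₂.relabel q 1))]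
    -- Only pairs with label 1 on both sides of the cut contribute, so the matching condition can be
    -- dropped and the sum becomes a product.
    have : ∀ (x₁ : D₁.Generator) (x₂ : D₂.Generator), (if x₁.lab p = x₂.lab q then
        α₁ x₁ * α₂ (x₂.relabel q 0) *
          (ζ x₁ * y (x₂.relabel q 0) + mulX p ζ x₁ * y (x₂.relabel q 1)) else 0) =
        α₁ x₁ * ζ x₁ * (α₂ x₂ * y x₂) := by
      intro x₁ x₂
      rcases x₁.lab_eq_zero_or_one p with h | h
      · rcases x₂.lab_eq_zero_or_one q with h' | h'
        · rw [if_pos (h.trans h'.symm), mulX_of_zero _ h, x₂.relabel_eq_self h']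
          ring
        · rw [if_neg (by rw [h, h']; decide), h₂.eq_zero_of_lab _ h']
          ring
      · rw [h₁.eq_zero_of_lab' _ h]
        simp
    simp only [this, ← Finset.mul_sum, h₂.sum_eq_one, mul_one, h₁.sum_eq_one]

/-- Multiplying the class of order `r * n` by `r` isolates the part of order `n`; β takes the value
`r` on it, a unit modulo `n`. -/
theorem IsTopRelation.isTorsionClass {D : LinkDiagram} {e : D.Edge} {r n : ℕ}
    {y w α β : D.Generator → ℤ} (h : IsTopRelation D e (r * n) y w α β)
    (hr : IsCoprime (r : ℤ) n) : IsTorsionClass D e n ((r : ℤ) • mulX e y) w β := by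
  constructor
  · intro x hx
    simp [mulX, hx]
  · rw [diff_smul, diff_mulX, h.diff_eq_zero]
    funext x
    simp [mulX]
  · rw [h.diff_eq_smul, smul_smul, mul_comm]
  · exact fun x => (Dvd.intro_left _ rfl).trans (h.dvd_codiff x)
  · have : ∑ x, β x * ((r : ℤ) • mulX e y) x = r := by
      have e1 : ∀ x, β x * ((r : ℤ) • mulX e y) x =
          if x.lab e = 1 then r * (β x * y (x.relabel e 0)) else 0 := by
        intro x
        rw [Pi.smul_apply, mulX, smul_eq_mul]
        split_ifs <;> ring
      simp only [e1]
      rw [sum_lab_one e fun x => r * (β x * y (x.relabel e 0))]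
      refine Eq.trans ?_ ((congrArg (fun s => (r : ℤ) * s) h.sum_eq_one).trans (mul_one _))
      rw [Finset.mul_sum]
      refine Finset.sum_congr rfl fun x _ => ?_
      split_ifs with hx
      · rw [h.eq_of_lab _ (x.lab_relabel_self e 1), relabel_relabel, x.relabel_eq_self hx]
      · rw [h.eq_zero_of_lab x ((x.lab_eq_zero_or_one e).resolve_left hx)]
        ring
    rwa [this]

-- Since `z` is a multiple of X, its product with κ involves only Xκ = −`o`; it is a copy of −`z`
-- placed next to the single generator `o`. The result is again a multiple of X, at `a`, because `o`
-- has label X there, so the step can be iterated.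
open Classical in
theorem IsTorsionClass.connectedSum {a : D₁.Edge} {κ : D₁.Generator → ℤ} {o : D₁.Generator}
    (hκ : diff κ = 0) (heven : ∀ x, (-1) ^ x.weight * κ x = κ x)
    (hκo : ∀ x, mulX p κ x = if x = o then -1 else 0) (hoa : o.lab a = 1) (hop : o.lab p = 1)
    (ho : o.weight = 0) {n : ℕ} {z w φ : D₂.Generator → ℤ} (h : IsTorsionClass D₂ q n z w φ) :
    IsTorsionClass (connectedSum D₁ D₂ p q) (leftEdge a) n (glueMul κ z) (glueMul κ w)
      (fun x => if SameOff p x.left o then φ x.right else 0) := by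
  have heven' : (fun x : D₁.Generator => (-1) ^ x.weight * κ x) = κ := funext heven
  -- The first term of the product vanishes because `z` is zero on generators with label 1 at `q`.
  have hmul : ∀ x : (LinkDiagram.connectedSum D₁ D₂ p q).Generator,
      glueMul κ z x = (if x.left = o then -1 else 0) * z (x.right.relabel q 1) := by
    intro x
    rw [glueMul, hκo, h.eq_zero_of_lab _ (x.right.lab_relabel_self q 0)]
    ring
  constructor
  · intro x hx
    rw [hmul, if_neg, zero_mul]
    rintro rfl
    rw [lab_left, hx] at hoa
    exact absurd hoa (by decide)
  · rw [diff_glueMul, hκ, h.diff_eq_zero, glueMul_zero_left, glueMul_zero_right, add_zero]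
  · rw [diff_glueMul, hκ, heven', h.diff_eq_smul, glueMul_zero_left, glueMul_smul_right, zero_add]
  · intro x
    rw [codiff_connectedSum, Finset.sum_eq_zero, zero_add]
    · by_cases hx : SameOff p x.left o
      · have : ∀ z₂ : D₂.Generator, SameOff p (x.left.relabel p (z₂.lab q)) o := by
          intro z₂
          rw [SameOff, relabel_relabel]
          exact hx
        simp only [glueRight, left_pair, right_pair, this, if_true]
        exact (h.dvd_codiff x.right).mul_left _
      · have : ∀ z₂ : D₂.Generator, ¬ SameOff p (x.left.relabel p (z₂.lab q)) o := by
          intro z₂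
          rw [SameOff, relabel_relabel]
          exact hx
        simp [glueRight, this]
    · intro z₁ _
      simp only [glueLeft, left_pair]
      split_ifs with hz
      -- The differential raises the weight, so no generator of the first summand maps to one of
      -- weight 0.
      · have hw : z₁.weight = 0 := by
          rw [← ho, ← z₁.weight_relabel p 0, hz, weight_relabel]
        by_cases hi : incidence x.left z₁ = 0
        · rw [hi, zero_mul]
        · have := (degrees_of_incidence_ne_zero hi).1
          rw [Generator.hdeg, Generator.hdeg, hw] at this
          push_cast at this
          omega
      · exact mul_zero _
  · have : ∑ x : (LinkDiagram.connectedSum D₁ D₂ p q).Generator,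
        (if SameOff p x.left o then φ x.right else 0) * glueMul κ z x = -∑ x, φ x * z x := by
      simp only [ite_mul, zero_mul]
      rw [sum_sameOff_left o fun x => φ x.right * glueMul κ z x, ← Finset.sum_neg_distrib]
      refine Finset.sum_congr rfl fun x₂ _ => ?_
      rw [hmul, glueRight, left_pair, right_pair]
      rcases x₂.lab_eq_zero_or_one q with h0 | h1
      · rw [if_neg, h.eq_zero_of_lab _ h0]
        · ring
        · intro ho'
          rw [← ho', lab_relabel_self, h0] at hop
          exact absurd hop (by decide)
      · rw [h1, o.relabel_eq_self hop, if_pos rfl, x₂.relabel_eq_self h1]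
        ring
    rw [this]
    exact h.isCoprime.neg_left

end Sum

/-! ### Computation with bit masks

The functions of this section are written for evaluation in the kernel: they use the operations on
natural numbers that the kernel evaluates natively, and `force` makes it evaluate an argument
before it is copied. -/

namespace Code

/-- The application `f n`, evaluated strictly. -/
def force {β : Type} (n : ℕ) (f : ℕ → β) : β := Nat.rec (f 0) (fun k _ => f (Nat.succ k)) n

theorem force_eq {β : Type} (n : ℕ) (f : ℕ → β) : force n f = f n := by
  cases n <;> rfl

theorem beq_eq_true_iff (a b : ℕ) : Nat.beq a b = true ↔ a = b :=
  ⟨Nat.eq_of_beq_eq_true, fun h => h ▸ Nat.beq_refl a⟩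

/-- The bit number `i` of `m`. -/
def bit (m i : ℕ) : Bool := Nat.beq (Nat.land (Nat.shiftRight m i) 1) 1

theorem bit_eq (m i : ℕ) : bit m i = m.testBit i := by
  change ((m >>> i) &&& 1).beq 1 = _
  rw [Nat.testBit_eq_decide_div_mod_eq, Nat.and_one_is_mod, Nat.shiftRight_eq_div_pow,
    Bool.eq_iff_iff, beq_eq_true_iff, decide_eq_true_eq]

/-- One step of the search for the edges connected to the edges in `M`.  The bit `i` of `v` is set
if there is an arc from `i` to `i + S`, the bit `i` of `u` if there is an arc from `i` to `i + 1`;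
there are also arcs from `i` to `i + N` for `i < S`. -/
def flow (S N v u M : ℕ) : ℕ :=
  Nat.lor M (Nat.lor
    (Nat.lor (Nat.lor (Nat.shiftLeft (Nat.land M v) S) (Nat.land (Nat.shiftRight M S) v))
      (Nat.lor (Nat.shiftLeft (Nat.land M u) 1) (Nat.land (Nat.shiftRight M 1) u)))
    (Nat.lor (Nat.shiftRight M N) (Nat.shiftLeft (Nat.land M (Nat.sub (Nat.pow 2 S) 1)) N)))

/-- The mask of the vertical arcs in the resolution with code `h`. -/
def vertical (N h : ℕ) : ℕ :=
  Nat.xor (Nat.sub (Nat.pow 2 N) 1)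
    (Nat.land (Nat.sub (Nat.pow 2 N) 1) (Nat.lor h (Nat.shiftLeft h 1)))

/-- The mask of the horizontal arcs in the resolution with code `h`. -/
def horizontal (S h : ℕ) : ℕ := Nat.lor h (Nat.shiftLeft h S)

/-- Two indices of edges are joined in the resolution with code `h`. -/
def Link (S N h i j : ℕ) : Prop :=
  ((vertical N h).testBit i = true ∧ j = i + S) ∨
    ((horizontal S h).testBit i = true ∧ j = i + 1) ∨ (i < S ∧ j = i + N)

/-- A 1-smoothed crossing with index p interrupts the strands at p and p + 1. For a 0-smoothed
crossing of a positive braid the strands run straight upwards. -/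
theorem testBit_vertical (N h i : ℕ) : (vertical N h).testBit i = true ↔
    i < N ∧ h.testBit i = false ∧ ∀ k, i = k + 1 → h.testBit k = false := by
  change ((2 ^ N - 1) ^^^ ((2 ^ N - 1) &&& (h ||| h <<< 1))).testBit i = true ↔ _
  rw [Nat.testBit_xor, Nat.testBit_and, Nat.testBit_two_pow_sub_one, Nat.testBit_or,
    Nat.testBit_shiftLeft]
  by_cases hi : i < N
  · cases i with
    | zero => simp [hi]
    | succ k => simp [hi]
  · simp [hi]

/-- A 1-smoothed crossing gives one horizontal arc on its own level and one on the next level. -/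
theorem testBit_horizontal (S h i : ℕ) : (horizontal S h).testBit i = true ↔
    h.testBit i = true ∨ ∃ k, i = k + S ∧ h.testBit k = true := by
  change (h ||| h <<< S).testBit i = true ↔ _
  rw [Nat.testBit_or, Nat.testBit_shiftLeft, Bool.or_eq_true, Bool.and_eq_true,
    decide_eq_true_eq]
  refine or_congr_right ⟨fun ⟨h1, h2⟩ => ⟨i - S, by omega, h2⟩, ?_⟩
  rintro ⟨k, rfl, hk⟩
  exact ⟨by omega, by rwa [Nat.add_sub_cancel]⟩

theorem testBit_flow {S N h M : ℕ} (hM : M < 2 ^ (N + S)) (i : ℕ) :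
    (flow S N (vertical N h) (horizontal S h) M).testBit i = true ↔ M.testBit i = true ∨
      ∃ j, (Link S N h i j ∨ Link S N h j i) ∧ M.testBit j = true := by
  change (M ||| ((((M &&& vertical N h) <<< S) ||| ((M >>> S) &&& vertical N h)) |||
    (((M &&& horizontal S h) <<< 1) ||| ((M >>> 1) &&& horizontal S h)) |||
    ((M >>> N) ||| ((M &&& (2 ^ S - 1)) <<< N)))).testBit i = true ↔ _
  simp only [Nat.testBit_or, Nat.testBit_shiftLeft, Nat.testBit_shiftRight, Nat.testBit_and,
    Nat.testBit_two_pow_sub_one, Bool.or_eq_true, Bool.and_eq_true, decide_eq_true_eq, Link]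
  constructor
  · rintro (h | ((⟨h1, h2, h3⟩ | ⟨h1, h2⟩) | ⟨h1, h2, h3⟩ | ⟨h1, h2⟩) | h | ⟨h1, h2, h3⟩)
    · exact .inl h
    · exact .inr ⟨i - S, .inr (.inl ⟨h3, by omega⟩), h2⟩
    · exact .inr ⟨S + i, .inl (.inl ⟨h2, by omega⟩), h1⟩
    · exact .inr ⟨i - 1, .inr (.inr (.inl ⟨h3, by omega⟩)), h2⟩
    · exact .inr ⟨1 + i, .inl (.inr (.inl ⟨h2, by omega⟩)), h1⟩
    -- The shift by `N` is the only move that is not masked. The bound on `M` ensures that it uses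
    -- closing arcs only.
    · have : N + i < N + S := by
        by_contra hi
        rw [Nat.testBit_lt_two_pow (hM.trans_le (Nat.pow_le_pow_right (by omega)
          (not_lt.1 hi)))] at h
        exact absurd h (by decide)
      exact .inr ⟨N + i, .inl (.inr (.inr ⟨by omega, by omega⟩)), h⟩
    · exact .inr ⟨i - N, .inr (.inr (.inr ⟨h3, by omega⟩)), h2⟩
  · rintro (h | ⟨j, (⟨h1, rfl⟩ | ⟨h1, rfl⟩ | ⟨h1, rfl⟩) | (⟨h1, rfl⟩ | ⟨h1, rfl⟩ | ⟨h1, rfl⟩), h2⟩)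
    · exact .inl h
    · exact .inr (.inl (.inl (.inr ⟨by rwa [add_comm], h1⟩)))
    · exact .inr (.inl (.inr (.inr ⟨by rwa [add_comm], h1⟩)))
    · exact .inr (.inr (.inl (by rwa [add_comm])))
    · exact .inr (.inl (.inl (.inl ⟨by omega, by rwa [Nat.add_sub_cancel],
        by rwa [Nat.add_sub_cancel]⟩)))
    · exact .inr (.inl (.inr (.inl ⟨by omega, by rwa [Nat.add_sub_cancel],
        by rwa [Nat.add_sub_cancel]⟩)))
    · exact .inr (.inr (.inr ⟨by omega, by rwa [Nat.add_sub_cancel],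
        by rwa [Nat.add_sub_cancel]⟩))

/-- Repeat `flow` until nothing changes, at most `fuel` times. -/
def floodAux (S N v u : ℕ) : ℕ → ℕ → ℕ
  | 0, M => M
  | fuel + 1, M => force (flow S N v u M) fun M₁ =>
      bif Nat.beq M₁ M then M else floodAux S N v u fuel M₁

/-- The mask of the edges connected to the edges in `M` in the resolution with code `h`. -/
def flood (S N h M : ℕ) : ℕ :=
  force (vertical N h) fun v => force (horizontal S h) fun u =>
    floodAux S N v u (Nat.pow 2 (Nat.add N S)) M

/-- The codes of the labels obtained from those with code `m` on two circles with masks `P` and `Q`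
and labels `s` and `t`, when they become one circle: by multiplication if `b` is true, and by the
transpose of comultiplication otherwise. -/
def toOne (b : Bool) (P Q m : ℕ) (s t : Bool) : List ℕ :=
  force (Nat.lor P Q) fun R => force (Nat.xor m (Nat.land m R)) fun r =>
    match b, s, t with
    | true, true, true => []
    | true, true, false => [Nat.lor r R]
    | true, false, true => [Nat.lor r R]
    | true, false, false => [r]
    | false, true, true => [Nat.lor r R]
    | false, true, false => [r]
    | false, false, true => [r]
    | false, false, false => []

/-- The codes of the labels obtained from those with code `m` on one circle with label `s`, when it
becomes two circles with masks `P` and `Q`: by the transpose of multiplication if `b` is true, and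
by comultiplication otherwise. -/
def toTwo (b : Bool) (P Q m : ℕ) (s : Bool) : List ℕ :=
  force (Nat.lor P Q) fun R => force (Nat.xor m (Nat.land m R)) fun r =>
    match b, s with
    | true, true => [Nat.lor r P, Nat.lor r Q]
    | true, false => [r]
    | false, true => [Nat.lor r R]
    | false, false => [Nat.lor r P, Nat.lor r Q]

/-- A linear combination of labellings of the circles of one resolution. -/
abbrev Terms : Type := List (ℕ × ℤ)

/-- A linear combination of generators, as a list of codes of resolutions with codes of
labellings and coefficients. -/
abbrev Chain : Type := List (ℕ × Terms)

/-- The coefficient of `m`. -/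
def Terms.coeff (m : ℕ) : Terms → ℤ
  | [] => 0
  | q :: l => (if q.1 = m then q.2 else 0) + Terms.coeff m l

/-- The coefficient of the labelling `m` of the resolution `h`. -/
def Chain.coeff (h m : ℕ) : Chain → ℤ
  | [] => 0
  | q :: L => (if q.1 = h then q.2.coeff m else 0) + Chain.coeff h m L

/-- Apply `g` to all terms of `l` and multiply by `a`. -/
def Terms.bind (a : ℤ) (g : ℕ → List ℕ) : Terms → Terms
  | [] => []
  | (m, c) :: l => ((g m).map fun k => (k, a * c)) ++ Terms.bind a g l

theorem Terms.coeff_append (m : ℕ) (l l' : Terms) :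
    Terms.coeff m (l ++ l') = Terms.coeff m l + Terms.coeff m l' := by
  induction l with
  | nil => simp [Terms.coeff]
  | cons q l ih =>
    rw [List.cons_append, Terms.coeff, Terms.coeff, ih]
    ring

theorem Chain.coeff_append (h m : ℕ) (L L' : Chain) :
    Chain.coeff h m (L ++ L') = Chain.coeff h m L + Chain.coeff h m L' := by
  induction L with
  | nil => simp [Chain.coeff]
  | cons q l ih =>
    rw [List.cons_append, Chain.coeff, Chain.coeff, ih]
    ring

theorem Terms.coeff_map (k : ℕ) (a : ℤ) (l : List ℕ) :
    Terms.coeff k (l.map fun k => (k, a)) = a * l.count k := by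
  induction l with
  | nil => simp [Terms.coeff]
  | cons q l ih =>
    rw [List.map_cons, Terms.coeff, ih, List.count_cons]
    by_cases h : q = k
    · simp [h]
      ring
    · simp [h]

theorem Terms.coeff_bind (k : ℕ) (a : ℤ) (g : ℕ → List ℕ) (l : Terms) :
    Terms.coeff k (Terms.bind a g l) = (l.map fun q => a * q.2 * (g q.1).count k).sum := by
  induction l with
  | nil => rfl
  | cons q l ih => rw [Terms.bind, Terms.coeff_append, Terms.coeff_map, ih, List.map_cons,
      List.sum_cons]

/-- The part of the differential at one crossing. -/
def fwdAt (S N h h' p : ℕ) (a : ℤ) (l : Terms) : Terms :=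
  force (flood S N h (Nat.pow 2 (Nat.add p 1))) fun P =>
    bif bit P (Nat.add p S) then
      force (flood S N h' (Nat.pow 2 (Nat.add p 1))) fun P =>
        bif bit P (Nat.add p S) then [] else
        force (flood S N h' (Nat.pow 2 (Nat.add p S))) fun Q =>
          l.bind a fun m => toTwo false P Q m (bit m (Nat.add p 1))
    else force (flood S N h (Nat.pow 2 (Nat.add p S))) fun Q =>
      l.bind a fun m => toOne true P Q m (bit m (Nat.add p 1)) (bit m (Nat.add p S))

/-- The part of the transposed differential at one crossing. -/
def bwdAt (S N h h' p : ℕ) (a : ℤ) (l : Terms) : Terms :=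
  force (flood S N h' (Nat.pow 2 (Nat.add p 1))) fun P =>
    bif bit P (Nat.add p S) then
      force (flood S N h (Nat.pow 2 (Nat.add p 1))) fun P =>
        bif bit P (Nat.add p S) then [] else
        force (flood S N h (Nat.pow 2 (Nat.add p S))) fun Q =>
          l.bind a fun m => toOne false P Q m (bit m (Nat.add p 1)) (bit m (Nat.add p S))
    else force (flood S N h' (Nat.pow 2 (Nat.add p S))) fun Q =>
      l.bind a fun m => toTwo true P Q m (bit m (Nat.add p 1))

/-- The differential of a linear combination with the resolution `h`. -/
def fwdAux (S N h : ℕ) (l : Terms) : List ℕ → ℤ → Chain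
  | [], _ => []
  | p :: ps, a => bif bit h p then fwdAux S N h l ps (-a) else
      (force (Nat.lor h (Nat.pow 2 p)) fun h' => (h', fwdAt S N h h' p a l)) ::
        fwdAux S N h l ps a

/-- The transposed differential of a linear combination with the resolution `h`. -/
def bwdAux (S N h : ℕ) (l : Terms) : List ℕ → ℤ → Chain
  | [], _ => []
  | p :: ps, a => bif bit h p then
      (force (Nat.xor h (Nat.pow 2 p)) fun h' => (h', bwdAt S N h h' p a l)) ::
        bwdAux S N h l ps (-a)
      else bwdAux S N h l ps a

/-- The differential. -/
def fwd (S N : ℕ) (ps : List ℕ) : Chain → Chain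
  | [] => []
  | q :: L => fwdAux S N q.1 q.2 ps 1 ++ fwd S N ps L

/-- The transposed differential. -/
def bwd (S N : ℕ) (ps : List ℕ) : Chain → Chain
  | [] => []
  | q :: L => bwdAux S N q.1 q.2 ps 1 ++ bwd S N ps L

/-- The terms without the bit `i`, with the bits `P` added, multiplied by `a`. -/
def Terms.addCircle (P i : ℕ) (a : ℤ) : Terms → Terms
  | [] => []
  | (m, c) :: l => bif bit m i then Terms.addCircle P i a l else
      (Nat.lor m P, a * c) :: Terms.addCircle P i a l

/-- Multiplication by `a X` at the edge `i`. -/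
def timesX (S N i : ℕ) (a : ℤ) : Chain → Chain
  | [] => []
  | (h, l) :: L => (h, force (flood S N h (Nat.pow 2 i)) fun P => l.addCircle P i a) ::
      timesX S N i a L

/-- The terms with the bit `i`. -/
def Terms.withBit (i : ℕ) : Terms → Terms
  | [] => []
  | (m, c) :: l => bif bit m i then (m, c) :: Terms.withBit i l else Terms.withBit i l

/-- The part with the label `X` at the edge `i`. -/
def Chain.withBit (i : ℕ) : Chain → Chain
  | [] => []
  | (h, l) :: L => (h, l.withBit i) :: Chain.withBit i L

/-- The chain is a linear combination of codes of generators. -/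
def Chain.valid (S N : ℕ) (ps : List ℕ) (L : Chain) : Bool :=
  L.all fun q => Nat.beq (Nat.land q.1 (ps.foldr (fun p s => Nat.lor (Nat.pow 2 p) s) 0)) q.1 &&
    q.2.all fun r => Nat.blt r.1 (Nat.pow 2 (Nat.add N S)) &&
      Nat.beq (flow S N (vertical N q.1) (horizontal S q.1) r.1) r.1

/-- The weights of all vertices are congruent to `r` modulo `2`. -/
def Chain.hasParity (ps : List ℕ) (r : ℕ) (L : Chain) : Bool :=
  L.all fun q => Nat.beq (Nat.mod (ps.countP (bit q.1)) 2) r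

/-! ### Divisibility of all coefficients -/

/-- Search trees, used to collect the terms with the same key. -/
inductive Tree (α : Type) : Type
  | leaf : Tree α
  | node (l : Tree α) (k : ℕ) (v : α) (r : Tree α) : Tree α

/-- Add the value `v` at the key `k`, and pass the resulting tree to `f`. -/
def Tree.insert {α β : Type} (op : α → α → α) (k : ℕ) (v : α) : Tree α → (Tree α → β) → β
  | leaf, f => f (node leaf k v leaf)
  | node l k₁ v₁ r, f => bif Nat.beq k k₁ then f (node l k₁ (op v v₁) r) else
      bif Nat.ble k k₁ then Tree.insert op k v l fun l₁ => f (node l₁ k₁ v₁ r) else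
      Tree.insert op k v r fun r₁ => f (node l k₁ v₁ r₁)

/-- Add all entries of a list, and pass the resulting tree to `f`. -/
def Tree.insertList {α β : Type} (op : α → α → α) : List (ℕ × α) → Tree α → (Tree α → β) → β
  | [], t, f => f t
  | (k, v) :: L, t, f => force k fun k =>
      Tree.insert op k v t fun t' => Tree.insertList op L t' f

/-- All values satisfy `p`. -/
def Tree.all {α : Type} (p : α → Bool) : Tree α → Bool
  | leaf => true
  | node l _ v r => p v && (l.all p && r.all p)

/-- The sum of all values at the key `k`, measured by `val`. -/
def Tree.sum {α : Type} (val : α → ℤ) (k : ℕ) : Tree α → ℤ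
  | leaf => 0
  | node l k' v r => (if k' = k then val v else 0) + (Tree.sum val k l + Tree.sum val k r)

/-- Only the total value at each key is tracked. No ordering of the tree is needed for correctness:
if every node is divisible by `d`, so is every total, even if a key occurred twice. -/
theorem Tree.insert_eq {α β : Type} {op : α → α → α} {val : α → ℤ}
    (hadd : ∀ a b, val (op a b) = val a + val b) (k : ℕ) (v : α) (t : Tree α) (f : Tree α → β) :
    ∃ t', Tree.insert op k v t f = f t' ∧
      ∀ j, t'.sum val j = t.sum val j + if k = j then val v else 0 := by
  induction t generalizing f with
  | leaf => exact ⟨_, rfl, fun j => by simp [Tree.sum]⟩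
  | node l k' v' r ihl ihr =>
    rw [Tree.insert]
    cases h : Nat.beq k k' with
    | true =>
      refine ⟨_, rfl, fun j => ?_⟩
      rw [beq_eq_true_iff] at h
      subst h
      simp only [Tree.sum, hadd]
      split_ifs <;> ring
    | false =>
      cases h' : Nat.ble k k' with
      | true =>
        obtain ⟨t', h1, h2⟩ := ihl fun l' => f (node l' k' v' r)
        refine ⟨_, h1, fun j => ?_⟩
        simp only [Tree.sum, h2]
        ring
      | false =>
        obtain ⟨t', h1, h2⟩ := ihr fun r' => f (node l k' v' r')
        refine ⟨_, h1, fun j => ?_⟩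
        simp only [Tree.sum, h2]
        ring

theorem Tree.insertList_eq {α β : Type} {op : α → α → α} {val : α → ℤ}
    (hadd : ∀ a b, val (op a b) = val a + val b) (L : List (ℕ × α)) (t : Tree α)
    (f : Tree α → β) :
    ∃ t', Tree.insertList op L t f = f t' ∧ ∀ j, t'.sum val j = t.sum val j +
      (L.map fun q => if q.1 = j then val q.2 else 0).sum := by
  induction L generalizing t with
  | nil => exact ⟨t, rfl, fun j => by simp⟩
  | cons q L ih =>
    obtain ⟨k, v⟩ := q
    rw [Tree.insertList, force_eq]
    obtain ⟨t₁, h1, h2⟩ := Tree.insert_eq hadd k v t fun t' => Tree.insertList op L t' f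
    obtain ⟨t₂, h3, h4⟩ := ih t₁
    refine ⟨t₂, h1.trans h3, fun j => ?_⟩
    rw [h4, h2, List.map_cons, List.sum_cons]
    ring

theorem Tree.dvd_sum {α : Type} {val : α → ℤ} {p : α → Bool} {d : ℤ}
    (hp : ∀ v, p v = true → d ∣ val v) {t : Tree α} (h : t.all p = true) (k : ℕ) :
    d ∣ t.sum val k := by
  induction t with
  | leaf => exact dvd_zero d
  | node l k' v r ihl ihr =>
    simp only [Tree.all, Bool.and_eq_true] at h
    refine dvd_add ?_ (dvd_add (ihl h.2.1) (ihr h.2.2))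
    split_ifs
    · exact hp v h.1
    · exact dvd_zero d

/-- All coefficients are divisible by `d`. -/
def Terms.dvd (d : ℤ) (l : Terms) : Bool :=
  Tree.insertList (· + ·) l .leaf (Tree.all fun c => decide (d ∣ c))

/-- All coefficients are divisible by `d`. -/
def Chain.dvd (d : ℤ) (L : Chain) : Bool :=
  Tree.insertList (· ++ ·) L .leaf (Tree.all (Terms.dvd d))

theorem Terms.dvd_coeff {d : ℤ} {l : Terms} (h : l.dvd d = true) (m : ℕ) : d ∣ l.coeff m := by
  obtain ⟨t, h1, h2⟩ := Tree.insertList_eq (op := (· + ·)) (val := id) (fun _ _ => rfl) l .leaf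
    (Tree.all fun c => decide (d ∣ c))
  have h3 := Tree.dvd_sum (val := id) (d := d) (fun c hc => of_decide_eq_true hc)
    (h1.symm.trans h) m
  rw [h2, Tree.sum, zero_add] at h3
  convert h3
  clear h h1 h2 h3
  induction l with
  | nil => rfl
  | cons q l ih => rw [Terms.coeff, ih, List.map_cons, List.sum_cons, id]

theorem Chain.dvd_coeff {d : ℤ} {L : Chain} (h : L.dvd d = true) (k m : ℕ) :
    d ∣ L.coeff k m := by
  obtain ⟨t, h1, h2⟩ := Tree.insertList_eq (op := (· ++ ·)) (val := Terms.coeff m)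
    (fun _ _ => Terms.coeff_append _ _ _) L .leaf (Tree.all (Terms.dvd d))
  have h3 := Tree.dvd_sum (val := Terms.coeff m) (d := d) (fun c hc => Terms.dvd_coeff hc m)
    (h1.symm.trans h) k
  rw [h2, Tree.sum, zero_add] at h3
  convert h3
  clear h h1 h2 h3
  induction L with
  | nil => rfl
  | cons q l ih => rw [Chain.coeff, ih, List.map_cons, List.sum_cons]

end Code

/-! ### Closed braids -/

section Braid

variable {m : ℕ} {w : List (Fin m)}

/-- The index of an edge of a closed braid. -/
def edgeIndex (e : (braidClosure w).Edge) : ℕ :=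
  (m + 1) * (e : Fin (w.length + 1) × Fin (m + 1)).1 + (e : Fin (w.length + 1) × Fin (m + 1)).2

/-- The index of the edge on which the overpass enters a crossing of a closed braid. -/
def crossingIndex (c : Fin (braidClosure w).n) : ℕ :=
  (m + 1) * (c : Fin w.length) + w.get (c : Fin w.length)

theorem edgeIndex_injective : Function.Injective (edgeIndex (w := w)) := by
  rintro ⟨⟨t, ht⟩, ⟨j, hj⟩⟩ ⟨⟨t', ht'⟩, ⟨j', hj'⟩⟩ h
  change (m + 1) * t + j = (m + 1) * t' + j' at h
  have h1 : t = t' := by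
    have := congrArg (· / (m + 1)) h
    simpa [Nat.mul_add_div, Nat.div_eq_of_lt hj, Nat.div_eq_of_lt hj'] using this
  subst h1
  have h2 : j = j' := by omega
  subst h2
  rfl

theorem edgeIndex_lt (e : (braidClosure w).Edge) :
    edgeIndex e < w.length * (m + 1) + (m + 1) := by
  obtain ⟨⟨t, ht⟩, ⟨j, hj⟩⟩ := e
  change (m + 1) * t + j < _
  nlinarith [Nat.le_of_lt_succ ht]

theorem exists_edgeIndex {i : ℕ} (hi : i < w.length * (m + 1) + (m + 1)) :
    ∃ e : (braidClosure w).Edge, edgeIndex e = i :=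
  ⟨((⟨i / (m + 1), Nat.div_lt_of_lt_mul (by linarith)⟩ : Fin (w.length + 1)),
    (⟨i % (m + 1), Nat.mod_lt _ (Nat.succ_pos m)⟩ : Fin (m + 1))), Nat.div_add_mod i (m + 1)⟩

theorem braidPassages_inl (p : Fin w.length × Bool) :
    braidPassages w (Sum.inl p) = braidIn w p := rfl

theorem braidPassages_inr (s : {e // e ∉ Set.range (braidIn w)}) :
    braidPassages w (Sum.inr s) = s.1 := rfl

theorem edgeIndex_overIn (c : Fin (braidClosure w).n) :
    edgeIndex ((braidClosure w).overIn c) = crossingIndex c := by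
  have : (braidClosure w).overIn c = braidIn w (c, true) := braidPassages_inl (c, true)
  rw [this]
  rfl

theorem edgeIndex_underIn (c : Fin (braidClosure w).n) :
    edgeIndex ((braidClosure w).underIn c) = crossingIndex c + 1 := by
  have : (braidClosure w).underIn c = braidIn w (c, false) := braidPassages_inl (c, false)
  rw [this]
  rfl

theorem prodShear_braidIn (p : Fin w.length × Bool) :
    Equiv.prodShear (finRotate (w.length + 1)) (levelPerm w) (braidIn w p) =
      (p.1.succ, if p.2 then (w.get p.1).succ else (w.get p.1).castSucc) := by
  obtain ⟨c, b⟩ := p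
  have h : levelPerm w c.castSucc = Equiv.swap (w.get c).castSucc (w.get c).succ := by
    simp [levelPerm]
  have h' : finRotate (w.length + 1) c.castSucc = c.succ := by
    rw [finRotate_apply, Fin.coeSucc_eq_succ]
  cases b <;> simp [braidIn, h, h']

theorem edgeIndex_overOut (c : Fin (braidClosure w).n) :
    edgeIndex ((braidClosure w).overOut c) = crossingIndex c + (m + 1) + 1 := by
  have : (braidClosure w).overOut c = Equiv.prodShear (finRotate (w.length + 1)) (levelPerm w)
      (braidIn w (c, true)) :=
    congrArg (Equiv.prodShear (finRotate (w.length + 1)) (levelPerm w))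
      (braidPassages_inl (c, true))
  rw [this, prodShear_braidIn]
  change (m + 1) * (_ + 1) + (_ + 1) = (m + 1) * _ + _ + (m + 1) + 1
  ring

theorem edgeIndex_underOut (c : Fin (braidClosure w).n) :
    edgeIndex ((braidClosure w).underOut c) = crossingIndex c + (m + 1) := by
  have : (braidClosure w).underOut c = Equiv.prodShear (finRotate (w.length + 1)) (levelPerm w)
      (braidIn w (c, false)) :=
    congrArg (Equiv.prodShear (finRotate (w.length + 1)) (levelPerm w))
      (braidPassages_inl (c, false))
  rw [this, prodShear_braidIn]
  change (m + 1) * (_ + 1) + (w.get (c : Fin w.length) : ℕ) = (m + 1) * _ + _ + (m + 1)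
  ring

theorem crossingIndex_injective : Function.Injective (crossingIndex (w := w)) := by
  intro c c' h
  rw [← edgeIndex_overIn, ← edgeIndex_overIn] at h
  simpa [overIn] using edgeIndex_injective h

/-- The under passage of one crossing is never the over passage of another. Bits of different
crossings therefore do not interfere in the arc masks. -/
theorem crossingIndex_ne (c c' : Fin (braidClosure w).n) :
    crossingIndex c + 1 ≠ crossingIndex c' := by
  rw [← edgeIndex_overIn c', ← edgeIndex_underIn c]
  intro h
  simpa [overIn, underIn] using edgeIndex_injective h

theorem crossingIndex_add_one_lt (c : Fin (braidClosure w).n) :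
    crossingIndex c + 1 < w.length * (m + 1) := by
  have h1 : (c : ℕ) + 1 ≤ w.length := c.2
  have h2 : ((w.get (c : Fin w.length) : Fin m) : ℕ) + 1 ≤ m := (w.get (c : Fin w.length)).2
  have h3 := Nat.mul_le_mul_right (m + 1) h1
  change (m + 1) * (c : ℕ) + _ + 1 < _
  nlinarith

/-- A marked point continues a strand to the next level, or it lies on the last level and closes the
braid up to level 0. -/
theorem edgeIndex_point (s : (braidClosure w).Pt) :
    (edgeIndex ((braidClosure w).inEdge (.inr s)) < w.length * (m + 1) ∧
      edgeIndex ((braidClosure w).outEdge (.inr s)) =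
        edgeIndex ((braidClosure w).inEdge (.inr s)) + (m + 1)) ∨
    (edgeIndex ((braidClosure w).outEdge (.inr s)) < m + 1 ∧
      edgeIndex ((braidClosure w).inEdge (.inr s)) =
        edgeIndex ((braidClosure w).outEdge (.inr s)) + w.length * (m + 1)) := by
  obtain ⟨⟨t, j⟩, hs⟩ := s
  have h1 : (braidClosure w).inEdge (.inr ⟨(t, j), hs⟩) = (t, j) := braidPassages_inr _
  have h2 : (braidClosure w).outEdge (.inr ⟨(t, j), hs⟩) =
      (finRotate (w.length + 1) t, levelPerm w t j) :=
    congrArg (Equiv.prodShear (finRotate (w.length + 1)) (levelPerm w)) h1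
  rw [h1, h2]
  by_cases ht : (t : ℕ) < w.length
  · left
    obtain ⟨c, rfl⟩ : ∃ c : Fin w.length, t = c.castSucc := ⟨⟨t, ht⟩, rfl⟩
    have h3 : levelPerm w c.castSucc j = j := by
      have : levelPerm w c.castSucc = Equiv.swap (w.get c).castSucc (w.get c).succ := by
        simp [levelPerm]
      rw [this]
      refine Equiv.swap_apply_of_ne_of_ne ?_ ?_
      · rintro rfl
        exact hs ⟨(c, true), rfl⟩
      · rintro rfl
        exact hs ⟨(c, false), rfl⟩
    rw [h3, finRotate_apply, Fin.coeSucc_eq_succ]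
    change (m + 1) * (c : ℕ) + (j : ℕ) < _ ∧
      (m + 1) * ((c : ℕ) + 1) + (j : ℕ) = (m + 1) * (c : ℕ) + (j : ℕ) + (m + 1)
    have := Nat.mul_le_mul_right (m + 1) (Nat.succ_le_of_lt c.2)
    exact ⟨by have := j.2; nlinarith, by ring⟩
  · right
    obtain rfl : t = Fin.last w.length := Fin.ext (by have := t.2; simp; omega)
    have h3 : levelPerm w (Fin.last w.length) j = j := by simp [levelPerm]
    rw [h3, finRotate_last]
    change (m + 1) * 0 + (j : ℕ) < _ ∧
      (m + 1) * w.length + (j : ℕ) = (m + 1) * 0 + (j : ℕ) + w.length * (m + 1)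
    exact ⟨by have := j.2; omega, by ring⟩

/-! ### Bit masks for resolutions and sets of edges -/

/-- The number with the bits in `A`. -/
def mask (n : ℕ) (A : ℕ → Prop) : ℕ := by
  classical exact Nat.ofBits fun i : Fin n => decide (A i)

theorem testBit_mask {n : ℕ} {A : ℕ → Prop} (i : ℕ) :
    (mask n A).testBit i = true ↔ i < n ∧ A i := by
  classical
  rw [mask]
  by_cases h : i < n
  · rw [Nat.testBit_ofBits_lt _ _ h]
    simp [h]
  · rw [Nat.testBit_ofBits_ge _ _ (not_lt.1 h)]
    simp [h]

/-- The code of a resolution. -/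
def vertexCode (v : (braidClosure w).Vertex) : ℕ :=
  mask (w.length * (m + 1)) fun i => ∃ c, crossingIndex c = i ∧ v c = true

/-- The code of a set of edges. -/
def edgeCode (A : (braidClosure w).Edge → Prop) : ℕ :=
  mask (w.length * (m + 1) + (m + 1)) fun i => ∃ e, edgeIndex e = i ∧ A e

theorem testBit_vertexCode (v : (braidClosure w).Vertex) (i : ℕ) :
    (vertexCode v).testBit i = true ↔ ∃ c, crossingIndex c = i ∧ v c = true := by
  rw [vertexCode, testBit_mask, and_iff_right_iff_imp]
  rintro ⟨c, rfl, _⟩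
  have := crossingIndex_add_one_lt c
  omega

theorem testBit_vertexCode_crossingIndex (v : (braidClosure w).Vertex)
    (c : Fin (braidClosure w).n) : (vertexCode v).testBit (crossingIndex c) = v c := by
  rw [Bool.eq_iff_iff, testBit_vertexCode]
  refine ⟨?_, fun h => ⟨c, rfl, h⟩⟩
  rintro ⟨c', h, h'⟩
  rwa [← crossingIndex_injective h]

theorem testBit_edgeCode (A : (braidClosure w).Edge → Prop) (i : ℕ) :
    (edgeCode A).testBit i = true ↔ ∃ e, edgeIndex e = i ∧ A e := by
  rw [edgeCode, testBit_mask, and_iff_right_iff_imp]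
  rintro ⟨c, rfl, _⟩
  exact edgeIndex_lt c

theorem testBit_edgeCode_edgeIndex (A : (braidClosure w).Edge → Prop)
    (e : (braidClosure w).Edge) : (edgeCode A).testBit (edgeIndex e) = true ↔ A e := by
  rw [testBit_edgeCode]
  refine ⟨?_, fun h => ⟨e, rfl, h⟩⟩
  rintro ⟨e', h, h'⟩
  rwa [← edgeIndex_injective h]

theorem edgeCode_lt (A : (braidClosure w).Edge → Prop) :
    edgeCode A < 2 ^ (w.length * (m + 1) + (m + 1)) := by
  rw [edgeCode, mask]
  exact Nat.ofBits_lt_two_pow _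

/-- Below the bound every bit position is the index of an edge, so numbers and sets of edges
determine each other. -/
theorem eq_edgeCode_iff {M : ℕ} (hM : M < 2 ^ (w.length * (m + 1) + (m + 1)))
    (A : (braidClosure w).Edge → Prop) :
    M = edgeCode A ↔ ∀ e, M.testBit (edgeIndex e) = true ↔ A e := by
  constructor
  · rintro rfl e
    exact testBit_edgeCode_edgeIndex A e
  · intro h
    refine Nat.eq_of_testBit_eq fun i => ?_
    by_cases hi : i < w.length * (m + 1) + (m + 1)
    · obtain ⟨e, rfl⟩ := exists_edgeIndex hi
      rw [Bool.eq_iff_iff, h, testBit_edgeCode_edgeIndex]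
    · have hi' := Nat.pow_le_pow_right (n := 2) (by omega) (not_lt.1 hi)
      rw [Nat.testBit_lt_two_pow (hM.trans_le hi'),
        Nat.testBit_lt_two_pow ((edgeCode_lt A).trans_le hi')]

theorem edgeCode_inj {A B : (braidClosure w).Edge → Prop} :
    edgeCode A = edgeCode B ↔ ∀ e, A e ↔ B e := by
  rw [eq_edgeCode_iff (edgeCode_lt A)]
  simp only [testBit_edgeCode_edgeIndex]

theorem edgeCode_or (A B : (braidClosure w).Edge → Prop) :
    edgeCode A ||| edgeCode B = edgeCode fun e => A e ∨ B e := by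
  rw [eq_edgeCode_iff (Nat.or_lt_two_pow (edgeCode_lt A) (edgeCode_lt B))]
  intro e
  rw [Nat.testBit_or, Bool.or_eq_true, testBit_edgeCode_edgeIndex, testBit_edgeCode_edgeIndex]

theorem edgeCode_diff (A B : (braidClosure w).Edge → Prop) :
    edgeCode A ^^^ (edgeCode A &&& edgeCode B) = edgeCode fun e => A e ∧ ¬ B e := by
  rw [eq_edgeCode_iff (Nat.xor_lt_two_pow (edgeCode_lt A)
    (Nat.and_lt_two_pow _ (edgeCode_lt B)))]
  intro e
  rw [← testBit_edgeCode_edgeIndex A e, ← testBit_edgeCode_edgeIndex B e, Nat.testBit_xor,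
    Nat.testBit_and]
  generalize (edgeCode A).testBit (edgeIndex e) = a
  generalize (edgeCode B).testBit (edgeIndex e) = b
  revert a b
  decide

theorem vertexCode_injective : Function.Injective (vertexCode (w := w)) := by
  intro v v' h
  funext c
  rw [← testBit_vertexCode_crossingIndex v, h, testBit_vertexCode_crossingIndex]

/-! ### Arcs of a resolution and the search for circles -/

open Code in
theorem link_of_joined {v : (braidClosure w).Vertex} {e f : (braidClosure w).Edge}
    (h : (braidClosure w).Joined v e f) :
    Link (m + 1) (w.length * (m + 1)) (vertexCode v) (edgeIndex e) (edgeIndex f) ∨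
      Link (m + 1) (w.length * (m + 1)) (vertexCode v) (edgeIndex f) (edgeIndex e) := by
  have hbit : ∀ i, (∀ c, crossingIndex c = i → v c = true → False) →
      (vertexCode v).testBit i = false := by
    intro i hi
    rw [← Bool.not_eq_true, testBit_vertexCode]
    rintro ⟨c, h1, h2⟩
    exact hi c h1 h2
  cases h with
  | point s =>
    rcases edgeIndex_point s with ⟨h1, h2⟩ | ⟨h1, h2⟩
    · refine .inl (.inl ⟨(testBit_vertical _ _ _).2 ⟨h1, ?_, ?_⟩, h2⟩)
      · refine hbit _ fun c hc _ => ?_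
        rw [← edgeIndex_overIn] at hc
        simpa [overIn] using edgeIndex_injective hc
      · intro k hk
        refine hbit _ fun c hc _ => ?_
        rw [← hc, ← edgeIndex_underIn] at hk
        simpa [underIn] using edgeIndex_injective hk
    · exact .inr (.inr (.inr ⟨h1, h2⟩))
  | oriented_left c h =>
    have hv : v c = false := by simpa [braidClosure] using h
    rw [edgeIndex_underIn, edgeIndex_overOut]
    refine .inl (.inl ⟨(testBit_vertical _ _ _).2 ⟨crossingIndex_add_one_lt c, ?_, ?_⟩, by ring⟩)
    · exact hbit _ fun c' hc' _ => crossingIndex_ne c c' hc'.symm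
    · intro k hk
      obtain rfl : crossingIndex c = k := by omega
      rw [testBit_vertexCode_crossingIndex, hv]
  | oriented_right c h =>
    have hv : v c = false := by simpa [braidClosure] using h
    rw [edgeIndex_overIn, edgeIndex_underOut]
    refine .inl (.inl ⟨(testBit_vertical _ _ _).2
      ⟨(Nat.lt_succ_self _).trans (crossingIndex_add_one_lt c), ?_, ?_⟩, rfl⟩)
    · rw [testBit_vertexCode_crossingIndex, hv]
    · exact fun k hk => hbit _ fun c' hc' _ => crossingIndex_ne c' c (by omega)
  | unoriented_in c h =>
    rw [edgeIndex_underIn, edgeIndex_overIn]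
    refine .inr (.inr (.inl ⟨(testBit_horizontal _ _ _).2 (.inl ?_), rfl⟩))
    rw [testBit_vertexCode_crossingIndex, h]
    rfl
  | unoriented_out c h =>
    rw [edgeIndex_underOut, edgeIndex_overOut]
    refine .inl (.inr (.inl ⟨(testBit_horizontal _ _ _).2 (.inr ⟨_, rfl, ?_⟩), rfl⟩))
    rw [testBit_vertexCode_crossingIndex, h]
    rfl

open Code in
theorem joined_of_link {v : (braidClosure w).Vertex} {e f : (braidClosure w).Edge}
    (h : Link (m + 1) (w.length * (m + 1)) (vertexCode v) (edgeIndex e) (edgeIndex f)) :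
    (braidClosure w).Joined v e f ∨ (braidClosure w).Joined v f e := by
  have hv : ∀ c, v c = false → v c ≠ (braidClosure w).positive c := by
    intro c hc
    rw [hc]
    exact Bool.false_ne_true
  rcases h with ⟨h1, h2⟩ | ⟨h1, h2⟩ | ⟨h1, h2⟩
  · obtain ⟨h3, h4, h5⟩ := (testBit_vertical _ _ _).1 h1
    obtain ⟨⟨c, b⟩ | s, rfl⟩ := (braidClosure w).inEdge.surjective e
    · cases b
      · change edgeIndex f = edgeIndex ((braidClosure w).underIn c) + _ at h2
        obtain rfl : f = (braidClosure w).overOut c := edgeIndex_injective (by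
          rw [h2, edgeIndex_overOut, edgeIndex_underIn]; ring)
        have := h5 _ (edgeIndex_underIn c)
        rw [testBit_vertexCode_crossingIndex] at this
        exact .inl (.oriented_left c (hv c this))
      · change edgeIndex f = edgeIndex ((braidClosure w).overIn c) + _ at h2
        obtain rfl : f = (braidClosure w).underOut c := edgeIndex_injective (by
          rw [h2, edgeIndex_underOut, edgeIndex_overIn])
        change (vertexCode v).testBit (edgeIndex ((braidClosure w).overIn c)) = false at h4
        rw [edgeIndex_overIn, testBit_vertexCode_crossingIndex] at h4
        exact .inl (.oriented_right c (hv c h4))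
    · rcases edgeIndex_point s with ⟨_, h6⟩ | ⟨_, h6⟩
      · obtain rfl : f = _ := edgeIndex_injective (h2.trans h6.symm)
        exact .inl (.point s)
      · omega
  · rcases (testBit_horizontal _ _ _).1 h1 with h3 | ⟨k, hk, h3⟩
    · obtain ⟨c, hc, hvc⟩ := (testBit_vertexCode _ _).1 h3
      obtain rfl : e = (braidClosure w).overIn c := edgeIndex_injective (by
        rw [← hc, edgeIndex_overIn])
      obtain rfl : f = (braidClosure w).underIn c := edgeIndex_injective (by
        rw [h2, edgeIndex_overIn, edgeIndex_underIn])
      exact .inr (.unoriented_in c hvc)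
    · obtain ⟨c, rfl, hvc⟩ := (testBit_vertexCode _ _).1 h3
      obtain rfl : e = (braidClosure w).underOut c := edgeIndex_injective (by
        rw [hk, edgeIndex_underOut])
      obtain rfl : f = (braidClosure w).overOut c := edgeIndex_injective (by
        rw [h2, edgeIndex_overOut, edgeIndex_underOut])
      exact .inl (.unoriented_out c hvc)
  · obtain ⟨⟨c, b⟩ | s, rfl⟩ := (braidClosure w).inEdge.surjective f
    · exfalso
      have := crossingIndex_add_one_lt c
      cases b
      · change edgeIndex ((braidClosure w).underIn c) = _ at h2
        rw [edgeIndex_underIn] at h2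
        omega
      · change edgeIndex ((braidClosure w).overIn c) = _ at h2
        rw [edgeIndex_overIn] at h2
        omega
    · rcases edgeIndex_point s with ⟨h6, _⟩ | ⟨_, h6⟩
      · omega
      · obtain rfl : e = (braidClosure w).outEdge (.inr s) := edgeIndex_injective (by omega)
        exact .inr (.point s)

open Code in
theorem testBit_flow_edgeIndex {v : (braidClosure w).Vertex} {M : ℕ}
    (hM : M < 2 ^ (w.length * (m + 1) + (m + 1))) (e : (braidClosure w).Edge) :
    (flow (m + 1) (w.length * (m + 1)) (vertical (w.length * (m + 1)) (vertexCode v))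
      (horizontal (m + 1) (vertexCode v)) M).testBit (edgeIndex e) = true ↔
      M.testBit (edgeIndex e) = true ∨ ∃ f, ((braidClosure w).Joined v e f ∨
        (braidClosure w).Joined v f e) ∧ M.testBit (edgeIndex f) = true := by
  rw [testBit_flow hM]
  refine or_congr_right ⟨?_, ?_⟩
  · rintro ⟨j, h1, h2⟩
    have hj : j < w.length * (m + 1) + (m + 1) := by
      by_contra hj
      rw [Nat.testBit_lt_two_pow (hM.trans_le (Nat.pow_le_pow_right (by omega)
        (not_lt.1 hj)))] at h2
      exact absurd h2 (by decide)
    obtain ⟨f, rfl⟩ := exists_edgeIndex hj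
    exact ⟨f, h1.elim joined_of_link fun h => (joined_of_link h).symm, h2⟩
  · rintro ⟨f, h1, h2⟩
    exact ⟨_, h1.elim link_of_joined fun h => (link_of_joined h).symm, h2⟩

open Code Generator

/-- All arcs join indices of edges: vertical arcs start below the last level, and crossings leave
room for the next strand and level. The search never leaves the range of the code. -/
theorem flow_lt (v : (braidClosure w).Vertex) {M : ℕ}
    (hM : M < 2 ^ (w.length * (m + 1) + (m + 1))) :
    flow (m + 1) (w.length * (m + 1)) (vertical (w.length * (m + 1)) (vertexCode v))
      (horizontal (m + 1) (vertexCode v)) M < 2 ^ (w.length * (m + 1) + (m + 1)) := by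
  refine Nat.lt_pow_two_of_testBit _ fun i hi => ?_
  rw [← Bool.not_eq_true, testBit_flow hM]
  have hlt : ∀ j, M.testBit j = true → j < w.length * (m + 1) + (m + 1) := by
    intro j h2
    by_contra hj
    rw [Nat.testBit_lt_two_pow (hM.trans_le (Nat.pow_le_pow_right (by omega)
      (not_lt.1 hj)))] at h2
    exact absurd h2 (by decide)
  rintro (h | ⟨j, (⟨_, h2⟩ | ⟨_, h2⟩ | ⟨h1, h2⟩) | (⟨h1, h2⟩ | ⟨h1, h2⟩ | ⟨h1, h2⟩), h3⟩)
  · have := hlt i h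
    omega
  · have := hlt j h3
    omega
  · have := hlt j h3
    omega
  · have := hlt j h3
    omega
  · have := ((testBit_vertical _ _ _).1 h1).1
    omega
  · rcases (testBit_horizontal _ _ _).1 h1 with h4 | ⟨k, rfl, h4⟩
    all_goals
      obtain ⟨c, hc, _⟩ := (testBit_vertexCode _ _).1 h4
      have := crossingIndex_add_one_lt c
      omega
  · omega

theorem le_flow (S N v u M : ℕ) : M ≤ flow S N v u M := Nat.left_le_or

/-- The mask stays inside the circle of `e` and grows as a number at each step that changes it.
Since it stays below the bound, the fuel cannot run out before a fixed point is reached. -/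
theorem floodAux_spec (v : (braidClosure w).Vertex) (e : (braidClosure w).Edge) (fuel M : ℕ)
    (hM : M < 2 ^ (w.length * (m + 1) + (m + 1)))
    (hfuel : 2 ^ (w.length * (m + 1) + (m + 1)) ≤ fuel + M)
    (he : M.testBit (edgeIndex e) = true)
    (hc : ∀ f, M.testBit (edgeIndex f) = true →
      (braidClosure w).circle v f = (braidClosure w).circle v e) :
    floodAux (m + 1) (w.length * (m + 1)) (vertical (w.length * (m + 1)) (vertexCode v))
      (horizontal (m + 1) (vertexCode v)) fuel M =
      edgeCode fun f => (braidClosure w).circle v f = (braidClosure w).circle v e := by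
  induction fuel generalizing M with
  | zero => omega
  | succ fuel ih =>
    rw [floodAux, force_eq]
    have hflow := testBit_flow_edgeIndex (v := v) hM
    have hlt := flow_lt v hM
    have hle := le_flow (m + 1) (w.length * (m + 1))
      (vertical (w.length * (m + 1)) (vertexCode v)) (horizontal (m + 1) (vertexCode v)) M
    generalize flow (m + 1) (w.length * (m + 1)) (vertical (w.length * (m + 1)) (vertexCode v))
      (horizontal (m + 1) (vertexCode v)) M = M' at hflow hlt hle ⊢
    by_cases h : M' = M
    · rw [(beq_eq_true_iff _ _).2 h, cond_true, eq_edgeCode_iff hM]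
      -- A fixed point is closed under all arcs, so it contains the whole circle of `e`.
      refine fun f => ⟨hc f, fun hf => ?_⟩
      refine (mem_iff_of_circle_eq {g | M.testBit (edgeIndex g) = true} ?_ hf).2 he
      rw [h] at hflow
      intro a b hab
      exact ⟨fun ha => (hflow b).2 (.inr ⟨a, .inr hab, ha⟩),
        fun hb => (hflow a).2 (.inr ⟨b, .inl hab, hb⟩)⟩
    · rw [Bool.eq_false_iff.2 fun h' => h ((beq_eq_true_iff _ _).1 h'), cond_false]
      refine ih M' hlt (by omega) ((hflow e).2 (.inl he)) fun f hf => ?_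
      rcases (hflow f).1 hf with hf | ⟨g, hg | hg, hg'⟩
      · exact hc f hf
      · rw [circle_eq_of_joined hg, hc g hg']
      · rw [← circle_eq_of_joined hg, hc g hg']

theorem flood_eq (v : (braidClosure w).Vertex) (e : (braidClosure w).Edge) :
    flood (m + 1) (w.length * (m + 1)) (vertexCode v) (2 ^ edgeIndex e) =
      edgeCode fun f => (braidClosure w).circle v f = (braidClosure w).circle v e := by
  rw [flood, force_eq, force_eq]
  refine floodAux_spec v e _ _ ?_ (Nat.le_add_right _ _) ?_ ?_
  · exact Nat.pow_lt_pow_right (by omega) (edgeIndex_lt e)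
  · rw [Nat.testBit_two_pow_self]
  · intro f hf
    rw [Nat.testBit_two_pow, decide_eq_true_eq] at hf
    rw [edgeIndex_injective hf]

/-! ### Merging and splitting in terms of codes -/

/-- The code of the labels of a generator. -/
def labelCode (x : (braidClosure w).Generator) : ℕ := edgeCode fun e => x.lab e = 1

theorem bit_labelCode (x : (braidClosure w).Generator) (e : (braidClosure w).Edge) :
    bit (labelCode x) (edgeIndex e) = decide (x.lab e = 1) := by
  rw [bit_eq, Bool.eq_iff_iff, labelCode, testBit_edgeCode_edgeIndex, decide_eq_true_eq]

theorem eq_of_codes_eq {x y : (braidClosure w).Generator}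
    (h : vertexCode x.1 = vertexCode y.1) (h' : labelCode x = labelCode y) : x = y := by
  refine ext_lab (vertexCode_injective h) fun e => ?_
  have := edgeCode_inj.1 h' e
  rcases x.lab_eq_zero_or_one e with h1 | h1 <;> rcases y.lab_eq_zero_or_one e with h2 | h2 <;>
    simp_all

/-- Characterizes the label codes on the side where the strands at `c` lie on one circle: erase the
circles at `c`, then fill them in again if the new label `r` is X. -/
theorem labelCode_eq_rest_iff {x y : (braidClosure w).Generator} {c : Fin (braidClosure w).n}
    (hv : ∀ b, b ≠ c → x.1 b = y.1 b)
    (hy : (braidClosure w).circle y.1 ((braidClosure w).underIn c) =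
      (braidClosure w).circle y.1 ((braidClosure w).underOut c)) (r : Fin 2) :
    labelCode y = edgeCode (fun e => (x.lab e = 1 ∧ ¬ Touches x.1 c e) ∨
        (r = 1 ∧ Touches x.1 c e)) ↔
      (∀ e, ¬ Touches x.1 c e → x.lab e = y.lab e) ∧ y.lab ((braidClosure w).underIn c) = r := by
  have hui : Touches x.1 c ((braidClosure w).underIn c) := .inl rfl
  have h2 : ∀ a b : Fin 2, (a = 1 ↔ b = 1) ↔ a = b := by decide
  rw [labelCode, edgeCode_inj]
  constructor
  · intro h
    refine ⟨fun e he => ?_, ?_⟩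
    · have := h e
      simp only [he, not_false_eq_true, and_true, and_false, or_false, h2] at this
      exact this.symm
    · have := h ((braidClosure w).underIn c)
      simp only [hui, not_true_eq_false, and_true, and_false, false_or, h2] at this
      exact this
  · rintro ⟨h, rfl⟩ e
    by_cases he : Touches x.1 c e
    · have : y.lab e = y.lab ((braidClosure w).underIn c) := by
        rcases (touches_iff_of_agree hv).1 he with he | he
        · exact y.lab_congr he
        · exact y.lab_congr (he.trans hy.symm)
      simp [he, this]
    · simp [he, h e he]

theorem labelCode_eq_circles_iff {x y : (braidClosure w).Generator}
    {c : Fin (braidClosure w).n}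
    (hx : (braidClosure w).circle x.1 ((braidClosure w).underIn c) ≠
      (braidClosure w).circle x.1 ((braidClosure w).underOut c)) (s t : Fin 2) :
    labelCode x = edgeCode (fun e => (y.lab e = 1 ∧ ¬ Touches x.1 c e) ∨
        (s = 1 ∧ (braidClosure w).circle x.1 e =
          (braidClosure w).circle x.1 ((braidClosure w).underIn c)) ∨
        (t = 1 ∧ (braidClosure w).circle x.1 e =
          (braidClosure w).circle x.1 ((braidClosure w).underOut c))) ↔
      (∀ e, ¬ Touches x.1 c e → x.lab e = y.lab e) ∧
        x.lab ((braidClosure w).underIn c) = s ∧ x.lab ((braidClosure w).underOut c) = t := by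
  have h2 : ∀ a b : Fin 2, (a = 1 ↔ b = 1) ↔ a = b := by decide
  rw [labelCode, edgeCode_inj]
  constructor
  · intro h
    refine ⟨fun e he => ?_, ?_, ?_⟩
    · have := h e
      rw [Touches, not_or] at he
      simpa [Touches, he.1, he.2, h2] using this
    · have := h ((braidClosure w).underIn c)
      simpa [Touches, hx, h2] using this
    · have := h ((braidClosure w).underOut c)
      simpa [Touches, hx.symm, h2] using this
  · rintro ⟨h, rfl, rfl⟩ e
    by_cases h1 : (braidClosure w).circle x.1 e =
      (braidClosure w).circle x.1 ((braidClosure w).underIn c)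
    · simp [Touches, h1, hx, x.lab_congr h1]
    · by_cases h3 : (braidClosure w).circle x.1 e =
        (braidClosure w).circle x.1 ((braidClosure w).underOut c)
      · simp [Touches, h3, hx.symm, x.lab_congr h3]
      · simp [Touches, h1, h3, h e (by rw [Touches]; tauto)]

-- Here `x` always has two circles at `c` and `y` has one, whichever comes first in the cube.
-- Multiplication requires that exponents add up; comultiplication differs only by the shift by 1,
-- so one formula covers both directions.
open Classical in
theorem count_toOne (b : Bool) {x y : (braidClosure w).Generator} {c : Fin (braidClosure w).n}
    (hv : ∀ b, b ≠ c → x.1 b = y.1 b)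
    (hy : (braidClosure w).circle y.1 ((braidClosure w).underIn c) =
      (braidClosure w).circle y.1 ((braidClosure w).underOut c)) :
    (((toOne b
      (edgeCode fun e => (braidClosure w).circle x.1 e =
        (braidClosure w).circle x.1 ((braidClosure w).underIn c))
      (edgeCode fun e => (braidClosure w).circle x.1 e =
        (braidClosure w).circle x.1 ((braidClosure w).underOut c)) (labelCode x)
      (decide (x.lab ((braidClosure w).underIn c) = 1))
      (decide (x.lab ((braidClosure w).underOut c) = 1))).count (labelCode y) : ℕ) : ℤ) =
    if ∀ e, ¬ Touches x.1 c e → x.lab e = y.lab e then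
      if (x.lab ((braidClosure w).underIn c) : ℕ) + x.lab ((braidClosure w).underOut c) =
        y.lab ((braidClosure w).underIn c) + (if b then 0 else 1) then 1 else 0 else 0 := by
  have h0 := labelCode_eq_rest_iff hv hy 0
  have h1 := labelCode_eq_rest_iff hv hy 1
  simp only [zero_ne_one, false_and, or_false, true_and] at h0 h1
  rw [toOne, force_eq, force_eq]
  have e2 : Nat.lor (edgeCode fun e => (braidClosure w).circle x.1 e =
        (braidClosure w).circle x.1 ((braidClosure w).underIn c))
      (edgeCode fun e => (braidClosure w).circle x.1 e =
        (braidClosure w).circle x.1 ((braidClosure w).underOut c)) =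
      edgeCode fun e => Touches x.1 c e := edgeCode_or _ _
  have e3 : Nat.xor (labelCode x) (Nat.land (labelCode x) (edgeCode fun e => Touches x.1 c e)) =
      edgeCode fun e => x.lab e = 1 ∧ ¬ Touches x.1 c e := edgeCode_diff _ _
  have e4 : ∀ A B : (braidClosure w).Edge → Prop, Nat.lor (edgeCode A) (edgeCode B) =
      edgeCode fun e => A e ∨ B e := edgeCode_or
  rw [e2, e3]
  simp only [e4]
  rcases x.lab_eq_zero_or_one ((braidClosure w).underIn c) with hs | hs <;>
  rcases x.lab_eq_zero_or_one ((braidClosure w).underOut c) with ht | ht <;>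
  rcases y.lab_eq_zero_or_one ((braidClosure w).underIn c) with hr | hr <;>
  cases b <;>
  simp [hs, ht, hr, List.count_singleton, eq_comm (b := labelCode y), h0, h1]

open Classical in
theorem count_toTwo (b : Bool) {x y : (braidClosure w).Generator} {c : Fin (braidClosure w).n}
    (hx : (braidClosure w).circle x.1 ((braidClosure w).underIn c) ≠
      (braidClosure w).circle x.1 ((braidClosure w).underOut c)) :
    (((toTwo b
      (edgeCode fun e => (braidClosure w).circle x.1 e =
        (braidClosure w).circle x.1 ((braidClosure w).underIn c))
      (edgeCode fun e => (braidClosure w).circle x.1 e =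
        (braidClosure w).circle x.1 ((braidClosure w).underOut c)) (labelCode y)
      (decide (y.lab ((braidClosure w).underIn c) = 1))).count (labelCode x) : ℕ) : ℤ) =
    if ∀ e, ¬ Touches x.1 c e → x.lab e = y.lab e then
      if (x.lab ((braidClosure w).underIn c) : ℕ) + x.lab ((braidClosure w).underOut c) =
        y.lab ((braidClosure w).underIn c) + (if b then 0 else 1) then 1 else 0 else 0 := by
  have h00 := labelCode_eq_circles_iff (y := y) hx 0 0
  have h01 := labelCode_eq_circles_iff (y := y) hx 0 1
  have h10 := labelCode_eq_circles_iff (y := y) hx 1 0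
  have h11 := labelCode_eq_circles_iff (y := y) hx 1 1
  simp only [zero_ne_one, false_and, or_false, false_or, true_and] at h00 h01 h10 h11
  change labelCode x = edgeCode (fun e => _ ∨ Touches x.1 c e) ↔ _ at h11
  rw [toTwo, force_eq, force_eq]
  have e2 : Nat.lor (edgeCode fun e => (braidClosure w).circle x.1 e =
        (braidClosure w).circle x.1 ((braidClosure w).underIn c))
      (edgeCode fun e => (braidClosure w).circle x.1 e =
        (braidClosure w).circle x.1 ((braidClosure w).underOut c)) =
      edgeCode fun e => Touches x.1 c e := edgeCode_or _ _
  have e3 : Nat.xor (labelCode y) (Nat.land (labelCode y) (edgeCode fun e => Touches x.1 c e)) =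
      edgeCode fun e => y.lab e = 1 ∧ ¬ Touches x.1 c e := edgeCode_diff _ _
  have e4 : ∀ A B : (braidClosure w).Edge → Prop, Nat.lor (edgeCode A) (edgeCode B) =
      edgeCode fun e => A e ∨ B e := edgeCode_or
  rw [e2, e3]
  simp only [e4]
  rcases x.lab_eq_zero_or_one ((braidClosure w).underIn c) with hs | hs <;>
  rcases x.lab_eq_zero_or_one ((braidClosure w).underOut c) with ht | ht <;>
  rcases y.lab_eq_zero_or_one ((braidClosure w).underIn c) with hr | hr <;>
  cases b <;>
  simp [hs, ht, hr, List.count_cons, eq_comm (b := labelCode x), h00, h01, h10, h11]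

theorem vertexCode_lor (v : (braidClosure w).Vertex) (c : Fin (braidClosure w).n) :
    Nat.lor (vertexCode v) (Nat.pow 2 (crossingIndex c)) =
      vertexCode (Function.update v c true) := by
  change vertexCode v ||| 2 ^ crossingIndex c = _
  refine Nat.eq_of_testBit_eq fun i => ?_
  rw [Bool.eq_iff_iff, Nat.testBit_or, Bool.or_eq_true, testBit_vertexCode, testBit_vertexCode,
    Nat.testBit_two_pow, decide_eq_true_eq]
  constructor
  · rintro (⟨d, rfl, hd⟩ | rfl)
    · refine ⟨d, rfl, ?_⟩
      rw [Function.update_apply]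
      split_ifs
      exacts [rfl, hd]
    · exact ⟨c, rfl, Function.update_self ..⟩
  · rintro ⟨d, rfl, hd⟩
    by_cases h : d = c
    · exact .inr (by rw [h])
    · rw [Function.update_of_ne h] at hd
      exact .inl ⟨d, rfl, hd⟩

theorem vertexCode_xor {v : (braidClosure w).Vertex} {c : Fin (braidClosure w).n}
    (hc : v c = true) : Nat.xor (vertexCode v) (Nat.pow 2 (crossingIndex c)) =
      vertexCode (Function.update v c false) := by
  change vertexCode v ^^^ 2 ^ crossingIndex c = _
  refine Nat.eq_of_testBit_eq fun i => ?_
  rw [Nat.testBit_xor, Nat.testBit_two_pow]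
  by_cases h : crossingIndex c = i
  · subst h
    rw [testBit_vertexCode_crossingIndex, testBit_vertexCode_crossingIndex, hc,
      Function.update_self]
    simp
  · rw [decide_eq_false h, Bool.xor_false, Bool.eq_iff_iff, testBit_vertexCode,
      testBit_vertexCode]
    refine exists_congr fun d => and_congr_right fun hd => ?_
    rw [Function.update_of_ne]
    rintro rfl
    exact h hd

theorem flood_underIn (v : (braidClosure w).Vertex) (c : Fin (braidClosure w).n) :
    flood (m + 1) (w.length * (m + 1)) (vertexCode v) (Nat.pow 2 (Nat.add (crossingIndex c) 1)) =
      edgeCode fun f => (braidClosure w).circle v f =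
        (braidClosure w).circle v ((braidClosure w).underIn c) := by
  rw [← flood_eq, edgeIndex_underIn]
  rfl

theorem flood_underOut (v : (braidClosure w).Vertex) (c : Fin (braidClosure w).n) :
    flood (m + 1) (w.length * (m + 1)) (vertexCode v)
      (Nat.pow 2 (Nat.add (crossingIndex c) (m + 1))) =
      edgeCode fun f => (braidClosure w).circle v f =
        (braidClosure w).circle v ((braidClosure w).underOut c) := by
  rw [← flood_eq, edgeIndex_underOut]
  rfl

theorem bit_circle (v : (braidClosure w).Vertex) (c : Fin (braidClosure w).n) :
    bit (edgeCode fun f => (braidClosure w).circle v f =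
        (braidClosure w).circle v ((braidClosure w).underIn c))
      (Nat.add (crossingIndex c) (m + 1)) = true ↔
      (braidClosure w).circle v ((braidClosure w).underIn c) =
        (braidClosure w).circle v ((braidClosure w).underOut c) := by
  change bit _ (crossingIndex c + (m + 1)) = true ↔ _
  rw [← edgeIndex_underOut, bit_eq, testBit_edgeCode_edgeIndex, eq_comm]

theorem bit_labelCode_underIn (x : (braidClosure w).Generator) (c : Fin (braidClosure w).n) :
    bit (labelCode x) (Nat.add (crossingIndex c) 1) =
      decide (x.lab ((braidClosure w).underIn c) = 1) := by
  rw [← bit_labelCode, edgeIndex_underIn]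

theorem bit_labelCode_underOut (x : (braidClosure w).Generator) (c : Fin (braidClosure w).n) :
    bit (labelCode x) (Nat.add (crossingIndex c) (m + 1)) =
      decide (x.lab ((braidClosure w).underOut c) = 1) := by
  rw [← bit_labelCode, edgeIndex_underOut]
  rfl

open Classical in
theorem entry_eq_of_ne {x y : (braidClosure w).Generator} {c : Fin (braidClosure w).n}
    (hc : x.1 c = false) (hy : y.1 = Function.update x.1 c true)
    (h : (braidClosure w).circle x.1 ((braidClosure w).underIn c) ≠
      (braidClosure w).circle x.1 ((braidClosure w).underOut c)) :
    entry x y c = if ∀ e, ¬ Touches x.1 c e → x.lab e = y.lab e then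
      if (x.lab ((braidClosure w).underIn c) : ℕ) + x.lab ((braidClosure w).underOut c) =
        y.lab ((braidClosure w).underIn c) + (if true then 0 else 1) then 1 else 0 else 0 := by
  rw [entry, edgeCoeff_of_ne h, mulCoeff]
  refine if_congr ?_ rfl rfl
  rw [adjacent_iff]
  exact ⟨fun h => h.2.2, fun h => ⟨hc, hy, h⟩⟩

open Classical in
theorem entry_eq_of_eq {x y : (braidClosure w).Generator} {c : Fin (braidClosure w).n}
    (hc : x.1 c = false) (hy : y.1 = Function.update x.1 c true)
    (h : (braidClosure w).circle x.1 ((braidClosure w).underIn c) =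
      (braidClosure w).circle x.1 ((braidClosure w).underOut c))
    (h' : (braidClosure w).circle y.1 ((braidClosure w).underIn c) ≠
      (braidClosure w).circle y.1 ((braidClosure w).underOut c)) :
    entry x y c = if ∀ e, ¬ Touches y.1 c e → y.lab e = x.lab e then
      if (y.lab ((braidClosure w).underIn c) : ℕ) + y.lab ((braidClosure w).underOut c) =
        x.lab ((braidClosure w).underIn c) + (if false then 0 else 1) then 1 else 0 else 0 := by
  rw [entry, edgeCoeff_of_eq_of_ne h h', comulCoeff]
  refine if_congr ?_ rfl rfl
  have hv : ∀ b, b ≠ c → x.1 b = y.1 b := fun b hb => by rw [hy, Function.update_of_ne hb]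
  rw [adjacent_iff]
  constructor
  · rintro ⟨_, _, h⟩ e he
    exact (h e (by rwa [touches_iff_of_agree hv])).symm
  · intro h
    exact ⟨hc, hy, fun e he => (h e (by rwa [← touches_iff_of_agree hv])).symm⟩

theorem entry_eq_zero {x y : (braidClosure w).Generator} {c : Fin (braidClosure w).n}
    (h : ¬ (x.1 c = false ∧ y.1 = Function.update x.1 c true)) : entry x y c = 0 :=
  if_neg fun hxy => h ⟨hxy.1, hxy.2.1⟩

/-- The function that computes the differential at a crossing. -/
theorem exists_fwdAt_eq {v : (braidClosure w).Vertex} {c : Fin (braidClosure w).n}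
    (hc : v c = false) : ∃ g : ℕ → List ℕ,
      (∀ a l, fwdAt (m + 1) (w.length * (m + 1)) (vertexCode v)
        (vertexCode (Function.update v c true)) (crossingIndex c) a l = l.bind a g) ∧
      ∀ x y : (braidClosure w).Generator, x.1 = v → y.1 = Function.update v c true →
        ((g (labelCode x)).count (labelCode y) : ℤ) = entry x y c := by
  have hv : ∀ b, b ≠ c → v b = Function.update v c true b :=
    fun b hb => (Function.update_of_ne hb ..).symm
  have hv' : v c ≠ Function.update v c true c := by simp [hc]
  simp only [fwdAt, force_eq, flood_underIn, flood_underOut]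
  by_cases h : (braidClosure w).circle v ((braidClosure w).underIn c) =
    (braidClosure w).circle v ((braidClosure w).underOut c)
  · by_cases h' : (braidClosure w).circle (Function.update v c true)
      ((braidClosure w).underIn c) =
      (braidClosure w).circle (Function.update v c true) ((braidClosure w).underOut c)
    -- One circle before and one after: planarity is not assumed, and the differential is 0 here by
    -- definition.
    · refine ⟨fun _ => [], fun a l => ?_, ?_⟩
      · rw [(bit_circle v c).2 h, (bit_circle _ c).2 h', cond_true, cond_true]
        induction l with
        | nil => rfl
        | cons q l ih => exact ih
      · rintro x y rfl hy
        rw [entry, edgeCoeff_of_eq_of_eq h (by rwa [hy])]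
        simp
    · simp only [(bit_circle v c).2 h, Bool.eq_false_iff.2 (mt (bit_circle _ c).1 h'), cond_true, cond_false]
      refine ⟨_, fun a l => rfl, ?_⟩
      · rintro x y rfl hy
        rw [← hy] at h' ⊢
        rw [bit_labelCode_underIn, count_toTwo false h', entry_eq_of_eq hc hy h h']
  · simp only [Bool.eq_false_iff.2 (mt (bit_circle _ c).1 h), cond_false]
    refine ⟨_, fun a l => rfl, ?_⟩
    · rintro x y rfl hy
      rw [← hy] at hv hv'
      rw [bit_labelCode_underIn, bit_labelCode_underOut,
        count_toOne true hv (circle_eq_of_circle_ne hv hv' h), entry_eq_of_ne hc hy h]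

/-- The function that computes the transposed differential at a crossing. -/
theorem exists_bwdAt_eq {v : (braidClosure w).Vertex} {c : Fin (braidClosure w).n}
    (hc : v c = true) : ∃ g : ℕ → List ℕ,
      (∀ a l, bwdAt (m + 1) (w.length * (m + 1)) (vertexCode v)
        (vertexCode (Function.update v c false)) (crossingIndex c) a l = l.bind a g) ∧
      ∀ x y : (braidClosure w).Generator, y.1 = v → x.1 = Function.update v c false →
        ((g (labelCode y)).count (labelCode x) : ℤ) = entry x y c := by
  have hv : ∀ b, b ≠ c → v b = Function.update v c false b :=
    fun b hb => (Function.update_of_ne hb ..).symm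
  have hv' : v c ≠ Function.update v c false c := by simp [hc]
  have hxy : ∀ x y : (braidClosure w).Generator, y.1 = v → x.1 = Function.update v c false →
      x.1 c = false ∧ y.1 = Function.update x.1 c true := by
    rintro x y rfl hx
    rw [hx, Function.update_self, Function.update_idem, ← hc, Function.update_eq_self]
    exact ⟨rfl, rfl⟩
  simp only [bwdAt, force_eq, flood_underIn, flood_underOut]
  by_cases h : (braidClosure w).circle (Function.update v c false)
      ((braidClosure w).underIn c) =
      (braidClosure w).circle (Function.update v c false) ((braidClosure w).underOut c)
  · by_cases h' : (braidClosure w).circle v ((braidClosure w).underIn c) =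
      (braidClosure w).circle v ((braidClosure w).underOut c)
    · refine ⟨fun _ => [], fun a l => ?_, ?_⟩
      · rw [(bit_circle _ c).2 h, (bit_circle _ c).2 h', cond_true, cond_true]
        induction l with
        | nil => rfl
        | cons q l ih => exact ih
      · rintro x y rfl hx
        rw [entry, edgeCoeff_of_eq_of_eq (by rwa [hx]) h']
        simp
    · simp only [(bit_circle _ c).2 h, Bool.eq_false_iff.2 (mt (bit_circle _ c).1 h'), cond_true, cond_false]
      refine ⟨_, fun a l => rfl, ?_⟩
      · rintro x y rfl hx
        obtain ⟨h1, h2⟩ := hxy x y rfl hx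
        rw [← hx] at h hv
        rw [bit_labelCode_underIn, bit_labelCode_underOut, count_toOne false hv h,
          entry_eq_of_eq h1 h2 h h']
  · simp only [Bool.eq_false_iff.2 (mt (bit_circle _ c).1 h), cond_false]
    refine ⟨_, fun a l => rfl, ?_⟩
    · rintro x y rfl hx
      obtain ⟨h1, h2⟩ := hxy x y rfl hx
      rw [← hx] at h ⊢
      rw [bit_labelCode_underIn, count_toTwo true h, entry_eq_of_ne h1 h2 h]

/-! ### Cochains given by lists -/

/-- The cochain described by a list of codes. -/
def cochain (w : List (Fin m)) (L : Chain) (x : (braidClosure w).Generator) : ℤ :=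
  L.coeff (vertexCode x.1) (labelCode x)

/-- All entries are codes of generators. -/
def Represents (w : List (Fin m)) (L : Chain) : Prop :=
  ∀ q ∈ L, ∃ v : (braidClosure w).Vertex, vertexCode v = q.1 ∧
    ∀ r ∈ q.2, ∃ x : (braidClosure w).Generator, x.1 = v ∧ labelCode x = r.1

theorem cochain_append (L L' : Chain) : cochain w (L ++ L') = cochain w L + cochain w L' := by
  funext x
  exact Chain.coeff_append ..

theorem cochain_eq_zero {L : Chain} (h : L.dvd 0 = true) : cochain w L = 0 := by
  funext x
  exact zero_dvd_iff.1 (Chain.dvd_coeff h _ _)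

/-- Codes determine generators, so each term of a valid list represents one generator and the
pairing can be evaluated term by term, even if generators repeat. -/
theorem sum_mul_terms {v : (braidClosure w).Vertex} {l : Terms}
    (hl : ∀ r ∈ l, ∃ x : (braidClosure w).Generator, x.1 = v ∧ labelCode x = r.1)
    {F : (braidClosure w).Generator → ℤ} {G : ℕ → ℤ}
    (hG : ∀ x : (braidClosure w).Generator, x.1 = v → G (labelCode x) = F x) :
    ∑ x, F x * (if vertexCode v = vertexCode x.1 then l.coeff (labelCode x) else 0) =
      (l.map fun r => r.2 * G r.1).sum := by
  classical
  induction l with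
  | nil => simp [Terms.coeff]
  | cons r l ih =>
    obtain ⟨z, hz, hr⟩ := hl r (List.mem_cons_self ..)
    have h1 : ∀ x : (braidClosure w).Generator,
        F x * (if vertexCode v = vertexCode x.1 then Terms.coeff (labelCode x) (r :: l) else 0) =
        (if x = z then F x * r.2 else 0) +
          F x * (if vertexCode v = vertexCode x.1 then Terms.coeff (labelCode x) l else 0) := by
      intro x
      rw [Terms.coeff, ← hr]
      by_cases hxz : x = z
      · subst hxz
        rw [if_pos (by rw [hz]), if_pos rfl, if_pos rfl, if_pos (by rw [hz])]
        ring
      · rw [if_neg hxz, zero_add]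
        split_ifs with h2 h3
        · rw [← hz] at h2
          exact absurd (eq_of_codes_eq h2 h3).symm hxz
        · rw [zero_add]
        · rfl
    simp only [h1]
    rw [Finset.sum_add_distrib, ih fun r hr => hl r (List.mem_cons_of_mem _ hr), List.map_cons,
      List.sum_cons, ← hr, hG z hz, Finset.sum_ite_eq' Finset.univ z fun x => F x * r.2]
    simp [mul_comm]

theorem sum_map_mul_sum {ι : Type} [Fintype ι] (A : ι → Prop) [DecidablePred A] (s : ι → ℤ)
    (F : ι → ℕ → ℤ) (l : Terms) :
    (l.map fun r => r.2 * ∑ c, s c * if A c then F c r.1 else 0).sum =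
      ∑ c, s c * if A c then (l.map fun r => r.2 * F c r.1).sum else 0 := by
  induction l with
  | nil => simp
  | cons r l ih =>
    simp only [List.map_cons, List.sum_cons]
    rw [ih, Finset.mul_sum, ← Finset.sum_add_distrib]
    refine Finset.sum_congr rfl fun c _ => ?_
    split_ifs <;> ring

/-- The sum of the values of `T` with signs that change after each `c` with `v c = true`. -/
def alternatingSum {ι : Type} (v : ι → Bool) (T : ι → ℤ) : List ι → ℤ → ℤ
  | [], _ => 0
  | c :: cs, a => a * T c + alternatingSum v T cs (if v c then -a else a)

theorem alternatingSum_map {ι κ : Type} (f : κ → ι) (v : ι → Bool) (T : ι → ℤ) (cs : List κ)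
    (a : ℤ) : alternatingSum v T (cs.map f) a = alternatingSum (v ∘ f) (T ∘ f) cs a := by
  induction cs generalizing a with
  | nil => rfl
  | cons c cs ih =>
    rw [List.map_cons, alternatingSum, alternatingSum, ih]
    rfl

/-- The running sign used in the computation is the sign of the cube; the first crossing contributes
a factor −1 to all later ones exactly when it is 1-smoothed. -/
theorem alternatingSum_finRange {n : ℕ} (v : Fin n → Bool) (T : Fin n → ℤ) (a : ℤ) :
    alternatingSum v T (List.finRange n) a =
      a * ∑ c, (-1) ^ (Finset.univ.filter fun b => b < c ∧ v b = true).card * T c := by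
  induction n generalizing a with
  | zero => simp [alternatingSum]
  | succ n ih =>
    rw [List.finRange_succ, alternatingSum, alternatingSum_map, ih, Fin.sum_univ_succ, mul_add]
    congr 1
    · simp
    · simp only [Fin.card_filter_univ_succ, Fin.succ_pos, true_and, Function.comp_apply,
        Fin.succ_lt_succ_iff]
      cases v 0
      · simp
      · simp only [if_true, pow_add, Finset.mul_sum]
        exact Finset.sum_congr rfl fun _ _ => by ring

theorem cochain_nil : cochain w [] = 0 := rfl

theorem cochain_cons (q : ℕ × Terms) (L : Chain) :
    cochain w (q :: L) = cochain w [q] + cochain w L := cochain_append [q] L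

theorem cochain_singleton (h : ℕ) (l : Terms) (x : (braidClosure w).Generator) :
    cochain w [(h, l)] x = if h = vertexCode x.1 then l.coeff (labelCode x) else 0 :=
  add_zero _

theorem coeff_fwdAux {v : (braidClosure w).Vertex} {T : Fin (braidClosure w).n → ℤ} {l : Terms}
    {k j : ℕ} (hT : ∀ c, v c = true → T c = 0)
    (hT' : ∀ c, v c = false → ∀ a, Chain.coeff k j [(vertexCode (Function.update v c true),
      fwdAt (m + 1) (w.length * (m + 1)) (vertexCode v) (vertexCode (Function.update v c true))
        (crossingIndex c) a l)] = a * T c) (cs : List (Fin (braidClosure w).n)) (a : ℤ) :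
    Chain.coeff k j (fwdAux (m + 1) (w.length * (m + 1)) (vertexCode v) l
      (cs.map crossingIndex) a) = alternatingSum v T cs a := by
  induction cs generalizing a with
  | nil => rfl
  | cons c cs ih =>
    rw [List.map_cons, fwdAux, bit_eq, testBit_vertexCode_crossingIndex, alternatingSum]
    cases hc : v c with
    | true => rw [cond_true, ih, hT c hc, mul_zero, zero_add, if_pos rfl]
    | false =>
      rw [cond_false, force_eq, vertexCode_lor, if_neg Bool.false_ne_true, ← ih, ← hT' c hc]
      exact Chain.coeff_append k j [_] _

theorem coeff_bwdAux {v : (braidClosure w).Vertex} {T : Fin (braidClosure w).n → ℤ} {l : Terms}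
    {k j : ℕ} (hT : ∀ c, v c = false → T c = 0)
    (hT' : ∀ c, v c = true → ∀ a, Chain.coeff k j [(vertexCode (Function.update v c false),
      bwdAt (m + 1) (w.length * (m + 1)) (vertexCode v) (vertexCode (Function.update v c false))
        (crossingIndex c) a l)] = a * T c) (cs : List (Fin (braidClosure w).n)) (a : ℤ) :
    Chain.coeff k j (bwdAux (m + 1) (w.length * (m + 1)) (vertexCode v) l
      (cs.map crossingIndex) a) = alternatingSum v T cs a := by
  induction cs generalizing a with
  | nil => rfl
  | cons c cs ih =>
    rw [List.map_cons, bwdAux, bit_eq, testBit_vertexCode_crossingIndex, alternatingSum]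
    cases hc : v c with
    | false => rw [cond_false, ih, hT c hc, mul_zero, zero_add, if_neg Bool.false_ne_true]
    | true =>
      rw [cond_true, force_eq, vertexCode_xor hc, if_pos rfl, ← ih, ← hT' c hc]
      exact Chain.coeff_append k j [_] _

theorem diff_cochain_singleton {v : (braidClosure w).Vertex} {l : Terms}
    (hl : ∀ r ∈ l, ∃ x : (braidClosure w).Generator, x.1 = v ∧ labelCode x = r.1) :
    diff (cochain w [(vertexCode v, l)]) = cochain w (fwdAux (m + 1) (w.length * (m + 1))
      (vertexCode v) l ((List.finRange (braidClosure w).n).map crossingIndex) 1) := by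
  classical
  funext y
  choose! g hg hg' using fun c (hc : v c = false) => exists_fwdAt_eq hc
  have hT : ∀ c, v c = false → ∀ a, Chain.coeff (vertexCode y.1) (labelCode y)
      [(vertexCode (Function.update v c true),
        fwdAt (m + 1) (w.length * (m + 1)) (vertexCode v) (vertexCode (Function.update v c true))
        (crossingIndex c) a l)] = a * if v c = false ∧ y.1 = Function.update v c true then
          (l.map fun r => r.2 * ((g c r.1).count (labelCode y) : ℤ)).sum else 0 := by
    intro c hc a
    rw [hg c hc, Chain.coeff, Chain.coeff, add_zero, Terms.coeff_bind]
    by_cases hy : y.1 = Function.update v c true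
    · rw [if_pos (by rw [hy]), if_pos ⟨hc, hy⟩, ← List.sum_map_mul_left]
      simp only [mul_assoc]
    · rw [if_neg (fun h => hy (vertexCode_injective h).symm), if_neg (fun h => hy h.2), mul_zero]
  rw [cochain, coeff_fwdAux (fun c hc => if_neg fun h => by simp [hc] at h) hT,
    alternatingSum_finRange, one_mul]
  simp only [diff, cochain_singleton]
  rw [sum_mul_terms hl (G := fun k => ∑ c, (-1) ^ before v c *
    if v c = false ∧ y.1 = Function.update v c true then ((g c k).count (labelCode y) : ℤ) else 0)]
  · exact sum_map_mul_sum (fun c => v c = false ∧ y.1 = Function.update v c true)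
      (fun c => (-1) ^ before v c) (fun c k => ((g c k).count (labelCode y) : ℤ)) l
  · rintro x rfl
    rw [incidence_eq]
    refine Finset.sum_congr rfl fun c _ => ?_
    congr 1
    split_ifs with h
    · exact hg' c h.1 x y rfl h.2
    · exact (entry_eq_zero h).symm

theorem codiff_cochain_singleton {v : (braidClosure w).Vertex} {l : Terms}
    (hl : ∀ r ∈ l, ∃ x : (braidClosure w).Generator, x.1 = v ∧ labelCode x = r.1) :
    codiff (cochain w [(vertexCode v, l)]) = cochain w (bwdAux (m + 1) (w.length * (m + 1))
      (vertexCode v) l ((List.finRange (braidClosure w).n).map crossingIndex) 1) := by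
  classical
  funext x
  choose! g hg hg' using fun c (hc : v c = true) => exists_bwdAt_eq hc
  have hT : ∀ c, v c = true → ∀ a, Chain.coeff (vertexCode x.1) (labelCode x)
      [(vertexCode (Function.update v c false),
        bwdAt (m + 1) (w.length * (m + 1)) (vertexCode v) (vertexCode (Function.update v c false))
        (crossingIndex c) a l)] = a * if v c = true ∧ x.1 = Function.update v c false then
          (l.map fun r => r.2 * ((g c r.1).count (labelCode x) : ℤ)).sum else 0 := by
    intro c hc a
    rw [hg c hc, Chain.coeff, Chain.coeff, add_zero, Terms.coeff_bind]
    by_cases hx : x.1 = Function.update v c false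
    · rw [if_pos (by rw [hx]), if_pos ⟨hc, hx⟩, ← List.sum_map_mul_left]
      simp only [mul_assoc]
    · rw [if_neg (fun h => hx (vertexCode_injective h).symm), if_neg (fun h => hx h.2), mul_zero]
  rw [cochain, coeff_bwdAux (fun c hc => if_neg fun h => by simp [hc] at h) hT,
    alternatingSum_finRange, one_mul]
  simp only [codiff, cochain_singleton]
  rw [sum_mul_terms hl (G := fun k => ∑ c, (-1) ^ before v c *
    if v c = true ∧ x.1 = Function.update v c false then ((g c k).count (labelCode x) : ℤ) else 0)]
  · exact sum_map_mul_sum (fun c => v c = true ∧ x.1 = Function.update v c false)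
      (fun c => (-1) ^ before v c) (fun c k => ((g c k).count (labelCode x) : ℤ)) l
  · rintro y rfl
    rw [incidence_eq]
    refine Finset.sum_congr rfl fun c _ => ?_
    split_ifs with h
    -- The sign depends only on crossings before `c`, where the two ends of the edge of the cube
    -- agree; so it may be read off at the target.
    · have hb : before x.1 c = before y.1 c := by
        refine congrArg Finset.card (Finset.filter_congr fun b _ => and_congr_right fun hb => ?_)
        rw [h.2, Function.update_of_ne hb.ne]
      rw [hb, ← hg' c h.1 x y rfl h.2]
    · rw [entry_eq_zero, mul_zero, mul_zero]
      rintro ⟨h1, h2⟩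
      refine h ⟨by rw [h2, Function.update_self], ?_⟩
      rw [h2, Function.update_idem, ← h1, Function.update_eq_self]

theorem diff_cochain {L : Chain} (hL : Represents w L) :
    diff (cochain w L) = cochain w (fwd (m + 1) (w.length * (m + 1))
      ((List.finRange (braidClosure w).n).map crossingIndex) L) := by
  induction L with
  | nil =>
    funext y
    simp [cochain_nil, diff, fwd]
  | cons q L ih =>
    obtain ⟨v, hv, hl⟩ := hL q (List.mem_cons_self ..)
    obtain ⟨h, l⟩ := q
    obtain rfl : vertexCode v = h := hv
    rw [cochain_cons, diff_add, ih fun q hq => hL q (List.mem_cons_of_mem _ hq), fwd,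
      cochain_append, diff_cochain_singleton hl]

theorem codiff_add {D : LinkDiagram} (f g : D.Generator → ℤ) :
    codiff (f + g) = codiff f + codiff g := by
  funext y
  simp [codiff, mul_add, Finset.sum_add_distrib]

theorem codiff_cochain {L : Chain} (hL : Represents w L) :
    codiff (cochain w L) = cochain w (bwd (m + 1) (w.length * (m + 1))
      ((List.finRange (braidClosure w).n).map crossingIndex) L) := by
  induction L with
  | nil =>
    funext y
    simp [cochain_nil, codiff, bwd]
  | cons q L ih =>
    obtain ⟨v, hv, hl⟩ := hL q (List.mem_cons_self ..)
    obtain ⟨h, l⟩ := q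
    obtain rfl : vertexCode v = h := hv
    rw [cochain_cons, codiff_add, ih fun q hq => hL q (List.mem_cons_of_mem _ hq), bwd,
      cochain_append, codiff_cochain_singleton hl]

/-- Terms with label X at `e` are dropped because X² = 0. On the others, filling in the circle is a
bijection onto the labellings with label X. -/
theorem coeff_addCircle (e : (braidClosure w).Edge) (a : ℤ) {x : (braidClosure w).Generator}
    {l : Terms}
    (hl : ∀ r ∈ l, ∃ y : (braidClosure w).Generator, y.1 = x.1 ∧ labelCode y = r.1) :
    (l.addCircle (edgeCode fun f => (braidClosure w).circle x.1 f = (braidClosure w).circle x.1 e)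
      (edgeIndex e) a).coeff (labelCode x) =
      if x.lab e = 1 then a * l.coeff (labelCode (x.relabel e 0)) else 0 := by
  classical
  induction l with
  | nil => simp [Terms.addCircle, Terms.coeff]
  | cons r l ih =>
    obtain ⟨k, c⟩ := r
    obtain ⟨y, hy, hk⟩ := hl _ (List.mem_cons_self ..)
    obtain rfl : labelCode y = k := hk
    have ih := ih fun r hr => hl r (List.mem_cons_of_mem _ hr)
    rw [Terms.addCircle, bit_labelCode, Terms.coeff]
    have hinj : labelCode y = labelCode (x.relabel e 0) ↔ y = x.relabel e 0 :=
      ⟨fun h => eq_of_codes_eq (by rw [hy, relabel_fst]) h, fun h => by rw [h]⟩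
    rcases y.lab_eq_zero_or_one e with h | h
    · have hor : Nat.lor (labelCode y) (edgeCode fun f =>
          (braidClosure w).circle x.1 f = (braidClosure w).circle x.1 e) =
          labelCode (y.relabel e 1) := by
        refine (edgeCode_or _ _).trans (edgeCode_inj.2 fun f => ?_)
        rw [lab_relabel, hy]
        by_cases hf : (braidClosure w).circle x.1 f = (braidClosure w).circle x.1 e
        · rw [if_pos hf]
          exact iff_of_true (.inr hf) rfl
        · rw [if_neg hf, or_iff_left hf]
      have hinj' : labelCode (y.relabel e 1) = labelCode x ↔ y.relabel e 1 = x :=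
        ⟨fun h => eq_of_codes_eq (by rw [relabel_fst, hy]) h, fun h => by rw [h]⟩
      rw [h, decide_eq_false (by decide), cond_false, Terms.coeff, ih, hor]
      by_cases hx : x.lab e = 1
      · have : y.relabel e 1 = x ↔ y = x.relabel e 0 := by
          constructor
          · rintro rfl
            rw [relabel_relabel, y.relabel_eq_self h]
          · rintro rfl
            rw [relabel_relabel, x.relabel_eq_self hx]
        simp only [hinj, hinj', this, if_pos hx]
        split_ifs <;> ring
      · rw [if_neg hx, if_neg hx, add_zero]
        refine if_neg fun h' => hx ?_
        rw [← hinj'.1 h', lab_relabel_self]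
    · have hne : ¬ labelCode y = labelCode (x.relabel e 0) := by
        intro h'
        rw [hinj.1 h', lab_relabel_self] at h
        exact absurd h (by decide)
      rw [h, decide_eq_true rfl, cond_true, ih, if_neg hne, zero_add]

theorem cochain_timesX (e : (braidClosure w).Edge) (a : ℤ) {L : Chain} (hL : Represents w L) :
    cochain w (timesX (m + 1) (w.length * (m + 1)) (edgeIndex e) a L) =
      a • mulX e (cochain w L) := by
  induction L with
  | nil =>
    funext x
    simp [cochain_nil, timesX, mulX]
  | cons q L ih =>
    obtain ⟨v, hv, hl⟩ := hL q (List.mem_cons_self ..)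
    obtain ⟨h, l⟩ := q
    obtain rfl : vertexCode v = h := hv
    rw [timesX, cochain_cons, ih fun q hq => hL q (List.mem_cons_of_mem _ hq),
      cochain_cons (vertexCode v, l)]
    funext x
    have h1 : cochain w [(vertexCode v, force (flood (m + 1) (w.length * (m + 1)) (vertexCode v)
        (Nat.pow 2 (edgeIndex e))) fun P => Terms.addCircle P (edgeIndex e) a l)] x =
        a * mulX e (cochain w [(vertexCode v, l)]) x := by
      rw [force_eq, cochain_singleton]
      by_cases hx : vertexCode v = vertexCode x.1
      · obtain rfl := vertexCode_injective hx
        rw [if_pos rfl]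
        refine Eq.trans ?_ ((coeff_addCircle e a hl).trans ?_)
        · rw [← flood_eq]
          rfl
        · rw [mulX, cochain_singleton]
          split_ifs <;> simp_all
      · rw [if_neg hx, mulX, cochain_singleton]
        simp [hx]
    rw [Pi.add_apply, h1, Pi.smul_apply, Pi.smul_apply, mulX, mulX, mulX]
    split_ifs
    · simp [mul_add]
    · simp

theorem cochain_withBit (e : (braidClosure w).Edge) (L : Chain)
    (x : (braidClosure w).Generator) :
    cochain w (L.withBit (edgeIndex e)) x = if x.lab e = 1 then cochain w L x else 0 := by
  have hl : ∀ l : Terms, (l.withBit (edgeIndex e)).coeff (labelCode x) =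
      if x.lab e = 1 then l.coeff (labelCode x) else 0 := by
    intro l
    induction l with
    | nil => simp [Terms.withBit, Terms.coeff]
    | cons r l ih =>
      obtain ⟨k, c⟩ := r
      rw [Terms.withBit, Terms.coeff]
      by_cases hk : k = labelCode x
      · subst hk
        rw [bit_labelCode]
        by_cases hx : x.lab e = 1
        · rw [decide_eq_true hx, cond_true, Terms.coeff, ih, if_pos hx, if_pos hx]
        · rw [decide_eq_false hx, cond_false, ih, if_neg hx, if_neg hx]
      · cases bit k (edgeIndex e)
        · rw [cond_false, ih, if_neg hk, zero_add]
        · rw [cond_true, Terms.coeff, ih, if_neg hk, zero_add, zero_add]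
  induction L with
  | nil => simp [Chain.withBit, cochain_nil]
  | cons q L ih =>
    obtain ⟨h, l⟩ := q
    rw [Chain.withBit, cochain_cons, cochain_cons (h, l), Pi.add_apply, Pi.add_apply, ih,
      cochain_singleton, cochain_singleton, hl]
    split_ifs <;> simp

theorem testBit_foldr_lor (ps : List ℕ) (i : ℕ) :
    (ps.foldr (fun p s => Nat.lor (Nat.pow 2 p) s) 0).testBit i = true ↔ i ∈ ps := by
  induction ps with
  | nil => simp
  | cons p ps ih =>
    change (2 ^ p ||| ps.foldr (fun p s => Nat.lor (Nat.pow 2 p) s) 0).testBit i = true ↔ _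
    rw [Nat.testBit_or, Bool.or_eq_true, ih, Nat.testBit_two_pow, decide_eq_true_eq,
      List.mem_cons, eq_comm]

theorem represents_of_valid {L : Chain} (h : L.valid (m + 1) (w.length * (m + 1))
    ((List.finRange (braidClosure w).n).map crossingIndex) = true) : Represents w L := by
  intro q hq
  obtain ⟨h1, h2⟩ := Bool.and_eq_true_iff.1 (List.all_eq_true.1 h q hq)
  have h1 : q.1 &&& _ = q.1 := (beq_eq_true_iff _ _).1 h1
  have hv : vertexCode (w := w) (fun c => q.1.testBit (crossingIndex c)) = q.1 := by
    refine Nat.eq_of_testBit_eq fun i => ?_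
    rw [Bool.eq_iff_iff, testBit_vertexCode]
    constructor
    · rintro ⟨c, rfl, hc⟩
      exact hc
    · intro hi
      have hi' := hi
      rw [← h1, Nat.testBit_and, Bool.and_eq_true, testBit_foldr_lor] at hi'
      obtain ⟨c, _, rfl⟩ := List.mem_map.1 hi'.2
      exact ⟨c, rfl, hi⟩
  refine ⟨_, hv, fun r hr => ?_⟩
  obtain ⟨h3, h4⟩ := Bool.and_eq_true_iff.1 (List.all_eq_true.1 h2 r hr)
  have h3 : r.1 < 2 ^ (w.length * (m + 1) + (m + 1)) := Nat.le_of_ble_eq_true h3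
  have h4 := (beq_eq_true_iff _ _).1 h4
  rw [← hv] at h4
  -- A mask fixed by one step of the search is a union of circles, hence a labelling of the circles.
  have h5 := testBit_flow_edgeIndex (v := fun c => q.1.testBit (crossingIndex c)) h3
  rw [h4] at h5
  refine ⟨ofLab _ (fun e => if r.1.testBit (edgeIndex e) then 1 else 0) fun a b hab => ?_, rfl, ?_⟩
  · have : r.1.testBit (edgeIndex a) = r.1.testBit (edgeIndex b) := by
      rw [Bool.eq_iff_iff]
      exact ⟨fun ha => (h5 b).2 (.inr ⟨a, .inr hab, ha⟩),
        fun hb => (h5 a).2 (.inr ⟨b, .inl hab, hb⟩)⟩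
    simp only [this]
  · refine ((eq_edgeCode_iff h3 _).2 fun e => ?_).symm
    change _ ↔ (if r.1.testBit (edgeIndex e) then (1 : Fin 2) else 0) = 1
    cases r.1.testBit (edgeIndex e) <;> simp

theorem weight_eq (x : (braidClosure w).Generator) :
    ((List.finRange (braidClosure w).n).map crossingIndex).countP (bit (vertexCode x.1)) =
      x.weight := by
  rw [List.countP_map, weight, List.countP_eq_length_filter]
  have : bit (vertexCode x.1) ∘ crossingIndex = x.1 := by
    funext c
    rw [Function.comp_apply, bit_eq, testBit_vertexCode_crossingIndex]
  rw [this]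
  change _ = ((List.finRange _).filter fun c => decide (x.1 c = true)).length
  simp

theorem neg_one_pow_weight_mul_cochain {L : Chain} {r : ℕ}
    (h : Chain.hasParity ((List.finRange (braidClosure w).n).map crossingIndex) r L = true)
    (x : (braidClosure w).Generator) :
    (-1) ^ x.weight * cochain w L x = (-1) ^ r * cochain w L x := by
  induction L with
  | nil => simp [cochain_nil]
  | cons q L ih =>
    obtain ⟨k, l⟩ := q
    obtain ⟨h1, h2⟩ := Bool.and_eq_true_iff.1 h
    rw [cochain_cons, Pi.add_apply, mul_add, mul_add, ih h2, cochain_singleton]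
    split_ifs with hk
    · have h1 := (beq_eq_true_iff _ _).1 h1
      simp only [hk, weight_eq] at h1
      have h1 : x.weight % 2 = r := h1
      rw [← h1, ← neg_one_pow_eq_pow_mod_two]
    · simp

theorem sum_cochain_mul {h : ℕ} {l : Terms} (hl : Represents w [(h, l)]) (B : Chain) :
    ∑ x, cochain w [(h, l)] x * cochain w B x = (l.map fun r => r.2 * B.coeff h r.1).sum := by
  obtain ⟨v, hv, hl⟩ := hl _ (List.mem_singleton_self _)
  obtain rfl : vertexCode v = h := hv
  refine Eq.trans ?_ (sum_mul_terms (F := cochain w B)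
    (G := fun k => B.coeff (vertexCode v) k) hl ?_)
  · refine Finset.sum_congr rfl fun x _ => ?_
    rw [cochain_singleton, mul_comm]
  · rintro x rfl
    rfl

/-- Equality of cochains is tested by appending the negative and checking that all collected
coefficients are divisible by 0. -/
theorem cochain_eq_of_dvd {L L' : Chain} {f : (braidClosure w).Generator → ℤ}
    (hL' : cochain w L' = (-1 : ℤ) • f) (h : (L ++ L').dvd 0 = true) : cochain w L = f := by
  have := cochain_eq_zero (w := w) h
  rw [cochain_append, hL', neg_one_smul, ← sub_eq_add_neg] at this
  exact sub_eq_zero.1 this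

theorem eq_zero_of_withBit {L : Chain} {e : (braidClosure w).Edge}
    (h : (L.withBit (edgeIndex e)).dvd 0 = true) (x : (braidClosure w).Generator)
    (hx : x.lab e = 1) : cochain w L x = 0 := by
  have := congrFun (cochain_eq_zero (w := w) h) x
  rwa [cochain_withBit, if_pos hx] at this

/-- The X-labelled part of the first functional is compared with `t` times X applied to the second,
which has the required values on generators with label X. -/
theorem eq_of_withBit {L L' : Chain} {e : (braidClosure w).Edge} {t : ℤ} (hL' : Represents w L')
    (h : (L.withBit (edgeIndex e) ++
      timesX (m + 1) (w.length * (m + 1)) (edgeIndex e) (-t) L').dvd 0 = true)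
    (x : (braidClosure w).Generator) (hx : x.lab e = 1) :
    cochain w L x = t * cochain w L' (x.relabel e 0) := by
  have := congrFun (cochain_eq_of_dvd (f := t • mulX e (cochain w L'))
    (by rw [cochain_timesX e _ hL', smul_smul, neg_one_mul]) h) x
  rwa [cochain_withBit, if_pos hx, Pi.smul_apply, mulX_of_one _ hx] at this

/-! ### Certificates as finite checks -/

/-- The criterion `IsScalingClass` in terms of codes. -/
theorem isScalingClass_cochain {S N i j : ℕ} {ps : List ℕ} (hS : S = m + 1)
    (hN : N = w.length * (m + 1)) (hps : ps = (List.finRange (braidClosure w).n).map crossingIndex)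
    {a p : (braidClosure w).Edge} (hi : i = edgeIndex a) (hj : j = edgeIndex p) (t : ℤ)
    {k : ℕ} {l : Terms} {ζ η β : Chain} (hζ : ζ.valid S N ps = true) (hη : η.valid S N ps = true)
    (hα : Chain.valid S N ps [(k, l)] = true) (hβ : β.valid S N ps = true)
    (h1 : (fwd S N ps ζ).dvd 0 = true)
    (h2 : (fwd S N ps η ++ (timesX S N i (-t) ζ ++ timesX S N j 1 ζ)).dvd 0 = true)
    (h3 : ζ.hasParity ps 1 = true) (h4 : (bwd S N ps [(k, l)]).dvd 0 = true)
    (h5 : (bwd S N ps β).dvd 0 = true) (h6 : (Chain.withBit i [(k, l)]).dvd 0 = true)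
    (h7 : (β.withBit i ++ timesX S N i (-1) [(k, l)]).dvd 0 = true)
    (h8 : (Chain.withBit j [(k, l)]).dvd 0 = true)
    (h9 : (β.withBit j ++ timesX S N j (-t) [(k, l)]).dvd 0 = true)
    (h10 : (l.map fun r => r.2 * ζ.coeff k r.1).sum = 1) :
    IsScalingClass (braidClosure w) a p t (cochain w ζ) (cochain w η) (cochain w [(k, l)])
      (cochain w β) := by
  subst hS hN hps hi hj
  have hζ := represents_of_valid hζ
  have hη := represents_of_valid hη
  have hα := represents_of_valid hα
  have hβ := represents_of_valid hβ
  constructor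
  · rw [diff_cochain hζ, cochain_eq_zero h1]
  · rw [diff_cochain hη]
    refine cochain_eq_of_dvd ?_ h2
    rw [cochain_append, cochain_timesX a _ hζ, cochain_timesX p _ hζ]
    module
  · intro x
    rw [neg_one_pow_weight_mul_cochain h3, pow_one, neg_one_mul]
  · rw [codiff_cochain hα, cochain_eq_zero h4]
  · rw [codiff_cochain hβ, cochain_eq_zero h5]
  · exact eq_zero_of_withBit h6
  · exact fun x hx => (eq_of_withBit hα h7 x hx).trans (one_mul _)
  · exact eq_zero_of_withBit h8
  · exact eq_of_withBit hα h9
  · rw [sum_cochain_mul hα, h10]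

/-- The criterion `IsTopRelation` in terms of codes. -/
theorem isTopRelation_cochain {S N i : ℕ} {ps : List ℕ} (hS : S = m + 1)
    (hN : N = w.length * (m + 1)) (hps : ps = (List.finRange (braidClosure w).n).map crossingIndex)
    {e : (braidClosure w).Edge} (hi : i = edgeIndex e) (t : ℤ)
    {k : ℕ} {l : Terms} {y u β : Chain} (hy : y.valid S N ps = true) (hu : u.valid S N ps = true)
    (hα : Chain.valid S N ps [(k, l)] = true) (hβ : β.valid S N ps = true)
    (h1 : (fwd S N ps y).dvd 0 = true)
    (h2 : (fwd S N ps u ++ timesX S N i (-t) y).dvd 0 = true)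
    (h3 : (bwd S N ps [(k, l)]).dvd 0 = true)
    (h4 : (bwd S N ps β).dvd t = true) (h5 : (Chain.withBit i [(k, l)]).dvd 0 = true)
    (h6 : (β.withBit i ++ timesX S N i (-1) [(k, l)]).dvd 0 = true)
    (h7 : (l.map fun r => r.2 * y.coeff k r.1).sum = 1) :
    IsTopRelation (braidClosure w) e t (cochain w y) (cochain w u) (cochain w [(k, l)])
      (cochain w β) := by
  subst hS hN hps hi
  have hy := represents_of_valid hy
  have hu := represents_of_valid hu
  have hα := represents_of_valid hα
  have hβ := represents_of_valid hβ
  constructor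
  · rw [diff_cochain hy, cochain_eq_zero h1]
  · rw [diff_cochain hu]
    refine cochain_eq_of_dvd ?_ h2
    rw [cochain_timesX e _ hy]
    module
  · rw [codiff_cochain hα, cochain_eq_zero h3]
  · intro x
    rw [codiff_cochain hβ]
    exact Chain.dvd_coeff h4 _ _
  · exact eq_zero_of_withBit h5
  · exact fun x hx => (eq_of_withBit hα h6 x hx).trans (one_mul _)
  · rw [sum_cochain_mul hα, h7]

open Classical in
theorem cochain_generator (o : (braidClosure w).Generator) (c : ℤ)
    (x : (braidClosure w).Generator) :
    cochain w [(vertexCode o.1, [(labelCode o, c)])] x = if x = o then c else 0 := by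
  rw [cochain_singleton]
  by_cases h : x = o
  · subst h
    simp [Terms.coeff]
  · rw [if_neg h]
    split_ifs with h1
    · have h2 : labelCode o ≠ labelCode x := fun h2 => h (eq_of_codes_eq h1 h2).symm
      simp [Terms.coeff, h2]
    · rfl

end Braid

/-! ### The trefoil and `L₃` -/

section Links

open Code

/-- With all crossings 1-smoothed (code 21) there are three circles A, B, C, with masks 195, 12 and
48, where A passes through the base edge 0. The last changes of smoothing split A|B, B|C and C|A,
with signs +, −, +. -/
theorem isTopRelation_trefoil : ∃ y u α β, IsTopRelation trefoil
    (braidClosureEdge wordTrefoil 0) 2 y u α β :=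
  ⟨_, _, _, _, isTopRelation_cochain (w := wordTrefoil) (S := 2) (N := 6) (i := 0)
    -- `y` has label 1 on all three circles. Writing A for `y` with X on A, the boundary of `u` is
    -- (A + B) − (B + C) + (C + A) = 2A. The functional β takes the value 1 on each of A, B and C,
    -- hence 2 up to sign on each of these boundaries.
    (ps := [0, 2, 4]) rfl rfl rfl rfl 2 (k := 21) (l := [(0, 1)]) (y := [(21, [(0, 1)])])
    (u := [(20, [(0, 1)]), (17, [(0, 1)]), (5, [(0, 1)])])
    (β := [(21, [(195, 1), (12, 1), (48, 1)])]) (by decide +kernel) (by decide +kernel)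
    (by decide +kernel) (by decide +kernel) (by decide +kernel) (by decide +kernel)
    (by decide +kernel) (by decide +kernel) (by decide +kernel) (by decide +kernel)
    (by decide +kernel)⟩

/-- A cocycle of homological degree `9` of `L₃` that generates the cohomology in this degree. -/
def scalingCocycle : Chain :=
  [(9361242556731424, [(0, -1)]), (9288760667804704, [(0, -1)]), (9359112232113153, [(0, 1)]),
  (9077653919241248, [(13418496, 1), (53673984, -1)]), (351929641206817, [(54962159616, 1),
  (900500023148544, 1)]), (9009484198319105, [(13418496, 1), (53673984, -1)]), (351861458605057,
  [(13418496, -1), (53673984, 1)]), (9361242556858400, [(0, -1)]), (354043301991425, [(13418496,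
  -1), (53673984, 1)]), (9359060709151776, [(0, 1)]), (9361310739337248, [(0, -1)]),
  (354111484593185, [(0, -1)]), (9009484730995744, [(0, -1)]), (9009484714349600, [(0, -1)]),
  (9361310739334176, [(0, -1)]), (9009484714349569, [(0, -1)]), (9009484730995713, [(0, -1)]),
  (351929641209889, [(54962159616, 1), (900500023148544, 1)]), (351861458731041, [(0, -1)]),
  (9077654451917825, [(0, -1)]), (9359112236176416, [(0, 1)]), (9288760684450848, [(0, -1)]),
  (354043301990433, [(0, -1)]), (9359060692505601, [(0, 1)]), (9359112248759297, [(0, 1)]),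
  (9288760671867905, [(0, -1)]), (9009484718412832, [(0, -1)]), (9077654439334944, [(0, -1)]),
  (354043302117409, [(0, -1)]), (351929641336865, [(54962159616, 1), (900500023148544, 1)]),
  (9359128895950880, [(54962159616, 1), (900500023148544, 1)]), (9361242535892000, [(0, 1)]),
  (9359111716082720, [(13418496, -1), (53673984, 1)]), (9359060713345056, [(0, -1)]),
  (9288760151774240, [(13418496, 1), (53673984, -1)]), (9359060692505632, [(0, 1)]),
  (9359112248759328, [(0, 1)]), (354111484596257, [(0, -1)]), (9359128896077856, [(54962159616,
  1), (900500023148544, 1)]), (9359112232113184, [(0, 1)]), (9288760667804673, [(0, -1)]),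
  (9359060696568833, [(0, 1)]), (9359060696568864, [(0, 1)]), (9361242552538144, [(0, 1)]),
  (9009484718412801, [(0, -1)]), (9361242539955201, [(0, 1)]), (9288760671867936, [(0, -1)]),
  (354111484597249, [(13418496, -1), (53673984, 1)]), (9359060713341984, [(0, -1)]),
  (9361310739464224, [(0, -1)]), (9077654439334913, [(0, -1)]), (9359060709151745, [(0, 1)]),
  (351861458600993, [(0, -1)]), (9359111716082689, [(13418496, -1), (53673984, 1)]),
  (9361242552538113, [(0, 1)]), (9288760684450817, [(0, -1)]), (9077654435271712, [(0, -1)]),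
  (9077653919241217, [(13418496, 1), (53673984, -1)]), (9359112236176385, [(0, 1)]),
  (9361242556728352, [(0, -1)]), (351861458604065, [(0, -1)]), (9077654451917856, [(0, -1)]),
  (351929641210881, [(54975578112, 1), (55015833600, -1), (900500036567040, 1), (900500076822528,
  -1)]), (9077654435271681, [(0, -1)]), (9359060713472032, [(0, -1)]), (9361242535891969, [(0,
  1)]), (9359128895947808, [(54962159616, 1), (900500023148544, 1)]), (9361242539955232, [(0,
  1)]), (354111484723233, [(0, -1)]), (9288760151774209, [(13418496, 1), (53673984, -1)]),
  (354043301987361, [(0, -1)]), (9009484198319136, [(13418496, 1), (53673984, -1)])]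

/-- A cochain that shows that `X` on the unknot component acts on `scalingCocycle` as `3 X` on the
component `T(3, 4)`. -/
def scalingPrimitive : Chain :=
  [(9009467014382625, [(0, -1)]), (72653687751681, [(54962159616, 1)]), (9288743492128769, [(0,
  1)]), (9290873812553760, [(0, -1)]), (9359043512636417, [(0, 1)]), (9288760134996993,
  [(1152020729705794767, -1), (219902312448, -1)]), (283760440382464, [(0, -1)]),
  (9290873791714336, [(0, 1)]), (354111484724224, [(0, -1)]), (9361242003084320, [(0, 1)]),
  (354111484597248, [(229683580995908403, -1), (13418496, -1)]), (9288691952391169, [(0, 1)]),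
  (9288691432297473, [(13418496, -1), (53673984, 1)]), (9359128896077824, [(54962159616, -1),
  (900500023148544, -1)]), (9288691952391200, [(0, 1)]), (354043302117408, [(0, -1)]),
  (9359128895950848, [(54962159616, -1), (900500023148544, -1)]), (9290890438775809, [(0, -1)]),
  (9288691432297504, [(13418496, -1), (53673984, 1)]), (9361242015667201, [(0, 1)]),
  (354043297923105, [(0, -2)]), (9359111716081665, [(1151795604713426127, 1), (53673984, -1)]),
  (70455184593921, [(922112023704112332, 1), (13104, -1)]), (9288760151773216,
  [(719675165491658649, -1), (219848638464, -1)]), (9077654439330817, [(0, 1)]),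
  (9288691948327937, [(0, 1)]), (9359128879173633, [(219902312448, -1), (225125005787136, -1)]),
  (351861458731040, [(0, -1)]), (9077637272048672, [(0, -1)]), (9079767563244576, [(0, -1)]),
  (9361310739333121, [(0, 1)]), (9359042996605953, [(13418496, -1), (53673984, 1)]),
  (2284943578113, [(53673984, 1), (54962159616, 1)]), (351930161300481, [(922112023704112332, 1),
  (900500023148544, 1)]), (70454664500225, [(230584081032462339, 2), (230584081072717827, -2),
  (922112023757786316, 1), (53687088, -1), (922112078666271948, 1), (54975578112, 2),
  (55015833600, -1)]), (9077653915046913, [(1152696104723156175, 1), (54975578112, 1)]),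
  (9290890438905888, [(0, 1)]), (283742736352289, [(0, -1)]), (72568325279777, [(0, -2)]),
  (283742736356353, [(0, 1)]), (351861458732032, [(0, -1)]), (9361242539954177, [(0, -1)]),
  (9288743504581633, [(0, 1)]), (9361310739337216, [(0, 1)]), (351930161304576,
  [(229683580995908403, 1), (922112023704112332, -1)]), (9361241999021057, [(0, 1)]),
  (9079835758560288, [(0, 1)]), (283742740415521, [(0, -1)]), (9009467018449921,
  [(1124105283950349519, 1), (53673984, 1)]), (9288691964974081, [(0, 1)]), (70386481894401,
  [(13418496, -2), (53673984, 2)]), (351861454410753, [(922112023704112332, -1), (900774847365120,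
  -2), (53673984, 1)]), (9359111699305473, [(13418496, -1), (219902312448, 1)]), (351929641209888,
  [(54962159616, 1), (900500023148544, 1)]), (9009467534476321, [(0, -1)]), (9007285695157249,
  [(0, 1)]), (354043285214209, [(922112023704112332, -1), (1118864736976896, -1)]),
  (72653687755776, [(53673984, -1), (54962159616, -1)]), (9077637255402497, [(0, -1)]),
  (9079835758559265, [(0, -2)]), (9361259178759200, [(0, 1)]), (9359043529282561, [(0, 1)]),
  (351861458605056, [(229683580995908403, -1), (13418496, -1)]), (70454664496161,
  [(230584081019043843, 2), (54962159616, 1)]), (9079767575953441, [(0, -2)]), (72568325406753,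
  [(0, -2)]), (9361259178759169, [(0, 1)]), (72636507885601, [(0, -2)]), (70454660436993,
  [(922112023704112332, 1), (13104, -1)]), (9361259182952449, [(0, -1)]), (72636507882529, [(0,
  -2)]), (9359043516699680, [(0, 1)]), (9077637259465760, [(0, -1)]), (9288743487935520, [(0,
  1)]), (9359060713340929, [(0, 1)]), (9288691964974112, [(0, 1)]), (9359128895946784,
  [(54962159616, -1), (900500023148544, -1)]), (9290873808360449, [(0, 1)]), (9288691948327968,
  [(0, 1)]), (9077585715790881, [(0, 1)]), (9079767575954464, [(0, 1)]), (9361310735139872, [(0,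
  1)]), (354111484596256, [(0, -1)]), (72654203786240, [(0, -1)]), (351929641336864,
  [(54962159616, 1), (900500023148544, 1)]), (9361242556727328, [(0, 1)]), (9290890438905857, [(0,
  1)]), (354111484593153, [(229683580995895299, 1), (13418496, 1)]), (9361259182952480, [(0,
  -1)]), (9359112236175392, [(0, -1)]), (70386481893409, [(0, -2)]), (283743256450049, [(0, 1)]),
  (9290890438775840, [(0, -1)]), (9077585736631328, [(0, 1)]), (70454664626209,
  [(230584081019043843, 2), (54962159616, 2)]), (283743256445985, [(0, -1)]), (9361242539954208,
  [(0, -1)]), (9361242003084289, [(0, 1)]), (9009484194251777, [(0, 1)]), (9009467538539553, [(0,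
  -1)]), (9288743492128800, [(0, 1)]), (9361242556731392, [(0, 1)]), (9009467534480385, [(0, 1)]),
  (351929641337856, [(54962159616, 1), (900500023148544, 1)]), (9009484194255872, [(0, -1)]),
  (351861437760545, [(0, 1)]), (9359128895946753, [(54962159616, -1), (900500023148544, -1)]),
  (354043297796129, [(0, -2)]), (351929637143553, [(922112023704112332, 1), (900500023148544,
  1)]), (9079835758432289, [(0, -2)]), (9288760151773185, [(1152020729719213263, -1),
  (219848638464, -1)]), (9361242535760928, [(0, 1)]), (9079767563240481, [(0, 1)]),
  (9007285691094017, [(0, 1)]), (354043285210145, [(0, 1)]), (9079767575826465, [(0, -2)]),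
  (9288760135127041, [(0, 1)]), (9077653915173920, [(0, -1)]), (351861454406689, [(0, -1)]),
  (354043301987329, [(229683580995895299, 1), (13418496, 1)]), (9077653919237152,
  [(720350540549275545, -1), (54962159616, -1)]), (9359060176474144, [(719450040485871513, -1),
  (53673984, 1)]), (9077585732567073, [(0, -2)]), (70455201367041, [(274810798080, 1)]),
  (9009484714345473, [(0, 1)]), (354111480401953, [(0, -2)]), (9290873791714305, [(0, 1)]),
  (283742740419585, [(923237703695207628, 1), (53673984, 1)]), (9007285175063584, [(13418496, -1),
  (53673984, 1)]), (9079835758433281, [(0, -1)]), (351861454536737, [(0, -2)]), (2285459608608,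
  [(0, 1)]), (9009467018445857, [(0, -1)]), (351861441827841, [(922112023704112332, -1),
  (900774887620608, -1)]), (9077585719858177, [(0, -2)]), (351929637015585, [(922112078679703548,
  2), (900500023148544, 2)]), (72636507886593, [(13418496, -2), (53673984, 2)]), (351929637142561,
  [(922112078732958204, 2), (900500023148544, 2)]), (283760440378369, [(0, 1)]),
  (9007285707740192, [(0, 1)]), (354043301990432, [(0, -1)]), (9359043512636448, [(0, 1)]),
  (354043281150977, [(922112023704112332, -1), (1118863032827904, -1)]), (2285463671809, [(0,
  1)]), (72653683692544, [(0, -1)]), (9009484198319104, [(53673984, -1), (54962159616, -1)]),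
  (9077585715794945, [(0, -2)]), (354043297793057, [(0, -1)]), (9009484194124801,
  [(1124105228988189903, -1), (28816000740753408, 1)]), (351930157241344, [(229683580995908403,
  1), (922112023704112332, -1)]), (351929641206785, [(922112023757799420, 1), (229683635958054915,
  -2), (922112078666271948, 1), (54975578112, -1), (230584081019043843, -1), (900500076835632, 1),
  (900500036567040, -1)]), (9359128879173664, [(219902312448, -1), (225125005787136, -1)]),
  (9077585732568096, [(0, 1)]), (9079835762623520, [(0, 1)]), (283743260509217, [(0, -1)]),
  (283759916221441, [(0, 1)]), (9361310739464192, [(0, 1)]), (351930157237249,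
  [(922112023704112332, 1), (900500023148544, 1)]), (9359042996605984, [(13418496, -1), (53673984,
  1)]), (283760436319232, [(0, -1)]), (9288743504581664, [(0, 1)]), (72636508012577, [(0, -2)]),
  (9361241999021088, [(0, 1)]), (351929637012513, [(54975578112, 1), (900500023148544, 1)]),
  (351929641210880, [(229683581049582387, 1), (922112023757786316, -1), (229683635958068019, 2),
  (922112078666271948, -1), (54975578112, 1), (230584081019056947, 1), (900500036567040, 1)]),
  (9359128874980353, [(54975578112, -1), (219902312448, 1)]), (9009467538543617, [(0, 1)]),
  (2285459608577, [(0, 1)]), (72568325276705, [(0, -2)]), (70455180530689, [(922112023704112332,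
  1), (13104, -1)]), (70386481890337, [(0, -2)]), (351929637016577, [(922112078679690444, 1),
  (55029252096, -1), (923012523727260876, 1), (900554998726656, 2), (900500076822528, -1)]),
  (9290873795907585, [(0, 1)]), (72568325280769, [(13418496, -2), (53673984, 2)]),
  (283760436315137, [(0, 1)]), (9077653915173889, [(0, 1)]), (9361242556727297, [(0, 1)]),
  (283759920288768, [(53673984, -1), (54962159616, -1)]), (9079767575827457, [(0, -2)]),
  (9359128874980384, [(54975578112, -1), (219902312448, 1)]), (9361242535760897, [(0, 1)]),
  (9077654435267585, [(0, 1)]), (9359060176474113, [(1151795604713426127, -1), (53673984, 1)]),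
  (354043297797121, [(922112023704112332, -1), (1118864696721408, -2), (53673984, 1)]),
  (9079767559181313, [(0, -2)]), (9079767563244545, [(0, -2)]), (9359111716081696,
  [(719450040485871513, 1), (53673984, -1)]), (9077636739372033, [(13418496, 1), (53673984, -1)]),
  (2284939514881, [(0, 1)]), (9359060713340960, [(0, 1)]), (9007285707740161, [(0, 1)]),
  (354111480398881, [(0, -1)]), (9361310739333152, [(0, 1)]), (9007285695157280, [(0, 1)]),
  (9077585719854113, [(0, 1)]), (9359112236175361, [(0, -1)]), (9077637259465729, [(0, -1)]),
  (9077653915045921, [(0, 2)]), (354111480402945, [(922112023704112332, -1), (1125680004513792,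
  -2), (53673984, 1)]), (9009484714349568, [(0, -1)]), (70454664499233, [(230584081019043843, 2),
  (54962159616, 2)]), (9009467014386689, [(0, 1)]), (351861441823777, [(0, 1)]),
  (9077637272048641, [(0, -1)]), (9361242556858368, [(0, 1)]), (9077585732440097, [(0, -2)]),
  (72654207849472, [(0, -1)]), (9290890455552032, [(0, -1)]), (9359060713345024, [(0, 1)]),
  (9288760134997024, [(719675165478240153, -1), (219902312448, -1)]), (9290873812553729, [(0,
  -1)]), (354111484723232, [(0, -1)]), (2284939514912, [(0, 1)]), (9288743508774913, [(0, -1)]),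
  (9079767559177249, [(0, 1)]), (9359111699305504, [(13418496, -1), (219902312448, 1)]),
  (9079835758433312, [(0, 1)]), (351929637147648, [(229683580995908403, 1), (922112023704112332,
  -1)]), (9009484194124832, [(691759664760635289, -1), (28816000740753408, 1)]), (354043302118400,
  [(0, -1)]), (9077653915046944, [(720350540495601561, -1), (54975578112, -1)]),
  (9359060172280833, [(54975578112, 1), (53673984, -1)]), (9361310718366752, [(0, 1)]),
  (9077585719858208, [(0, -1)]), (9007285691094048, [(0, 1)]), (351861458604064, [(0, -1)]),
  (9077637255402528, [(0, -1)]), (9359060709147680, [(0, 1)]), (9077636739372064, [(13418496, 1),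
  (53673984, -1)]), (351861437764609, [(922112023704112332, -1), (900773183471616, -1)]),
  (9290873795907616, [(0, 1)]), (2284943578144, [(53673984, 1), (54962159616, 1)]),
  (351861458600961, [(229683580995895299, 1), (13418496, 1)]), (9077585715794976, [(0, -1)]),
  (9359128891753504, [(54975578112, -1), (900500023148544, -1)]), (283759916225536, [(0, -1)]),
  (9079767580017696, [(0, 1)]), (9361242552534048, [(0, 1)]), (9077653915172897, [(0, 2)]),
  (9077653919237121, [(53687088, 1)]), (9079767559181344, [(0, -1)]), (9359060172280864,
  [(54975578112, 1), (53673984, -1)]), (9288743487935489, [(0, 1)]), (354043281146913, [(0, 1)]),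
  (70386482020385, [(0, -2)]), (9009484198315009, [(53687088, 1), (54962159616, 1)]),
  (2285463671840, [(0, 1)]), (9361310718366721, [(0, 1)]), (9009484718412800, [(0, -1)]),
  (354111480528929, [(0, -2)]), (9007285175063553, [(13418496, -1), (53673984, 1)]),
  (9359043529282592, [(0, 1)]), (9077585732441089, [(0, -2)]), (283743260513281, [(0, 1)]),
  (9290873808360480, [(0, 1)]), (351861454409761, [(0, -2)]), (9359060713472000, [(0, 1)]),
  (283759920284673, [(53687088, 1), (54962159616, 1)]), (9288760135127072, [(0, 1)]),
  (9288743508774944, [(0, -1)]), (354043301991424, [(229683580995908403, -1), (13418496, -1)]),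
  (9359043516699649, [(0, 1)]), (9290890455552001, [(0, -1)]), (9009484718408705, [(0, 1)]),
  (9361242015667232, [(0, 1)]), (70454664627201, [(54962159616, 1)])]

/-- A functional that detects the product of `scalingCocycle` with `X`. -/
def scalingDual : Chain :=
  [(9361242552665089, [(0, -2)]), (9361259199856672, [(54962159616, -2)]), (9077654435271712,
  [(1717567488, -2), (225125005787136, -2)]), (9361242556858400, [(432345564227567718, 4),
  (419328, -4), (7035156430848, 2)]), (9361259732403232, [(0, -2)]), (354043302117409,
  [(229683580995895299, -1), (922112023770798588, -3), (419328, 3), (1118864683302912, 3),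
  (7035156430848, -1)]), (9361259195663392, [(0, -2)]), (9359112253079584, [(900500023148544,
  -2)]), (351929637143585, [(225125005787136, -2)]), (9077653915178016, [(55029252096, 2)]),
  (9359129428624416, [(900500023148544, 2)]), (9009484714349569, [(13104, 2)]), (9359128891884576,
  [(900500023148544, 2)]), (354111484723233, [(1125679991095296, -2)]), (9009484714349600,
  [(432345564227567718, -2), (28816000740753408, 2)]), (9077653919371296, [(54962159616, -2)]),
  (354112017269793, [(0, -2)]), (283759920414753, [(54962159616, 2)]), (9077637276373024, [(0,
  2)]), (72637044883489, [(0, -2)]), (9359129411978241, [(225125005787136, -2)]),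
  (283759916221473, [(0, 2)]), (9290959691056129, [(0, 2)]), (9361311255364609, [(0, -2)]),
  (9361242556728352, [(13418496, 4)]), (283760452961313, [(0, 2)]), (9361242552534049, [(0, -2)]),
  (9077637276242976, [(13418496, 2)]), (351930174014465, [(225125005787136, -2)]),
  (9359128896077856, [(900554985308160, 2)]), (354111480529953, [(0, -2)]), (9077637272179744,
  [(0, -2)]), (351912998338593, [(900500023148544, -2)]), (354112017400833, [(0, -2)]),
  (283760453092353, [(0, 2)]), (9077654451917856, [(53673984, 2)]), (351929641336865,
  [(225179967946752, -2)]), (9077653919241248, [(54975578112, -2)]), (351930173883425,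
  [(225125005787136, -2)])]

/-- The indices of the crossings of `L₃`. -/
def crossingsL3 : List ℕ := [0, 5, 10, 12, 17, 22, 24, 29, 34, 36, 41, 46, 48, 53]

theorem crossingsL3_eq :
    crossingsL3 = (List.finRange (braidClosure wordL3).n).map crossingIndex := rfl

theorem isScalingClass_L3 : ∃ ζ η α β, IsScalingClass L3 L3torus L3unknot 3 ζ η α β :=
  ⟨_, _, _, _, isScalingClass_cochain (w := wordL3) (S := 4) (N := 56) (i := 0) (j := 3)
    -- α is minus the coefficient of the generator with label 1 on all circles of one resolution;
    -- this generator occurs in `scalingCocycle` with coefficient −1. The edge indices 0 and 3 are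
    -- the first and the last strand at the start of the braid.
    rfl rfl crossingsL3_eq rfl rfl 3 (k := 354043302117409) (l := [(0, -1)])
    (ζ := scalingCocycle) (η := scalingPrimitive) (β := scalingDual)
    (by decide +kernel) (by decide +kernel) (by decide +kernel) (by decide +kernel)
    (by decide +kernel) (by decide +kernel) (by decide +kernel) (by decide +kernel)
    (by decide +kernel) (by decide +kernel) (by decide +kernel) (by decide +kernel)
    (by decide +kernel) (by decide +kernel)⟩

/-- A cocycle of homological degree `0` of `L₃`. -/
def degreeZeroCocycle : Chain :=
  -- With all crossings 0-smoothed the circles are the four strands. Term number j has label 1 on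
  -- strand j and X elsewhere, with sign (−1)^j. Every crossing merges neighbouring strands, so the
  -- two surviving terms cancel. X on the last strand leaves only minus the generator with all
  -- labels X.
  [(0, [(1076060070966390510, 1), (999198637325934045, -1), (845475770045021115, 1), (538030035483195255, -1)])]

open Classical in
/-- A cocycle of homological degree `0` on which `X` at the unknot component acts as a single
generator. -/
theorem exists_degree_zero_cocycle : ∃ (κ : L3.Generator → ℤ) (o : L3.Generator), diff κ = 0 ∧
    (∀ x, (-1) ^ x.weight * κ x = κ x) ∧ (∀ x, mulX L3unknot κ x = if x = o then -1 else 0) ∧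
    o.lab L3torus = 1 ∧ o.lab L3unknot = 1 ∧ o.weight = 0 := by
  have hκ : Represents wordL3 degreeZeroCocycle :=
    represents_of_valid (show Chain.valid 4 56 crossingsL3 _ = true by decide +kernel)
  -- The mask is 2^60 − 1: all 15 · 4 edges carry the label X.
  have ho : Represents wordL3 [(0, [(1152921504606846975, -1)])] :=
    represents_of_valid (show Chain.valid 4 56 crossingsL3 _ = true by decide +kernel)
  obtain ⟨v, hv, hl⟩ := ho _ (List.mem_singleton_self _)
  obtain ⟨o, rfl, ho⟩ := hl _ (List.mem_singleton_self _)
  dsimp only at hv ho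
  refine ⟨cochain wordL3 degreeZeroCocycle, o, ?_, ?_, ?_, ?_, ?_, ?_⟩
  · exact (diff_cochain hκ).trans (cochain_eq_zero
      (show (fwd 4 56 crossingsL3 degreeZeroCocycle).dvd 0 = true by decide +kernel))
  · intro x
    have := neg_one_pow_weight_mul_cochain (w := wordL3) (r := 0)
      (show Chain.hasParity crossingsL3 0 degreeZeroCocycle = true by decide +kernel) x
    rwa [pow_zero, one_mul] at this
  · intro x
    have h1 := cochain_timesX (w := wordL3) L3unknot 1 hκ
    rw [one_smul] at h1
    have h2 := cochain_generator (w := wordL3) o (-1)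
    rw [hv, ho] at h2
    have h3 : cochain wordL3 [(0, [(1152921504606846975, 1)])] =
        (-1 : ℤ) • cochain wordL3 [(0, [(1152921504606846975, -1)])] := by
      funext x
      simp [cochain, Chain.coeff, Terms.coeff]
    exact (congrFun (h1.symm.trans (cochain_eq_of_dvd h3
      (show (timesX 4 56 3 1 degreeZeroCocycle ++ _).dvd 0 = true by decide +kernel))) x).trans
      (h2 x)
  · have := bit_labelCode (w := wordL3) o L3torus
    rw [ho] at this
    exact of_decide_eq_true (this.symm.trans (show bit 1152921504606846975 0 = true by decide +kernel))
  · have := bit_labelCode (w := wordL3) o L3unknot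
    rw [ho] at this
    exact of_decide_eq_true (this.symm.trans (show bit 1152921504606846975 3 = true by decide +kernel))
  · refine (weight_eq (w := wordL3) o).symm.trans ?_
    rw [hv]
    exact (show crossingsL3.countP (bit 0) = 0 by decide +kernel)

/-- The trefoil contributes the factor 2 and each `L3` a factor 3. The new base edge lies on the
torus component, ready for the unknot component of the next factor on the left. -/
theorem exists_isTopRelation (l : ℕ) : ∃ y u α β,
    IsTopRelation (L3sumPointed l).1 (L3sumPointed l).2 ((2 : ℕ) * (3 ^ l : ℕ)) y u α β := by
  induction l with
  | zero => exact isTopRelation_trefoil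
  | succ l ih =>
    obtain ⟨y, u, α, β, h⟩ := ih
    obtain ⟨ζ, η, α', β', h'⟩ := isScalingClass_L3
    have hm : (((2 : ℕ) : ℤ) * (3 ^ (l + 1) : ℕ)) = 3 * (((2 : ℕ) : ℤ) * (3 ^ l : ℕ)) := by
      push_cast
      ring
    rw [hm]
    exact ⟨_, _, _, _, h.connectedSum h'⟩

/-- The `l` factors next to the trefoil build up the order 3^l; the `d` factors further to the left
only transport the class. -/
theorem exists_isTorsionClass (l d : ℕ) : ∃ z u φ,
    IsTorsionClass (L3sumPointed (l + d)).1 (L3sumPointed (l + d)).2 (3 ^ l) z u φ := by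
  induction d with
  | zero =>
    obtain ⟨y, u, α, β, h⟩ := exists_isTopRelation l
    refine ⟨_, _, _, h.isTorsionClass ?_⟩
    rw [Nat.isCoprime_iff_coprime]
    exact Nat.Coprime.pow_right _ (by decide)
  | succ d ih =>
    obtain ⟨z, u, φ, h⟩ := ih
    obtain ⟨κ, o, h1, h2, h3, h4, h5, h6⟩ := exists_degree_zero_cocycle
    exact ⟨_, _, _, h.connectedSum h1 h2 h3 h4 h5 h6⟩

end Links

end LinkDiagram

theorem theorem1 (k : ℕ) (hk : 0 < k) (l : ℕ) (hl : 1 ≤ l) (hlk : l ≤ k) :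
    ∃ i j : ℤ, HasDirectSummand ((LinkDiagram.L3sum k).Kh i j) (ZMod (3 ^ l)) := by
  obtain ⟨d, rfl⟩ := Nat.exists_eq_add_of_le hlk
  obtain ⟨z, u, φ, h⟩ := LinkDiagram.exists_isTorsionClass l d
  exact h.exists_hasDirectSummand Nat.prime_three hl

end
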